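/- Let $n\ge 2$ and let $g(\sigma)=\sum_{i=0}^N a_i\sigma^{\alpha_i}$, $\sigma\ge 0$, where $N\ge 1$, $0=\alpha_0<\alpha_1<\dots<\alpha_N$ are real, $a_i\ge 0$, $a_0>0$ and $a_N>0$. Set $a=\frac{\alpha_N}{1+\alpha_N}\in(0,1)$ and, for $\xi\ge 0$, let $K(\xi)=1/g(\sigma(\xi))$, where $\sigma(\xi)\ge 0$ is the unique solution of $\sigma g(\sigma)=\xi$. Let $U\subset\mathbb R^n$ be a bounded open set, let $U',V$ be open sets with $U'\Subset V\Subset U$, and let $s\ge 2$ be real. Then there is a constant $C>0$, depending only on $n,g,U,V,U',s$, such that the following holds for every $p$ of class $C^{2,1}$ on $U\times(0,\infty)$ (that is, $p,\partial_t p,\nabla p,\nabla^2p$ exist and are continuous there; $\nabla$ acts in $x$) with $$\partial_t p=\nabla\cdot\big(K(|\nabla p|)\nabla p\big)\quad\text{in } U\times(0,\infty),$$ and all $T_0\ge 0$, $T>0$, $\theta\in(0,1)$ (both sides take values in $[0,\infty]$): $$\int_{T_0+\theta T}^{T_0+T}\!\int_{U'}K(|\nabla p|)|\nabla p|^s\,dx\,dt\le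 C\big(1+(\theta T)^{-1}\big)^{s-2}\Big(1+\sup_{t\in[T_0+\theta T/2,\,T_0+T]}\|p(t)\|_{L^\infty(V)}^2\Big)^{s-2}\int_{T_0}^{T_0+T}\!\int_U\big(1+K(|\nabla p|)|\nabla p|^2\big)\,dx\,dt$$ and $$\sup_{t\in[T_0+\theta T,\,T_0+T]}\int_{U'}|\nabla p(x,t)|^s\,dx\le C\big(1+(\theta T)^{-1}\big)^{s+a-1}\Big(1+\sup_{t\in[T_0+\theta T/2,\,T_0+T]}\|p(t)\|_{L^\infty(V)}^2\Big)^{s-2+a}\int_{T_0}^{T_0+T}\!\int_U\big(1+K(|\nabla p|)|\nabla p|^2\big)\,dx\,dt.$$ -/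

import Mathlib

open MeasureTheory Set

/-- A generalized Forchheimer polynomial
`g(s) = a₀ s^{α₀} + a₁ s^{α₁} + ⋯ + a_N s^{α_N}` with `N ≥ 1`, real exponents
`0 = α₀ < α₁ < ⋯ < α_N`, non-negative coefficients, `a₀ > 0` and `a_N > 0`. -/
structure ForchheimerPoly where
  N : ℕ
  one_le_N : 1 ≤ N
  coeff : Fin (N + 1) → ℝ
  expo : Fin (N + 1) → ℝ
  coeff_nonneg : ∀ i, 0 ≤ coeff i
  coeff_zero_pos : 0 < coeff 0
  coeff_last_pos : 0 < coeff (Fin.last N)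
  expo_zero : expo 0 = 0
  expo_strictMono : StrictMono expo

namespace ForchheimerPoly

/-- The value `g(s)` (used for `s ≥ 0` only; `0 ^ 0 = 1`, so that `g(0) = a₀`). -/
noncomputable def eval (g : ForchheimerPoly) (s : ℝ) : ℝ :=
  ∑ i, g.coeff i * s ^ g.expo i

/-- The exponent `a = α_N / (1 + α_N) ∈ (0,1)`. -/
noncomputable def a (g : ForchheimerPoly) : ℝ :=
  g.expo (Fin.last g.N) / (1 + g.expo (Fin.last g.N))

/-- The solution `s = s(ξ) ≥ 0` of `s g(s) = ξ`, for `ξ ≥ 0`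
(existence and uniqueness: `root_spec`, `root_unique`). -/
noncomputable def root (g : ForchheimerPoly) (ξ : ℝ) : ℝ :=
  Function.invFunOn (fun s => s * g.eval s) (Ici 0) ξ

/-- `K(ξ) = 1 / g(s(ξ))`. -/
noncomputable def K (g : ForchheimerPoly) (ξ : ℝ) : ℝ :=
  1 / g.eval (g.root ξ)

theorem expo_nonneg (g : ForchheimerPoly) (i : Fin (g.N + 1)) : 0 ≤ g.expo i := by
  rw [← g.expo_zero]
  exact g.expo_strictMono.monotone (Fin.zero_le i)

theorem coeff_zero_le_eval (g : ForchheimerPoly) {s : ℝ} (hs : 0 ≤ s) :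
    g.coeff 0 ≤ g.eval s := by
  have h := Finset.single_le_sum (f := fun i => g.coeff i * s ^ g.expo i)
    (fun i _ => mul_nonneg (g.coeff_nonneg i) (Real.rpow_nonneg hs _)) (Finset.mem_univ 0)
  simpa [g.expo_zero, eval] using h

theorem eval_mono (g : ForchheimerPoly) {s t : ℝ} (hs : 0 ≤ s) (h : s ≤ t) :
    g.eval s ≤ g.eval t :=
  Finset.sum_le_sum fun i _ =>
    mul_le_mul_of_nonneg_left (Real.rpow_le_rpow hs h (g.expo_nonneg i)) (g.coeff_nonneg i)

theorem continuous_eval (g : ForchheimerPoly) : Continuous g.eval :=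
  continuous_finsetSum _ fun i _ =>
    continuous_const.mul (Real.continuous_rpow_const (g.expo_nonneg i))

theorem root_spec (g : ForchheimerPoly) {ξ : ℝ} (hξ : 0 ≤ ξ) :
    0 ≤ g.root ξ ∧ g.root ξ * g.eval (g.root ξ) = ξ := by
  have ha := g.coeff_zero_pos
  have hb : 0 ≤ ξ / g.coeff 0 := by positivity
  have hc : ContinuousOn (fun s => s * g.eval s) (Icc 0 (ξ / g.coeff 0)) :=
    (continuous_id.mul g.continuous_eval).continuousOn
  have hmem : ξ ∈ Icc (0 * g.eval 0) (ξ / g.coeff 0 * g.eval (ξ / g.coeff 0)) := by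
    refine ⟨by simpa using hξ, ?_⟩
    calc ξ = ξ / g.coeff 0 * g.coeff 0 := by field_simp
      _ ≤ _ := mul_le_mul_of_nonneg_left (g.coeff_zero_le_eval hb) hb
  obtain ⟨s, hs, hs'⟩ := intermediate_value_Icc hb hc hmem
  have hex : ∃ s ∈ Ici (0 : ℝ), s * g.eval s = ξ := ⟨s, hs.1, hs'⟩
  exact ⟨Function.invFunOn_mem (f := fun s => s * g.eval s) hex,
    Function.invFunOn_eq (f := fun s => s * g.eval s) hex⟩

theorem root_unique (g : ForchheimerPoly) {s : ℝ} (hs : 0 ≤ s) :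
    g.root (s * g.eval s) = s := by
  have ha := g.coeff_zero_pos
  have key : ∀ x y : ℝ, 0 ≤ x → x < y → x * g.eval x < y * g.eval y := fun x y hx h => by
    have h1 := g.eval_mono hx h.le
    have h2 := g.coeff_zero_le_eval (hx.trans h.le)
    calc x * g.eval x ≤ x * g.eval y := mul_le_mul_of_nonneg_left h1 hx
      _ < y * g.eval y := mul_lt_mul_of_pos_right h (ha.trans_le h2)
  have hnn : 0 ≤ s * g.eval s := mul_nonneg hs (ha.le.trans (g.coeff_zero_le_eval hs))
  obtain ⟨h0, h1⟩ := g.root_spec hnn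
  rcases lt_trichotomy (g.root (s * g.eval s)) s with h | h | h
  · exact absurd h1 (key _ _ h0 h).ne
  · exact h
  · exact absurd h1 (key _ _ hs h).ne'

end ForchheimerPoly

/-- `A ⋐ B`: the closure of `A` is compact and contained in `B`. -/
def CompactlyContained {X : Type*} [TopologicalSpace X] (A B : Set X) : Prop :=
  IsCompact (closure A) ∧ closure A ⊆ B

/-- The spatial gradient `∇p(x,t)` of a function `p(x,t)`. -/
noncomputable def spaceGrad {n : ℕ} (p : EuclideanSpace ℝ (Fin n) → ℝ → ℝ)
    (x : EuclideanSpace ℝ (Fin n)) (t : ℝ) : EuclideanSpace ℝ (Fin n) :=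
  gradient (fun y => p y t) x

/-- The divergence `∑ᵢ ∂ᵢ Fᵢ(x)` of a vector field. -/
noncomputable def divergence {n : ℕ}
    (F : EuclideanSpace ℝ (Fin n) → EuclideanSpace ℝ (Fin n))
    (x : EuclideanSpace ℝ (Fin n)) : ℝ :=
  ∑ i, fderiv ℝ F x (EuclideanSpace.single i 1) i

/-- `p` is of class `C^{2,1}` on `U × (0,∞)`: the derivatives `∂ₜp`, `∇p` and `∇²p` exist there
and, like `p` itself, are continuous in `(x,t)`. -/
structure IsC21On {n : ℕ} (U : Set (EuclideanSpace ℝ (Fin n)))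
    (p : EuclideanSpace ℝ (Fin n) → ℝ → ℝ) : Prop where
  continuousOn : ContinuousOn (fun z : EuclideanSpace ℝ (Fin n) × ℝ => p z.1 z.2)
    (U ×ˢ Ioi 0)
  differentiableAt_time : ∀ x ∈ U, ∀ t > 0, DifferentiableAt ℝ (p x) t
  continuousOn_time : ContinuousOn
    (fun z : EuclideanSpace ℝ (Fin n) × ℝ => deriv (p z.1) z.2) (U ×ˢ Ioi 0)
  differentiableAt_space : ∀ x ∈ U, ∀ t > 0, DifferentiableAt ℝ (fun y => p y t) x
  continuousOn_grad : ContinuousOn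
    (fun z : EuclideanSpace ℝ (Fin n) × ℝ => spaceGrad p z.1 z.2) (U ×ˢ Ioi 0)
  differentiableAt_grad : ∀ x ∈ U, ∀ t > 0, DifferentiableAt ℝ (fun y => spaceGrad p y t) x
  continuousOn_hessian : ContinuousOn
    (fun z : EuclideanSpace ℝ (Fin n) × ℝ => fderiv ℝ (fun y => spaceGrad p y z.2) z.1)
    (U ×ˢ Ioi 0)

/-- `p` is a classical solution of `∂ₜp = ∇·(K(|∇p|)∇p)` in `U × (0,∞)`. No condition at `t = 0`
or on the boundary of `U` is imposed. (The flux `y ↦ K(|y|)y` is of class `C¹` on `ℝⁿ`, so the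
divergence below is one of a differentiable vector field.) -/
structure IsForchheimerSolution {n : ℕ} (g : ForchheimerPoly)
    (U : Set (EuclideanSpace ℝ (Fin n))) (p : EuclideanSpace ℝ (Fin n) → ℝ → ℝ) : Prop where
  regular : IsC21On U p
  equation : ∀ x ∈ U, ∀ t > 0,
    deriv (p x) t = divergence (fun y => g.K ‖spaceGrad p y t‖ • spaceGrad p y t) x

/-! Write q = ∇p. The equation is tested against -∇·(|q|^σ q ζ) with σ ≥ 0 and ζ = (τψ)^(2m+2),
where ψ is a cutoff in space and τ a weight in time that vanishes at the starting time t₀ and is at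
least 1/2 from t₀ + δ on. The time term becomes the derivative of ∫ |q|^(σ+2) ψ^(2m+2). In the space
term the two partial derivatives are exchanged, which leaves the trace of the product of the
Jacobians of K(|q|)q and |q|^σ q. Since 0 ≤ -ξK'(ξ)/K(ξ) ≤ a < 1 and ∇²p is symmetric, that trace is
at least (1-a) K|q|^σ |∇²p|². Terms with ∇ψ are absorbed by Young's inequality. This is
`IsForchheimerSolution.energy_le`; it needs no initial or boundary data.

The second ingredient is a local bound |p| ≤ M. Writing |q|² = ∇p·q and integrating by parts bounds
∫ K|q|^(σ+4) by M² times the Hessian integral, up to lower order terms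
(`integral_flux_le_of_abs_le`). Combining both with s = σ+4 gives ∬ K|q|^s ≤ CΛ ∬ |q|^(s-2), where Λ
= (1+M²)(1+1/δ). No iteration is needed: ξK(ξ) is bounded below for ξ ≥ 1, so |q|^(s-2) is
controlled by K|q|^(s-1), whose exponent lies between 2 and s. Interpolation
(`ForchheimerPoly.rpow_sub_two_mul_pow_le`) lets half of ∬ K|q|^s be absorbed and leaves CΛ^(s-2) ∬
(1+K|q|²). For 2 ≤ s < 4 one interpolates between this base integral and the case s = 4.

For the second inequality the energy estimate with σ = s-2 bounds ∫ |q|^s at a fixed time by (1+1/δ)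
∬ |q|^s. The lower bound ξ^a K(ξ) ≥ c for ξ ≥ 1 reduces this to the first inequality at the exponent
s+a, which explains both exponents in the claim.

Since p is only C^{2,1}, third derivatives and ∂ₜ∇p are unavailable. The exchange of partial
derivatives is proved for C¹ functions by difference quotients (`integral_fderiv_mul_fderiv_comm`),
and the time derivative of the energy comes from the convexity of |y|^(σ+2)
(`hasDerivAt_integral_rpow_grad`). -/

namespace ForchheimerPoly

/-! ### The conductivity K: regularity, logarithmic slope and decay -/

variable (g : ForchheimerPoly)

theorem expo_last_pos : 0 < g.expo (Fin.last g.N) := by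
  rw [← g.expo_zero]
  refine g.expo_strictMono ?_
  have := g.one_le_N
  simp only [Fin.lt_def, Fin.val_zero, Fin.val_last]
  omega

theorem a_pos : 0 < g.a := div_pos g.expo_last_pos (by linarith [g.expo_last_pos])

theorem a_lt_one : g.a < 1 := by
  rw [a, div_lt_one (by linarith [g.expo_last_pos])]
  linarith

theorem eval_pos {s : ℝ} (hs : 0 ≤ s) : 0 < g.eval s :=
  g.coeff_zero_pos.trans_le (g.coeff_zero_le_eval hs)

theorem root_nonneg {ξ : ℝ} (hξ : 0 ≤ ξ) : 0 ≤ g.root ξ := (g.root_spec hξ).1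

theorem root_mul_eval {ξ : ℝ} (hξ : 0 ≤ ξ) : g.root ξ * g.eval (g.root ξ) = ξ :=
  (g.root_spec hξ).2

theorem root_pos {ξ : ℝ} (hξ : 0 < ξ) : 0 < g.root ξ := by
  refine (g.root_nonneg hξ.le).lt_of_ne fun h => ?_
  have := g.root_mul_eval hξ.le
  rw [← h, zero_mul] at this
  exact hξ.ne this

theorem root_zero : g.root 0 = 0 := by
  simpa using g.root_unique le_rfl

/-- With ρ = σ(ξ) ≥ ρ' = σ(η), one has ξ - η = (ρ-ρ')g(ρ) + ρ'(g(ρ)-g(ρ')), where g(ρ) ≥ a₀ and the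
last term is nonnegative. This supplies the continuity of the root. -/
theorem coeff_zero_mul_root_sub_le {ξ η : ℝ} (hξ : 0 ≤ ξ) (hη : 0 ≤ η) :
    g.coeff 0 * |g.root ξ - g.root η| ≤ |ξ - η| := by
  wlog h : g.root η ≤ g.root ξ generalizing ξ η with H
  · rw [abs_sub_comm, abs_sub_comm ξ]
    exact H hη hξ (le_of_not_ge h)
  rw [abs_of_nonneg (sub_nonneg.2 h)]
  refine le_trans ?_ (le_abs_self _)
  have h1 := g.root_mul_eval hξ
  have h2 := g.root_mul_eval hη
  have h3 := g.eval_mono (g.root_nonneg hη) h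
  have h4 := g.coeff_zero_le_eval (g.root_nonneg hξ)
  have h5 := g.root_nonneg hη
  nlinarith [mul_le_mul_of_nonneg_left h3 h5, mul_le_mul_of_nonneg_left h4 (sub_nonneg.2 h)]

theorem root_mono {ξ η : ℝ} (hξ : 0 ≤ ξ) (h : ξ ≤ η) : g.root ξ ≤ g.root η := by
  by_contra! hlt
  have h1 := g.root_mul_eval hξ
  have h2 := g.root_mul_eval (hξ.trans h)
  have h5 := g.root_nonneg (hξ.trans h)
  have h3 := g.eval_mono h5 hlt.le
  have h4 := g.eval_pos (g.root_nonneg hξ)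
  nlinarith [mul_le_mul_of_nonneg_left h3 h5, mul_lt_mul_of_pos_right hlt h4]

theorem continuousOn_root : ContinuousOn g.root (Ici 0) := by
  refine LipschitzOnWith.continuousOn (K := Real.toNNReal (g.coeff 0)⁻¹) ?_
  refine LipschitzOnWith.of_dist_le_mul fun ξ hξ η hη => ?_
  rw [Real.coe_toNNReal _ (inv_nonneg.2 g.coeff_zero_pos.le), Real.dist_eq, Real.dist_eq,
    inv_mul_eq_div, le_div_iff₀' g.coeff_zero_pos]
  exact g.coeff_zero_mul_root_sub_le hξ hη

/-- The Euler derivative `s g'(s)` of a Forchheimer polynomial. -/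
noncomputable def euler (s : ℝ) : ℝ := ∑ i, g.coeff i * (g.expo i * s ^ g.expo i)

theorem continuous_euler : Continuous g.euler :=
  continuous_finsetSum _ fun i _ =>
    continuous_const.mul (continuous_const.mul (Real.continuous_rpow_const (g.expo_nonneg i)))

theorem euler_nonneg {s : ℝ} (hs : 0 ≤ s) : 0 ≤ g.euler s :=
  Finset.sum_nonneg fun i _ =>
    mul_nonneg (g.coeff_nonneg i) (mul_nonneg (g.expo_nonneg i) (Real.rpow_nonneg hs _))

theorem euler_zero : g.euler 0 = 0 := by
  refine Finset.sum_eq_zero fun i _ => ?_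
  by_cases h : g.expo i = 0
  · simp [h]
  · simp [Real.zero_rpow h]

theorem euler_le {s : ℝ} (hs : 0 ≤ s) : g.euler s ≤ g.expo (Fin.last g.N) * g.eval s := by
  rw [euler, eval, Finset.mul_sum]
  refine Finset.sum_le_sum fun i _ => ?_
  have h1 : g.expo i ≤ g.expo (Fin.last g.N) := g.expo_strictMono.monotone (Fin.le_last i)
  have h2 := mul_nonneg (g.coeff_nonneg i) (Real.rpow_nonneg hs (g.expo i))
  nlinarith [mul_le_mul_of_nonneg_right h1 h2]

theorem hasDerivAt_eval {s : ℝ} (hs : 0 < s) : HasDerivAt g.eval (g.euler s / s) s := by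
  have h : HasDerivAt g.eval (∑ i, g.coeff i * (g.expo i * s ^ (g.expo i - 1))) s :=
    HasDerivAt.fun_sum fun i _ => (Real.hasDerivAt_rpow_const (Or.inl hs.ne')).const_mul _
  convert h using 1
  rw [euler, Finset.sum_div]
  refine Finset.sum_congr rfl fun i _ => ?_
  rw [Real.rpow_sub_one hs.ne']
  ring

/-- Inverse function rule for s ↦ s g(s), whose derivative is g(s) + s g'(s). The point ξ = 0 is
excluded because g need not be differentiable at 0 when some exponent is below 1. -/
theorem hasDerivAt_root {ξ : ℝ} (hξ : 0 < ξ) :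
    HasDerivAt g.root (g.eval (g.root ξ) + g.euler (g.root ξ))⁻¹ ξ := by
  have hr := g.root_pos hξ
  have h1 : HasDerivAt (fun s => s * g.eval s) (g.eval (g.root ξ) + g.euler (g.root ξ))
      (g.root ξ) := by
    refine ((hasDerivAt_id (g.root ξ)).mul (g.hasDerivAt_eval hr)).congr_deriv ?_
    rw [id_eq]
    field_simp
  refine HasDerivAt.of_local_left_inverse (f := fun s => s * g.eval s)
    (g.continuousOn_root.continuousAt (Ici_mem_nhds hξ)) h1 ?_ ?_
  · exact (add_pos_of_pos_of_nonneg (g.eval_pos hr.le) (g.euler_nonneg hr.le)).ne'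
  · filter_upwards [lt_mem_nhds hξ] with η hη
    exact g.root_mul_eval hη.le

/-- The logarithmic slope `-ξ K'(ξ) / K(ξ)` of the conductivity. -/
noncomputable def slopeK (ξ : ℝ) : ℝ :=
  g.euler (g.root ξ) / (g.eval (g.root ξ) + g.euler (g.root ξ))

theorem eval_add_euler_pos {s : ℝ} (hs : 0 ≤ s) : 0 < g.eval s + g.euler s :=
  add_pos_of_pos_of_nonneg (g.eval_pos hs) (g.euler_nonneg hs)

theorem slopeK_nonneg {ξ : ℝ} (hξ : 0 ≤ ξ) : 0 ≤ g.slopeK ξ :=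
  div_nonneg (g.euler_nonneg (g.root_nonneg hξ)) (g.eval_add_euler_pos (g.root_nonneg hξ)).le

/-- The slope is e/(g+e) with e = s g'(s) ≤ α_N g(s), and e/(g+e) is increasing in e. The resulting
bound a < 1 is what makes the energy estimate coercive. -/
theorem slopeK_le {ξ : ℝ} (hξ : 0 ≤ ξ) : g.slopeK ξ ≤ g.a := by
  have h0 := g.root_nonneg hξ
  have h1 := g.euler_le h0
  rw [slopeK, a, div_le_div_iff₀ (g.eval_add_euler_pos h0) (by linarith [g.expo_last_pos])]
  nlinarith

theorem continuousOn_slopeK : ContinuousOn g.slopeK (Ici 0) :=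
  (g.continuous_euler.comp_continuousOn g.continuousOn_root).div
    ((g.continuous_eval.add g.continuous_euler).comp_continuousOn g.continuousOn_root)
    fun _ h => (g.eval_add_euler_pos (g.root_nonneg h)).ne'

theorem slopeK_zero : g.slopeK 0 = 0 := by simp [slopeK, root_zero, euler_zero]

theorem K_pos {ξ : ℝ} (hξ : 0 ≤ ξ) : 0 < g.K ξ := one_div_pos.2 (g.eval_pos (g.root_nonneg hξ))

theorem K_le {ξ : ℝ} (hξ : 0 ≤ ξ) : g.K ξ ≤ 1 / g.coeff 0 :=
  one_div_le_one_div_of_le g.coeff_zero_pos (g.coeff_zero_le_eval (g.root_nonneg hξ))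

theorem continuousOn_K : ContinuousOn g.K (Ici 0) :=
  continuousOn_const.div (g.continuous_eval.comp_continuousOn g.continuousOn_root)
    fun _ h => (g.eval_pos (g.root_nonneg h)).ne'

theorem hasDerivAt_K {ξ : ℝ} (hξ : 0 < ξ) :
    HasDerivAt g.K (-g.slopeK ξ * g.K ξ / ξ) ξ := by
  have hr := g.root_pos hξ
  have he := g.eval_pos hr.le
  have hee := g.eval_add_euler_pos hr.le
  have h := ((g.hasDerivAt_eval hr).comp ξ (g.hasDerivAt_root hξ)).inv he.ne'
  have hK : g.K = (g.eval ∘ g.root)⁻¹ := by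
    funext ξ
    simp [K]
  rw [← hK] at h
  refine h.congr_deriv ?_
  have h2 := g.root_mul_eval hξ.le
  simp only [slopeK, Function.comp_apply, K]
  generalize g.root ξ = ρ at *
  subst h2
  field_simp

theorem mul_K_eq_root {ξ : ℝ} (hξ : 0 ≤ ξ) : ξ * g.K ξ = g.root ξ := by
  have h1 := g.root_mul_eval hξ
  have h2 := g.eval_pos (g.root_nonneg hξ)
  rw [K, mul_one_div, div_eq_iff h2.ne', h1]

/-- The product ξK(ξ) is the root itself, hence increasing. This cruder bound drives the absorption
step; the sharp decay rate is needed only for the gradient estimate. -/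
theorem root_one_le_mul_K {ξ : ℝ} (hξ : 1 ≤ ξ) : g.root 1 ≤ ξ * g.K ξ := by
  rw [g.mul_K_eq_root (zero_le_one.trans hξ)]
  exact g.root_mono zero_le_one hξ

/-- `K(ξ)` decays no faster than `ξ ^ (-a)`. -/
theorem exists_le_rpow_a_mul_K : ∃ c > 0, ∀ ξ : ℝ, 1 ≤ ξ → c ≤ ξ ^ g.a * g.K ξ := by
  set m := g.expo (Fin.last g.N) with hm
  have hm0 : 0 < m := g.expo_last_pos
  have h1 := g.root_pos one_pos
  -- For s ≥ `g.root 1` each s^(α_i-m) is at most its value at `g.root 1`, because α_i ≤ m; the sum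
  -- alone bounds g(s)/s^m. The first summand only makes the positivity of c₁ evident.
  set c₁ := g.eval (g.root 1) / g.root 1 ^ m + ∑ i, g.coeff i * g.root 1 ^ (g.expo i - m) with hc₁
  have hup : ∀ s, g.root 1 ≤ s → g.eval s ≤ c₁ * s ^ m := fun s hs => by
    have hs0 : 0 < s := h1.trans_le hs
    have h2 : g.eval s ≤ (∑ i, g.coeff i * g.root 1 ^ (g.expo i - m)) * s ^ m := by
      rw [eval, Finset.sum_mul]
      refine Finset.sum_le_sum fun i _ => ?_
      rw [mul_assoc]
      refine mul_le_mul_of_nonneg_left ?_ (g.coeff_nonneg i)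
      have h3 : g.expo i - m ≤ 0 := sub_nonpos.2 (g.expo_strictMono.monotone (Fin.le_last i))
      calc s ^ g.expo i = s ^ (g.expo i - m) * s ^ m := by
            rw [← Real.rpow_add hs0]; congr 1; ring
        _ ≤ _ := mul_le_mul_of_nonneg_right (Real.rpow_le_rpow_of_nonpos h1 hs h3)
            (Real.rpow_nonneg hs0.le _)
    refine h2.trans (mul_le_mul_of_nonneg_right ?_ (Real.rpow_nonneg hs0.le _))
    have := g.eval_pos h1.le
    rw [hc₁]
    linarith [show 0 ≤ g.eval (g.root 1) / g.root 1 ^ m by positivity]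
  have hc₁pos : 0 < c₁ := by
    have h2 : 0 < g.eval (g.root 1) / g.root 1 ^ m :=
      div_pos (g.eval_pos h1.le) (Real.rpow_pos_of_pos h1 _)
    have h3 : 0 ≤ ∑ i, g.coeff i * g.root 1 ^ (g.expo i - m) :=
      Finset.sum_nonneg fun i _ => mul_nonneg (g.coeff_nonneg i) (Real.rpow_nonneg h1.le _)
    linarith
  have ha1 : 1 - g.a = 1 / (1 + m) := by
    rw [a, ← hm]
    field_simp
    ring
  have ha0 : 0 ≤ 1 - g.a := by linarith [g.a_lt_one]
  refine ⟨(c₁ ^ (1 - g.a))⁻¹, inv_pos.2 (Real.rpow_pos_of_pos hc₁pos _), fun ξ hξ => ?_⟩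
  have hξ0 : 0 ≤ ξ := zero_le_one.trans hξ
  have hs := g.root_mono zero_le_one hξ
  have hs0 := h1.trans_le hs
  have he := g.eval_pos hs0.le
  have h4 : g.eval (g.root ξ) ^ (1 - g.a) ≤ c₁ ^ (1 - g.a) * g.root ξ ^ g.a := by
    calc g.eval (g.root ξ) ^ (1 - g.a) ≤ (c₁ * g.root ξ ^ m) ^ (1 - g.a) :=
          Real.rpow_le_rpow he.le (hup _ hs) ha0
      _ = c₁ ^ (1 - g.a) * (g.root ξ ^ m) ^ (1 - g.a) :=
          Real.mul_rpow hc₁pos.le (Real.rpow_nonneg hs0.le _)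
      _ = _ := by
          rw [← Real.rpow_mul hs0.le, ha1, a, ← hm, mul_one_div]
  -- Substituting ξ = ρ g(ρ) gives ρ^a / g(ρ)^(1-a). The powers of ρ balance because m(1-a) = a.
  have h5 : ξ ^ g.a * g.K ξ = g.root ξ ^ g.a / g.eval (g.root ξ) ^ (1 - g.a) := by
    nth_rewrite 1 [← g.root_mul_eval hξ0]
    rw [Real.mul_rpow hs0.le he.le, K, Real.rpow_sub he, Real.rpow_one]
    have := Real.rpow_pos_of_pos he g.a
    field_simp
  rw [h5, le_div_iff₀ (Real.rpow_pos_of_pos he _), inv_mul_le_iff₀ (Real.rpow_pos_of_pos hc₁pos _)]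
  exact h4

end ForchheimerPoly

/-! ### Radial vector fields of class C¹ -/

section RadialFields

open Filter Topology

/-- `h` is the profile of a radial field `y ↦ h(‖y‖) y` of class `C¹`; `k` is the Euler derivative
`r h'(r)`. -/
structure IsRadialProfile (h k : ℝ → ℝ) : Prop where
  continuousOn : ContinuousOn h (Ici 0)
  continuousOn_euler : ContinuousOn k (Ici 0)
  euler_zero : k 0 = 0
  hasDerivAt : ∀ r > 0, HasDerivAt h (k r / r) r

namespace IsRadialProfile

theorem rpow {σ : ℝ} (hσ : 0 ≤ σ) :
    IsRadialProfile (fun r => r ^ σ) (fun r => σ * r ^ σ) where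
  continuousOn := (Real.continuous_rpow_const hσ).continuousOn
  continuousOn_euler := (continuous_const.mul (Real.continuous_rpow_const hσ)).continuousOn
  euler_zero := by
    by_cases h : σ = 0
    · simp [h]
    · simp [Real.zero_rpow h]
  hasDerivAt r hr := by
    refine (Real.hasDerivAt_rpow_const (Or.inl hr.ne')).congr_deriv ?_
    rw [Real.rpow_sub_one hr.ne', mul_div_assoc]

theorem conductivity (g : ForchheimerPoly) :
    IsRadialProfile g.K (fun r => -g.slopeK r * g.K r) where
  continuousOn := g.continuousOn_K
  continuousOn_euler := g.continuousOn_slopeK.neg.mul g.continuousOn_K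
  euler_zero := by simp [g.slopeK_zero]
  hasDerivAt _ hr := g.hasDerivAt_K hr

theorem mul {h k h' k' : ℝ → ℝ} (H : IsRadialProfile h k) (H' : IsRadialProfile h' k') :
    IsRadialProfile (fun r => h r * h' r) (fun r => k r * h' r + h r * k' r) where
  continuousOn := H.continuousOn.mul H'.continuousOn
  continuousOn_euler := (H.continuousOn_euler.mul H'.continuousOn).add
    (H.continuousOn.mul H'.continuousOn_euler)
  euler_zero := by simp [H.euler_zero, H'.euler_zero]
  hasDerivAt r hr := by
    refine ((H.hasDerivAt r hr).mul (H'.hasDerivAt r hr)).congr_deriv ?_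
    ring

theorem continuous_comp_norm {E : Type*} [SeminormedAddCommGroup E] {h k : ℝ → ℝ} (H : IsRadialProfile h k) :
    Continuous fun y : E => h ‖y‖ :=
  H.continuousOn.comp_continuous continuous_norm fun y => norm_nonneg y

end IsRadialProfile

variable {E : Type*} [NormedAddCommGroup E] [InnerProductSpace ℝ E]

/-- The radial vector field `y ↦ h(‖y‖) y`. -/
def radialField (h : ℝ → ℝ) (y : E) : E := h ‖y‖ • y

/-- The derivative of `radialField h` at `y`, where `k` is the Euler derivative of `h`. -/
noncomputable def radialDeriv (h k : ℝ → ℝ) (y : E) : E →L[ℝ] E :=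
  h ‖y‖ • ContinuousLinearMap.id ℝ E + (k ‖y‖ / ‖y‖ ^ 2) • (innerSL ℝ y).smulRight y

theorem radialDeriv_apply (h k : ℝ → ℝ) (y w : E) :
    radialDeriv h k y w = h ‖y‖ • w + (k ‖y‖ / ‖y‖ ^ 2 * inner ℝ y w) • y := by
  simp [radialDeriv, smul_smul]

theorem IsRadialProfile.continuous_radialField {h k : ℝ → ℝ} (H : IsRadialProfile h k) :
    Continuous (radialField h : E → E) :=
  H.continuous_comp_norm.smul continuous_id

/-- Away from the origin this is the product rule. At the origin the increment minus its linear part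
is (h(|z|)-h(0))z, which is o(z) by continuity of h alone; the rank-one term of `radialDeriv` is
zero there, as 0/0 = 0. -/
theorem IsRadialProfile.hasFDerivAt {h k : ℝ → ℝ} (H : IsRadialProfile h k) (y : E) :
    HasFDerivAt (radialField h) (radialDeriv h k y) y := by
  rcases eq_or_ne y 0 with rfl | hy
  · have h1 : radialDeriv h k (0 : E) = h 0 • ContinuousLinearMap.id ℝ E := by
      simp [radialDeriv]
    rw [h1, hasFDerivAt_iff_isLittleO_nhds_zero]
    have h2 : (fun z : E => radialField h (0 + z) - radialField h 0
        - (h 0 • ContinuousLinearMap.id ℝ E) z) = fun z => (h ‖z‖ - h 0) • z := by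
      funext z
      simp [radialField, sub_smul]
    rw [h2]
    have h3 : Tendsto (fun z : E => h ‖z‖ - h 0) (𝓝 0) (𝓝 0) := by
      have := (H.continuous_comp_norm (E := E)).tendsto 0
      simpa using this.sub_const (h 0)
    have h4 := ((Asymptotics.isLittleO_one_iff ℝ).2 h3).smul_isBigO
      (Asymptotics.isBigO_refl (fun z : E => z) (𝓝 0))
    simpa using h4
  · have hn : 0 < ‖y‖ := norm_pos_iff.2 hy
    have h1 : HasFDerivAt (fun z : E => ‖z‖) (‖y‖⁻¹ • innerSL ℝ y) y := by
      have h2 := (hasStrictFDerivAt_norm_sq y).hasFDerivAt.sqrt (by positivity)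
      simp only [Real.sqrt_sq (norm_nonneg _)] at h2
      refine h2.congr_fderiv ?_
      rw [← Nat.cast_smul_eq_nsmul ℝ, smul_smul]
      congr 1
      field_simp
      norm_num
    have h5 := ((H.hasDerivAt _ hn).comp_hasFDerivAt y h1).smul (hasFDerivAt_id y)
    refine h5.congr_fderiv ?_
    ext w
    simp only [radialDeriv_apply, add_apply, smul_apply,
      ContinuousLinearMap.smulRight_apply, Function.comp_apply, ContinuousLinearMap.id_apply, id,
      innerSL_apply_apply, smul_eq_mul]
    congr 2
    field_simp

/-- The rank-one term has norm |k(|y|)|, so `euler_zero` gives continuity at the origin. Critical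
points of p therefore need no regularization of the flux. -/
theorem IsRadialProfile.continuous_radialDeriv {h k : ℝ → ℝ} (H : IsRadialProfile h k) :
    Continuous (radialDeriv h k : E → E →L[ℝ] E) := by
  refine (H.continuous_comp_norm.smul continuous_const).add ?_
  have hk : Continuous fun y : E => k ‖y‖ :=
    H.continuousOn_euler.comp_continuous continuous_norm fun y => norm_nonneg y
  have hr : Continuous fun y : E => (innerSL ℝ y).smulRight y :=
    ((ContinuousLinearMap.smulRightL ℝ E E).continuous.comp (innerSL ℝ).continuous).clm_apply
      continuous_id
  rw [continuous_iff_continuousAt]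
  intro y
  rcases eq_or_ne y 0 with rfl | hy
  · rw [ContinuousAt]
    have h0 : (k ‖(0 : E)‖ / ‖(0 : E)‖ ^ 2) • (innerSL ℝ (0 : E)).smulRight (0 : E) = 0 := by simp
    rw [h0]
    refine squeeze_zero_norm (a := fun y : E => |k ‖y‖|) (fun y => ?_) ?_
    · rw [norm_smul, norm_div, norm_pow, norm_norm, ContinuousLinearMap.norm_smulRight_apply,
        innerSL_apply_norm, Real.norm_eq_abs]
      rcases eq_or_ne y 0 with rfl | hy
      · simp
      · have := norm_pos_iff.2 hy
        exact le_of_eq (by field_simp)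
    · have := hk.abs.tendsto 0
      simpa [H.euler_zero] using this
  · exact (hk.continuousAt.div (by fun_prop) (by positivity)).smul hr.continuousAt

end RadialFields

/-! ### Integration by parts for C¹ functions -/

section IntegrationByParts

open Filter Topology

variable {E : Type*} [NormedAddCommGroup E] [InnerProductSpace ℝ E] [FiniteDimensional ℝ E]
  [MeasurableSpace E] [BorelSpace E]

/-- The product of a function continuous on an open set with a continuous function supported
in that set is continuous. -/
theorem ContinuousOn.continuous_mul_of_tsupport_subset {X : Type*} [TopologicalSpace X]
    {U : Set X} (hU : IsOpen U) {f η : X → ℝ} (hf : ContinuousOn f U) (hη : Continuous η)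
    (h : tsupport η ⊆ U) : Continuous fun x => f x * η x := by
  rw [continuous_iff_continuousAt]
  intro x
  by_cases hx : x ∈ tsupport η
  · exact (hf.continuousAt (hU.mem_nhds (h hx))).mul hη.continuousAt
  · have h0 : (fun x => f x * η x) =ᶠ[𝓝 x] fun _ => 0 := by
      filter_upwards [(isClosed_tsupport η).isOpen_compl.mem_nhds hx] with y hy
      rw [image_eq_zero_of_notMem_tsupport hy, mul_zero]
    exact continuousAt_const.congr h0.symm

/-- Integration by parts against a compactly supported function, for functions of class `C¹`
near its support. -/
theorem integral_mul_fderiv_eq_neg_of_compactSupport {U : Set E} (hU : IsOpen U) {f η : E → ℝ}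
    (hf : DifferentiableOn ℝ f U) (hf' : ContinuousOn (fderiv ℝ f) U) (hη : ContDiff ℝ 1 η)
    (hc : HasCompactSupport η) (h : tsupport η ⊆ U) (v : E) :
    ∫ x, f x * fderiv ℝ η x v = -∫ x, fderiv ℝ f x v * η x := by
  have hη' : Continuous fun x => fderiv ℝ η x v :=
    (hη.continuous_fderiv one_ne_zero).clm_apply continuous_const
  have hs : tsupport (fun x => fderiv ℝ η x v) ⊆ tsupport η :=
    tsupport_fderiv_apply_subset ℝ v
  have hcs := hc.of_isClosed_subset (isClosed_tsupport _) hs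
  have hfv : ContinuousOn (fun x => fderiv ℝ f x v) U := hf'.clm_apply continuousOn_const
  refine integral_mul_fderiv_eq_neg_fderiv_mul_of_integrable ?_ ?_ ?_ ?_ ?_
  · exact (hfv.continuous_mul_of_tsupport_subset hU hη.continuous h).integrable_of_hasCompactSupport
      (HasCompactSupport.mul_left hc)
  · exact (hf.continuousOn.continuous_mul_of_tsupport_subset hU hη'
      (hs.trans h)).integrable_of_hasCompactSupport (HasCompactSupport.mul_left hcs)
  · exact (hf.continuousOn.continuous_mul_of_tsupport_subset hU hη.continuous
      h).integrable_of_hasCompactSupport (HasCompactSupport.mul_left hc)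
  · exact fun x hx => hf.differentiableAt (hU.mem_nhds (h hx))
  · exact fun x _ => (hη.differentiable one_ne_zero) x

/-- For C² functions one would integrate by parts twice. Here ∂ᵥf is replaced by a difference
quotient, which is still C¹: integrate by parts in w, move the translation onto η, and let the step
tend to 0. -/
theorem integral_fderiv_mul_fderiv_comm_of_compactSupport {f η : E → ℝ}
    (hf : ContDiff ℝ 1 f) (hfc : HasCompactSupport f) (hη : ContDiff ℝ 1 η)
    (hc : HasCompactSupport η) (v w : E) :
    ∫ x, fderiv ℝ f x v * fderiv ℝ η x w = ∫ x, fderiv ℝ f x w * fderiv ℝ η x v := by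
  obtain ⟨C, hfL⟩ := hf.lipschitzWith_of_hasCompactSupport hfc one_ne_zero
  obtain ⟨D, hηL⟩ := hη.lipschitzWith_of_hasCompactSupport hc one_ne_zero
  have hf' : ∀ v, Continuous fun x => fderiv ℝ f x v := fun v =>
    (hf.continuous_fderiv one_ne_zero).clm_apply continuous_const
  have hη' : ∀ v, Continuous fun x => fderiv ℝ η x v := fun v =>
    (hη.continuous_fderiv one_ne_zero).clm_apply continuous_const
  have hfd := hf.differentiable one_ne_zero
  have hηd := hη.differentiable one_ne_zero
  have hfl : ∀ x v, lineDeriv ℝ f x v = fderiv ℝ f x v := fun x v =>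
    (hfd x).lineDeriv_eq_fderiv
  have hηl : ∀ x v, lineDeriv ℝ η x v = fderiv ℝ η x v := fun x v =>
    (hηd x).lineDeriv_eq_fderiv
  have h1 := LipschitzWith.integral_inv_smul_sub_mul_tendsto_integral_lineDeriv_mul' (μ := volume) hfL hfc
    (hη' w) v
  have h2 := (LipschitzWith.integral_inv_smul_sub_mul_tendsto_integral_lineDeriv_mul' (μ := volume) hηL hc
    (hf' w) (-v)).neg
  simp only [hfl, hηl, map_neg, neg_mul, integral_neg, neg_neg] at h1 h2
  simp only [mul_comm (fderiv ℝ η _ v)] at h2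
  refine tendsto_nhds_unique h1 (h2.congr fun t => ?_)
  have hcη : ∀ F : E → ℝ, Continuous F → Integrable fun x => F x * η x := fun F hF =>
    (hF.mul hη.continuous).integrable_of_hasCompactSupport (HasCompactSupport.mul_left hc)
  have hsh : ContDiff ℝ 1 fun x => f (x + t • v) - f x := by fun_prop
  have h3 := integral_mul_fderiv_eq_neg_of_compactSupport isOpen_univ
    (hsh.differentiable one_ne_zero).differentiableOn
    (hsh.continuous_fderiv one_ne_zero).continuousOn hη hc (subset_univ _) w
  have h4 : ∀ x, fderiv ℝ (fun x => f (x + t • v) - f x) x w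
      = fderiv ℝ f (x + t • v) w - fderiv ℝ f x w := fun x => by
    rw [fderiv_fun_sub (by fun_prop) (by fun_prop), fderiv_comp_add_right]
    rfl
  -- Translation invariance turns a forward shift of f into a backward shift of η, which is why `h2`
  -- uses the direction -v.
  have h5 : ∫ x, fderiv ℝ f (x + t • v) w * η x = ∫ x, fderiv ℝ f x w * η (x - t • v) := by
    rw [← integral_add_right_eq_self (fun x => fderiv ℝ f x w * η (x - t • v)) (t • v)]
    simp
  simp only [h4, sub_mul] at h3
  rw [integral_sub (hcη _ (by fun_prop)) (hcη _ (hf' w)), h5] at h3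
  have h6 : Integrable fun x => fderiv ℝ f x w * η (x - t • v) :=
    ((hf' w).mul (by fun_prop)).integrable_of_hasCompactSupport
      (HasCompactSupport.mul_right (by
        have := hfc.fderiv (𝕜 := ℝ)
        exact this.comp_left (g := fun L : E →L[ℝ] ℝ => L w) rfl))
  simp only [smul_eq_mul, mul_assoc, integral_const_mul, smul_neg, ← sub_eq_add_neg]
  simp only [sub_mul]
  rw [integral_sub (by simpa only [mul_comm] using h6)
    (by simpa only [mul_comm] using hcη _ (hf' w)), h3]
  simp only [mul_comm]
  ring

/-- Two partial derivatives may be exchanged in `∫ ∂ᵥ f ∂_w η`. -/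
theorem integral_fderiv_mul_fderiv_comm {U : Set E} (hU : IsOpen U) {f η : E → ℝ}
    (hf : ContDiffOn ℝ 1 f U) (hη : ContDiff ℝ 1 η)
    (hc : HasCompactSupport η) (h : tsupport η ⊆ U) (v w : E) :
    ∫ x, fderiv ℝ f x v * fderiv ℝ η x w = ∫ x, fderiv ℝ f x w * fderiv ℝ η x v := by
  -- A cutoff φ equal to 1 near the support of η makes fφ globally C¹ and compactly supported
  -- without changing either integrand.
  obtain ⟨W, hWo, hηW, hWU, hWc⟩ := exists_open_between_and_isCompact_closure hc hU h
  obtain ⟨φ, hφ1, hφ0, -⟩ := exists_contMDiffMap_one_nhds_of_subset_interior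
    (modelWithCornersSelf ℝ E) (n := 1) (isClosed_tsupport η) (t := W)
    (by rwa [hWo.interior_eq])
  have hφs : tsupport φ ⊆ closure W :=
    closure_mono fun x hx => by_contra fun hxW => hx (hφ0 x hxW)
  have hφd : ContDiff ℝ 1 φ := φ.contMDiff.contDiff
  have hφc : HasCompactSupport φ := hWc.of_isClosed_subset (isClosed_tsupport _) hφs
  have hF : ContDiff ℝ 1 fun x => f x * φ x := by
    rw [contDiff_iff_contDiffAt]
    intro x
    by_cases hx : x ∈ tsupport φ
    · exact (hf.contDiffAt (hU.mem_nhds (hWU (hφs hx)))).mul hφd.contDiffAt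
    · have h0 : (fun x => f x * φ x) =ᶠ[𝓝 x] fun _ => 0 := by
        filter_upwards [(isClosed_tsupport φ).isOpen_compl.mem_nhds hx] with y hy
        rw [image_eq_zero_of_notMem_tsupport hy, mul_zero]
      exact contDiffAt_const.congr_of_eventuallyEq h0
  have key := integral_fderiv_mul_fderiv_comm_of_compactSupport hF
    (HasCompactSupport.mul_left hφc) hη hc v w
  have hcongr : ∀ v w x, fderiv ℝ (fun x => f x * φ x) x v * fderiv ℝ η x w
      = fderiv ℝ f x v * fderiv ℝ η x w := fun v w x => by
    by_cases hx : x ∈ tsupport η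
    · have h0 : (fun x => f x * φ x) =ᶠ[𝓝 x] f := by
        filter_upwards [(eventually_nhdsSet_iff_forall.1 hφ1) x hx] with y hy
        rw [hy, mul_one]
      rw [h0.fderiv_eq]
    · have h0 : fderiv ℝ η x = 0 := by
        by_contra h0
        exact hx (support_fderiv_subset ℝ h0)
      simp [h0]
  simpa only [hcongr] using key

end IntegrationByParts

/-! ### Jacobians of radial fields and cutoff functions -/

section SpatialEstimates

open Filter Topology

variable {n : ℕ}

/-- The squared Frobenius norm `∑ᵢⱼ (L eᵢ)ⱼ²`. -/
noncomputable def frobSq (L : EuclideanSpace ℝ (Fin n) →L[ℝ] EuclideanSpace ℝ (Fin n)) : ℝ :=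
  ∑ i, ∑ j, L (EuclideanSpace.single i 1) j ^ 2

theorem frobSq_nonneg (L : EuclideanSpace ℝ (Fin n) →L[ℝ] EuclideanSpace ℝ (Fin n)) : 0 ≤ frobSq L :=
  Finset.sum_nonneg fun _ _ => Finset.sum_nonneg fun _ _ => sq_nonneg _

theorem continuous_frobSq : Continuous (frobSq : (EuclideanSpace ℝ (Fin n) →L[ℝ] EuclideanSpace ℝ (Fin n)) → ℝ) := by
  unfold frobSq
  fun_prop

/-- The entry `∂ᵢ Gⱼ` of the Jacobian of `G = radialField h ∘ q`, where `y` and `L` are the values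
of `q` and of its derivative. -/
noncomputable def radialJac (h k : ℝ → ℝ) (y : EuclideanSpace ℝ (Fin n)) (L : EuclideanSpace ℝ (Fin n) →L[ℝ] EuclideanSpace ℝ (Fin n)) (i j : Fin n) : ℝ :=
  radialDeriv h k y (L (EuclideanSpace.single i 1)) j

theorem radialJac_eq (h k : ℝ → ℝ) (y : EuclideanSpace ℝ (Fin n)) (L : EuclideanSpace ℝ (Fin n) →L[ℝ] EuclideanSpace ℝ (Fin n)) (i j : Fin n) :
    radialJac h k y L i j = h ‖y‖ * L (EuclideanSpace.single i 1) j
      + k ‖y‖ / ‖y‖ ^ 2 * inner ℝ y (L (EuclideanSpace.single i 1)) * y j := by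
  simp [radialJac, radialDeriv_apply]

theorem norm_apply_single_sq_le_frobSq (L : EuclideanSpace ℝ (Fin n) →L[ℝ] EuclideanSpace ℝ (Fin n)) (i : Fin n) :
    ‖L (EuclideanSpace.single i 1)‖ ^ 2 ≤ frobSq L := by
  rw [EuclideanSpace.real_norm_sq_eq]
  exact Finset.single_le_sum (f := fun i => ∑ j, L (EuclideanSpace.single i 1) j ^ 2)
    (fun i _ => Finset.sum_nonneg fun j _ => sq_nonneg _) (Finset.mem_univ i)

/-- The factor |y|² from the inner product and the outer y cancels the denominator, so the bound has
no singularity at y = 0. -/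
theorem abs_radialJac_le (h k : ℝ → ℝ) (y : EuclideanSpace ℝ (Fin n)) (L : EuclideanSpace ℝ (Fin n) →L[ℝ] EuclideanSpace ℝ (Fin n)) (i j : Fin n) :
    |radialJac h k y L i j| ≤ (|h ‖y‖| + |k ‖y‖|) * √(frobSq L) := by
  have hL : ‖L (EuclideanSpace.single i 1)‖ ≤ √(frobSq L) :=
    Real.le_sqrt_of_sq_le (norm_apply_single_sq_le_frobSq L i)
  have h1 : ‖radialDeriv h k y (L (EuclideanSpace.single i 1))‖
      ≤ (|h ‖y‖| + |k ‖y‖|) * ‖L (EuclideanSpace.single i 1)‖ := by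
    rw [radialDeriv_apply, add_mul]
    refine (norm_add_le _ _).trans (add_le_add (norm_smul_le _ _) ?_)
    rw [norm_smul, norm_mul, norm_div, norm_pow, norm_norm, Real.norm_eq_abs]
    rcases eq_or_ne y 0 with rfl | hy
    · simpa using by positivity
    · have h2 := abs_real_inner_le_norm y (L (EuclideanSpace.single i 1))
      have h3 := norm_pos_iff.2 hy
      rw [Real.norm_eq_abs]
      calc |k ‖y‖| / ‖y‖ ^ 2 * |inner ℝ y (L (EuclideanSpace.single i 1))| * ‖y‖
          ≤ |k ‖y‖| / ‖y‖ ^ 2 * (‖y‖ * ‖L (EuclideanSpace.single i 1)‖) * ‖y‖ := by gcongr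
        _ = _ := by field_simp
  calc |radialJac h k y L i j| ≤ ‖radialDeriv h k y (L (EuclideanSpace.single i 1))‖ :=
        PiLp.norm_apply_le (radialDeriv h k y (L (EuclideanSpace.single i 1))) j
    _ ≤ _ := h1.trans (by gcongr)

/-- The monotonicity of the two fluxes, tested on a symmetric matrix. -/
theorem frobSq_le_sum_radialJac_mul (g : ForchheimerPoly) {σ : ℝ} (hσ : 0 ≤ σ) (y : EuclideanSpace ℝ (Fin n))
    (L : EuclideanSpace ℝ (Fin n) →L[ℝ] EuclideanSpace ℝ (Fin n))
    (hL : ∀ i j, L (EuclideanSpace.single i 1) j = L (EuclideanSpace.single j 1) i) :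
    (1 - g.a) * (g.K ‖y‖ * ‖y‖ ^ σ * frobSq L) ≤
      ∑ i, ∑ j, radialJac g.K (fun r => -g.slopeK r * g.K r) y L i j *
        radialJac (fun r => r ^ σ) (fun r => σ * r ^ σ) y L j i := by
  have hr : 0 ≤ ‖y‖ := norm_nonneg y
  set r := ‖y‖ with hrdef
  set H : Fin n → Fin n → ℝ := fun i j => L (EuclideanSpace.single i 1) j with hH
  set c : Fin n → ℝ := fun i => inner ℝ y (L (EuclideanSpace.single i 1)) with hc
  have hcH : ∀ i, c i = ∑ j, H i j * y j := fun i => by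
    simp [hc, hH, PiLp.inner_apply]
  set S := frobSq L with hS
  have hS' : S = ∑ i, ∑ j, H i j ^ 2 := rfl
  have hr2 : r ^ 2 = ∑ i, y i ^ 2 := EuclideanSpace.real_norm_sq_eq y
  set κ := -g.slopeK r * g.K r / r ^ 2 with hκ
  set μ := σ * r ^ σ / r ^ 2 with hμ
  have hKp := g.K_pos hr
  have hb0 := g.slopeK_nonneg hr
  have hba := g.slopeK_le hr
  have ha1 := g.a_lt_one
  have hrσ : 0 ≤ r ^ σ := Real.rpow_nonneg hr σ
  have hμ0 : 0 ≤ μ := by positivity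
  have hS0 : 0 ≤ S := frobSq_nonneg L
  set C2 := ∑ i, c i ^ 2 with hC2
  set d := ∑ i, c i * y i with hd
  have hC20 : 0 ≤ C2 := Finset.sum_nonneg fun i _ => sq_nonneg _
  have hCS : C2 ≤ r ^ 2 * S := by
    rw [hC2, hS', Finset.mul_sum]
    refine Finset.sum_le_sum fun i _ => ?_
    rw [hcH, hr2, mul_comm]
    exact Finset.sum_mul_sq_le_sq_mul_sq _ _ _
  have hdS : d ^ 2 ≤ r ^ 2 * C2 := by
    rw [hd, hr2, mul_comm]
    exact Finset.sum_mul_sq_le_sq_mul_sq _ _ _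
  -- With H symmetric and c = Hy, d = y·Hy, the trace depends only on |H|², |c|² and d.
  have hexp : ∑ i, ∑ j, radialJac g.K (fun r => -g.slopeK r * g.K r) y L i j *
      radialJac (fun r => r ^ σ) (fun r => σ * r ^ σ) y L j i
      = g.K r * r ^ σ * S + (g.K r * μ + κ * r ^ σ) * C2 + κ * μ * d ^ 2 := by
    have h1 : ∀ i j, radialJac g.K (fun r => -g.slopeK r * g.K r) y L i j *
        radialJac (fun r => r ^ σ) (fun r => σ * r ^ σ) y L j i
        = g.K r * r ^ σ * H i j ^ 2 + g.K r * μ * (c j * (H j i * y i))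
          + κ * r ^ σ * (c i * (H i j * y j)) + κ * μ * ((c i * y i) * (c j * y j)) := by
      intro i j
      rw [radialJac_eq, radialJac_eq]
      have := hL j i
      simp only [hH, hc, hκ, hμ, this]
      ring
    simp only [h1, Finset.sum_add_distrib, ← Finset.mul_sum, ← hcH]
    rw [Finset.sum_comm (f := fun i j => c j * (H j i * y i))]
    simp only [← Finset.mul_sum, ← hcH, ← Finset.sum_mul, ← hS', ← hd]
    simp only [← pow_two, ← hC2]
    ring
  rw [hexp]
  rcases hr.eq_or_lt with h0 | h0
  -- At y = 0 the coefficient κ is a division by zero, hence 0, and c vanishes by Cauchy–Schwarz.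
  · have hκ0 : κ = 0 := by simp [hκ, ← h0]
    have hC20' : C2 = 0 := by
      rw [← h0] at hCS
      nlinarith
    rw [hκ0, hC20']
    nlinarith [mul_nonneg (mul_nonneg hKp.le hrσ) hS0, g.a_pos]
  · have hκr : κ * r ^ 2 = -g.slopeK r * g.K r := by rw [hκ]; field_simp
    have hκ0 : κ ≤ 0 := by
      rw [hκ]
      exact div_nonpos_of_nonpos_of_nonneg (by nlinarith) (by positivity)
    -- Only κ is negative. Cauchy–Schwarz bounds its two terms by `g.slopeK r` times the positive
    -- terms with |c|² and |H|², so a fraction at least 1-a of each survives.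
    have h1 : -g.slopeK r * g.K r * μ * C2 ≤ κ * μ * d ^ 2 := by
      rw [← hκr]
      nlinarith [mul_le_mul_of_nonneg_left hdS (mul_nonneg (neg_nonneg.2 hκ0) hμ0)]
    have h2 : -g.slopeK r * g.K r * r ^ σ * S ≤ κ * r ^ σ * C2 := by
      rw [← hκr]
      nlinarith [mul_le_mul_of_nonneg_left hCS (mul_nonneg (neg_nonneg.2 hκ0) hrσ)]
    have h3 : 0 ≤ (1 - g.slopeK r) * (g.K r * μ * C2) :=
      mul_nonneg (by linarith) (mul_nonneg (mul_nonneg hKp.le hμ0) hC20)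
    have h4 : 0 ≤ (g.a - g.slopeK r) * (g.K r * r ^ σ * S) :=
      mul_nonneg (by linarith) (mul_nonneg (mul_nonneg hKp.le hrσ) hS0)
    nlinarith

/-- A cutoff function of class `C¹` on `U` whose gradient is bounded by `B`. -/
structure IsCutoff (U : Set (EuclideanSpace ℝ (Fin n))) (B : ℝ) (ψ : EuclideanSpace ℝ (Fin n) → ℝ) : Prop where
  contDiff : ContDiff ℝ 1 ψ
  hasCompactSupport : HasCompactSupport ψ
  tsupport_subset : tsupport ψ ⊆ U
  nonneg : ∀ x, 0 ≤ ψ x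
  le_one : ∀ x, ψ x ≤ 1
  norm_fderiv_le : ∀ x, ‖fderiv ℝ ψ x‖ ≤ B

namespace IsCutoff

variable {U : Set (EuclideanSpace ℝ (Fin n))} {B : ℝ} {ψ : EuclideanSpace ℝ (Fin n) → ℝ}

theorem bound_nonneg (hψ : IsCutoff U B ψ) : 0 ≤ B := (norm_nonneg _).trans (hψ.norm_fderiv_le 0)

theorem contDiff_pow (hψ : IsCutoff U B ψ) (m : ℕ) : ContDiff ℝ 1 fun x => ψ x ^ m :=
  hψ.contDiff.pow m

theorem tsupport_pow_subset (m : ℕ) (hm : m ≠ 0) :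
    tsupport (fun x => ψ x ^ m) ⊆ tsupport ψ :=
  closure_mono fun x hx h0 => hx (by simp [h0, hm])

theorem hasCompactSupport_pow (hψ : IsCutoff U B ψ) (m : ℕ) (hm : m ≠ 0) :
    HasCompactSupport fun x => ψ x ^ m :=
  hψ.hasCompactSupport.of_isClosed_subset (isClosed_tsupport _) (tsupport_pow_subset m hm)

theorem pow_nonneg (hψ : IsCutoff U B ψ) (m : ℕ) (x : EuclideanSpace ℝ (Fin n)) : 0 ≤ ψ x ^ m :=
  _root_.pow_nonneg (hψ.nonneg x) m

theorem continuous_mul_pow (hψ : IsCutoff U B ψ) (hU : IsOpen U) {f : EuclideanSpace ℝ (Fin n) → ℝ}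
    (hf : ContinuousOn f U) (m : ℕ) (hm : m ≠ 0) : Continuous fun x => f x * ψ x ^ m :=
  hf.continuous_mul_of_tsupport_subset hU (hψ.contDiff_pow m).continuous
    ((tsupport_pow_subset m hm).trans hψ.tsupport_subset)

theorem integrable_mul_pow (hψ : IsCutoff U B ψ) (hU : IsOpen U) {f : EuclideanSpace ℝ (Fin n) → ℝ}
    (hf : ContinuousOn f U) (m : ℕ) (hm : m ≠ 0) : Integrable fun x => f x * ψ x ^ m :=
  (hψ.continuous_mul_pow hU hf m hm).integrable_of_hasCompactSupport
    (HasCompactSupport.mul_left (hψ.hasCompactSupport_pow m hm))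

/-- Differentiating the cutoff costs one power. Starting from ψ^(2m+2), Young's inequality then
returns half of ψ^(2m+2) to the main term and leaves ψ^(2m). -/
theorem abs_fderiv_pow_apply_single_le (hψ : IsCutoff U B ψ) (m : ℕ) (x : EuclideanSpace ℝ (Fin n)) (i : Fin n) :
    |fderiv ℝ (fun x => ψ x ^ (m + 1)) x (EuclideanSpace.single i 1)| ≤ (m + 1) * B * ψ x ^ m := by
  have h1 : fderiv ℝ (fun x => ψ x ^ (m + 1)) x = ((m + 1 : ℕ) * ψ x ^ m) • fderiv ℝ ψ x :=
    ((hψ.contDiff.differentiable one_ne_zero x).hasFDerivAt.pow (m + 1)).fderiv.trans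
      (by simp)
  have h2 : |fderiv ℝ ψ x (EuclideanSpace.single i 1)| ≤ B := by
    refine ((fderiv ℝ ψ x).le_opNorm _).trans ?_
    simpa using hψ.norm_fderiv_le x
  rw [h1, smul_apply, smul_eq_mul, abs_mul, abs_mul, abs_of_nonneg (hψ.pow_nonneg m x),
    Nat.abs_cast]
  push_cast
  have h3 := hψ.pow_nonneg m x
  nlinarith [mul_le_mul_of_nonneg_left h2 (mul_nonneg (by positivity : (0:ℝ) ≤ m + 1) h3)]

end IsCutoff

theorem ContDiffOn.contDiff_mul_of_tsupport_subset {U : Set (EuclideanSpace ℝ (Fin n))} (hU : IsOpen U) {f η : EuclideanSpace ℝ (Fin n) → ℝ}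
    (hf : ContDiffOn ℝ 1 f U) (hη : ContDiff ℝ 1 η) (h : tsupport η ⊆ U) :
    ContDiff ℝ 1 fun x => f x * η x := by
  rw [contDiff_iff_contDiffAt]
  intro x
  by_cases hx : x ∈ tsupport η
  · exact (hf.contDiffAt (hU.mem_nhds (h hx))).mul hη.contDiffAt
  · have h0 : (fun x => f x * η x) =ᶠ[𝓝 x] fun _ => 0 := by
      filter_upwards [(isClosed_tsupport η).isOpen_compl.mem_nhds hx] with y hy
      rw [image_eq_zero_of_notMem_tsupport hy, mul_zero]
    exact contDiffAt_const.congr_of_eventuallyEq h0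

section RadialComp

variable {U : Set (EuclideanSpace ℝ (Fin n))} {q : EuclideanSpace ℝ (Fin n) → EuclideanSpace ℝ (Fin n)} {h k : ℝ → ℝ}

theorem IsRadialProfile.contDiff_radialField (H : IsRadialProfile h k) :
    ContDiff ℝ 1 (radialField h : EuclideanSpace ℝ (Fin n) → EuclideanSpace ℝ (Fin n)) :=
  contDiff_one_iff_hasFDerivAt.2 ⟨radialDeriv h k, H.continuous_radialDeriv, H.hasFDerivAt⟩

theorem IsRadialProfile.contDiffOn_comp (H : IsRadialProfile h k) (hq : ContDiffOn ℝ 1 q U)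
    (j : Fin n) : ContDiffOn ℝ 1 (fun x => radialField h (q x) j) U := by
  have := H.contDiff_radialField.comp_contDiffOn hq
  exact (contDiffOn_euclidean.1 this) j

theorem IsRadialProfile.fderiv_comp (H : IsRadialProfile h k) (hU : IsOpen U)
    (hq : ContDiffOn ℝ 1 q U) {x : EuclideanSpace ℝ (Fin n)} (hx : x ∈ U) (i j : Fin n) :
    fderiv ℝ (fun x => radialField h (q x) j) x (EuclideanSpace.single i 1)
      = radialJac h k (q x) (fderiv ℝ q x) i j := by
  have hqx : HasFDerivAt q (fderiv ℝ q x) x :=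
    ((hq.differentiableOn one_ne_zero).differentiableAt (hU.mem_nhds hx)).hasFDerivAt
  have h1 := (H.hasFDerivAt (q x)).comp x hqx
  have h2 := ((EuclideanSpace.proj (𝕜 := ℝ) j).hasFDerivAt (x := radialField h (q x))).comp x h1
  have h3 : HasFDerivAt (fun x => radialField h (q x) j) _ x := h2
  rw [h3.fderiv]
  rfl

/-- Holds at every x, although q is regular only on U: off the support of η the product vanishes
locally and both sides are 0. -/
theorem IsRadialProfile.fderiv_comp_mul (H : IsRadialProfile h k) (hU : IsOpen U)
    (hq : ContDiffOn ℝ 1 q U) {η : EuclideanSpace ℝ (Fin n) → ℝ} (hη : ContDiff ℝ 1 η) (hs : tsupport η ⊆ U) (x : EuclideanSpace ℝ (Fin n))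
    (i j : Fin n) :
    fderiv ℝ (fun x => radialField h (q x) j * η x) x (EuclideanSpace.single i 1)
      = radialJac h k (q x) (fderiv ℝ q x) i j * η x
        + radialField h (q x) j * fderiv ℝ η x (EuclideanSpace.single i 1) := by
  by_cases hx : x ∈ tsupport η
  · have h1 : DifferentiableAt ℝ (fun x => radialField h (q x) j) x :=
      ((H.contDiffOn_comp hq j).differentiableOn one_ne_zero).differentiableAt
        (hU.mem_nhds (hs hx))
    rw [fderiv_fun_mul h1 (hη.differentiable one_ne_zero x), add_apply, smul_apply, smul_apply,
      H.fderiv_comp hU hq (hs hx), smul_eq_mul, smul_eq_mul]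
    ring
  · have h0 : (fun x => radialField h (q x) j * η x) =ᶠ[𝓝 x] fun _ => 0 := by
      filter_upwards [(isClosed_tsupport η).isOpen_compl.mem_nhds hx] with y hy
      rw [image_eq_zero_of_notMem_tsupport hy, mul_zero]
    have h1 : fderiv ℝ η x = 0 := by
      by_contra h0
      exact hx (support_fderiv_subset ℝ h0)
    rw [h0.fderiv_eq, h1, image_eq_zero_of_notMem_tsupport hx]
    simp

end RadialComp

end SpatialEstimates

/-! ### Energy and embedding estimates at a fixed time -/

section SpatialEstimates

open Filter Topology

variable {n : ℕ}

/-- The divergence of `η • (radialField h ∘ q)`, computed in coordinates. -/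
noncomputable def weightedDiv (h : ℝ → ℝ) (q : EuclideanSpace ℝ (Fin n) → EuclideanSpace ℝ (Fin n))
    (η : EuclideanSpace ℝ (Fin n) → ℝ) (x : EuclideanSpace ℝ (Fin n)) : ℝ :=
  ∑ j, fderiv ℝ (fun x => radialField h (q x) j * η x) x (EuclideanSpace.single j 1)

variable {U : Set (EuclideanSpace ℝ (Fin n))}
  {q : EuclideanSpace ℝ (Fin n) → EuclideanSpace ℝ (Fin n)} {h k : ℝ → ℝ}

theorem IsRadialProfile.weightedDiv_eq (H : IsRadialProfile h k) (hU : IsOpen U)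
    (hq : ContDiffOn ℝ 1 q U) {η : EuclideanSpace ℝ (Fin n) → ℝ} (hη : ContDiff ℝ 1 η)
    (hs : tsupport η ⊆ U) (x : EuclideanSpace ℝ (Fin n)) :
    weightedDiv h q η x = ∑ j, (radialJac h k (q x) (fderiv ℝ q x) j j * η x
        + radialField h (q x) j * fderiv ℝ η x (EuclideanSpace.single j 1)) :=
  Finset.sum_congr rfl fun j _ => H.fderiv_comp_mul hU hq hη hs x j j

theorem IsRadialProfile.contDiff_comp_mul (H : IsRadialProfile h k) (hU : IsOpen U)
    (hq : ContDiffOn ℝ 1 q U) {η : EuclideanSpace ℝ (Fin n) → ℝ} (hη : ContDiff ℝ 1 η)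
    (hs : tsupport η ⊆ U) (j : Fin n) : ContDiff ℝ 1 fun x => radialField h (q x) j * η x :=
  (H.contDiffOn_comp hq j).contDiff_mul_of_tsupport_subset hU hη hs

theorem tsupport_weightedDiv_subset (η : EuclideanSpace ℝ (Fin n) → ℝ) :
    tsupport (weightedDiv h q η) ⊆ tsupport η := by
  refine closure_minimal (fun x hx => by_contra fun hxη => hx ?_) (isClosed_tsupport η)
  refine Finset.sum_eq_zero fun j _ => ?_
  have h1 : x ∉ tsupport fun x => fderiv ℝ (fun x => radialField h (q x) j * η x) x
      (EuclideanSpace.single j 1) := fun hx' =>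
    hxη (tsupport_mul_subset_right (tsupport_fderiv_apply_subset ℝ
      (f := fun x => radialField h (q x) j * η x) _ hx'))
  exact image_eq_zero_of_notMem_tsupport (f := fun x =>
    fderiv ℝ (fun x => radialField h (q x) j * η x) x (EuclideanSpace.single j 1)) h1

theorem IsRadialProfile.continuous_weightedDiv (H : IsRadialProfile h k) (hU : IsOpen U)
    (hq : ContDiffOn ℝ 1 q U) {η : EuclideanSpace ℝ (Fin n) → ℝ} (hη : ContDiff ℝ 1 η)
    (hs : tsupport η ⊆ U) : Continuous (weightedDiv h q η) :=
  continuous_finsetSum _ fun j _ =>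
    ((H.contDiff_comp_mul hU hq hη hs j).continuous_fderiv one_ne_zero).clm_apply continuous_const

theorem IsRadialProfile.integrable_mul_weightedDiv (H : IsRadialProfile h k) (hU : IsOpen U)
    (hq : ContDiffOn ℝ 1 q U) {η : EuclideanSpace ℝ (Fin n) → ℝ} (hη : ContDiff ℝ 1 η)
    (hc : HasCompactSupport η) (hs : tsupport η ⊆ U) {w : EuclideanSpace ℝ (Fin n) → ℝ}
    (hw : ContinuousOn w U) : Integrable fun x => w x * weightedDiv h q η x :=
  (hw.continuous_mul_of_tsupport_subset hU (H.continuous_weightedDiv hU hq hη hs)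
    ((tsupport_weightedDiv_subset η).trans hs)).integrable_of_hasCompactSupport
    (HasCompactSupport.mul_left
      (hc.of_isClosed_subset (isClosed_tsupport _) (tsupport_weightedDiv_subset η)))

/-- The cutoff stays inside the divergence, so one integration by parts per coordinate leaves no
boundary term and no derivative of η. It serves with w = p in the embedding and with w an increment
of p in the time derivative. -/
theorem IsRadialProfile.integral_mul_weightedDiv (H : IsRadialProfile h k) (hU : IsOpen U)
    (hq : ContDiffOn ℝ 1 q U) {η : EuclideanSpace ℝ (Fin n) → ℝ} (hη : ContDiff ℝ 1 η)
    (hc : HasCompactSupport η) (hs : tsupport η ⊆ U) {w : EuclideanSpace ℝ (Fin n) → ℝ}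
    (hw : ContDiffOn ℝ 1 w U) :
    ∫ x, w x * weightedDiv h q η x = -∫ x, (∑ j, fderiv ℝ w x (EuclideanSpace.single j 1) *
      radialField h (q x) j) * η x := by
  have hB := H.contDiff_comp_mul hU hq hη hs
  have hBs : ∀ j, tsupport (fun x => radialField h (q x) j * η x) ⊆ tsupport η := fun j =>
    tsupport_mul_subset_right
  have hBc : ∀ j, HasCompactSupport (fun x => radialField h (q x) j * η x) := fun j =>
    HasCompactSupport.mul_left hc
  have hw' : ContinuousOn (fderiv ℝ w) U := hw.continuousOn_fderiv_of_isOpen hU le_rfl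
  have h1 : ∀ j, Integrable fun x =>
      w x * fderiv ℝ (fun x => radialField h (q x) j * η x) x (EuclideanSpace.single j 1) := by
    intro j
    have hs' := tsupport_fderiv_apply_subset ℝ (f := fun x => radialField h (q x) j * η x)
      (EuclideanSpace.single j 1)
    refine (hw.continuousOn.continuous_mul_of_tsupport_subset hU
      (((hB j).continuous_fderiv one_ne_zero).clm_apply continuous_const)
      (hs'.trans ((hBs j).trans hs))).integrable_of_hasCompactSupport
      (HasCompactSupport.mul_left ((hBc j).of_isClosed_subset (isClosed_tsupport _) hs'))
  have h2 : ∀ j, Integrable fun x =>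
      fderiv ℝ w x (EuclideanSpace.single j 1) * (radialField h (q x) j * η x) := fun j =>
    ((hw'.clm_apply continuousOn_const).continuous_mul_of_tsupport_subset hU (hB j).continuous
      ((hBs j).trans hs)).integrable_of_hasCompactSupport (HasCompactSupport.mul_left (hBc j))
  simp only [weightedDiv, Finset.mul_sum, Finset.sum_mul, mul_assoc]
  rw [integral_finsetSum _ fun j _ => h1 j, integral_finsetSum _ fun j _ => h2 j,
    ← Finset.sum_neg_distrib]
  refine Finset.sum_congr rfl fun j _ => ?_
  exact integral_mul_fderiv_eq_neg_of_compactSupport hU (hw.differentiableOn one_ne_zero) hw' (hB j)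
    (hBc j) ((hBs j).trans hs) _

/-- The coercivity constant of the spatial energy estimate. -/
noncomputable def energyConst (n : ℕ) (g : ForchheimerPoly) (B : ℝ) (m : ℕ) : ℝ :=
  (n ^ 2 * (2 * (2 * m + 2) * B)) ^ 2 / (2 * (1 - g.a))

theorem energyConst_nonneg (g : ForchheimerPoly) (B : ℝ) (m : ℕ) : 0 ≤ energyConst n g B m :=
  div_nonneg (sq_nonneg _) (by linarith [g.a_lt_one])

theorem abs_radialField_apply_le (h : ℝ → ℝ) (y : EuclideanSpace ℝ (Fin n)) (j : Fin n) :
    |radialField h y j| ≤ |h ‖y‖| * ‖y‖ :=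
  (PiLp.norm_apply_le (radialField h y) j).trans (norm_smul_le _ _)

/-- Pointwise coercivity with the cutoff included: d stands for the gradient of ψ^(2m+2) and z for
ψ. Half of the coercive term pays for the contribution of d. -/
theorem le_sum_radialJac_mul (g : ForchheimerPoly) {σ : ℝ} (hσ : 0 ≤ σ) {B : ℝ}
    (m : ℕ) (y : EuclideanSpace ℝ (Fin n))
    (L : EuclideanSpace ℝ (Fin n) →L[ℝ] EuclideanSpace ℝ (Fin n))
    (hL : ∀ i j, L (EuclideanSpace.single i 1) j = L (EuclideanSpace.single j 1) i)
    {z : ℝ} (hz : 0 ≤ z) (d : Fin n → ℝ) (hd : ∀ i, |d i| ≤ (2 * m + 2) * B * z ^ (2 * m + 1)) :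
    (1 - g.a) / 2 * (g.K ‖y‖ * ‖y‖ ^ σ * frobSq L * z ^ (2 * m + 2))
      - energyConst n g B m * (g.K ‖y‖ * (‖y‖ ^ σ * ‖y‖ ^ 2) * z ^ (2 * m)) ≤
      ∑ i, ∑ j, radialJac g.K (fun r => -g.slopeK r * g.K r) y L j i *
        (radialJac (fun r => r ^ σ) (fun r => σ * r ^ σ) y L i j * z ^ (2 * m + 2)
          + radialField (fun r => r ^ σ) y j * d i) := by
  have hr : 0 ≤ ‖y‖ := norm_nonneg y
  have hK := g.K_pos hr
  have hb0 := g.slopeK_nonneg hr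
  have hb1 := g.slopeK_le hr
  have ha1 := g.a_lt_one
  have hrσ : 0 ≤ ‖y‖ ^ σ := Real.rpow_nonneg hr σ
  set S := frobSq L with hS
  have hS0 : 0 ≤ S := frobSq_nonneg L
  have h1 := frobSq_le_sum_radialJac_mul g hσ y L hL
  rw [← hS] at h1
  -- Bound for one of the n² cross terms; the factor 2 dominates 1 + `g.slopeK`.
  set R := 2 * g.K ‖y‖ * √S * (‖y‖ ^ σ * ‖y‖ * ((2 * m + 2) * B * z ^ (2 * m + 1))) with hR
  have h2 : ∀ i j, -R ≤ radialJac g.K (fun r => -g.slopeK r * g.K r) y L j i *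
      (radialField (fun r => r ^ σ) y j * d i) := by
    intro i j
    refine (abs_le.1 ?_).1
    rw [abs_mul, abs_mul]
    have e1 := abs_radialJac_le g.K (fun r => -g.slopeK r * g.K r) y L j i
    have e2 := abs_radialField_apply_le (fun r => r ^ σ) y j
    have e3 := hd i
    rw [← hS] at e1
    simp only [abs_mul, abs_neg, abs_of_nonneg hb0, abs_of_pos hK] at e1
    simp only [abs_of_nonneg hrσ] at e2
    have e4 : (g.K ‖y‖ + g.slopeK ‖y‖ * g.K ‖y‖) * √S ≤ 2 * g.K ‖y‖ * √S :=
      mul_le_mul_of_nonneg_right (by nlinarith) (Real.sqrt_nonneg _)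
    exact mul_le_mul (e1.trans e4) (mul_le_mul e2 e3 (abs_nonneg _) (by positivity))
      (by positivity) (by positivity)
  have h3 : ∑ i, ∑ j, radialJac g.K (fun r => -g.slopeK r * g.K r) y L j i *
        (radialJac (fun r => r ^ σ) (fun r => σ * r ^ σ) y L i j * z ^ (2 * m + 2)
          + radialField (fun r => r ^ σ) y j * d i)
      = (∑ i, ∑ j, radialJac g.K (fun r => -g.slopeK r * g.K r) y L i j *
        radialJac (fun r => r ^ σ) (fun r => σ * r ^ σ) y L j i) * z ^ (2 * m + 2)
        + ∑ i, ∑ j, radialJac g.K (fun r => -g.slopeK r * g.K r) y L j i *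
      (radialField (fun r => r ^ σ) y j * d i) := by
    simp only [mul_add, Finset.sum_add_distrib, ← mul_assoc, ← Finset.sum_mul]
    rw [Finset.sum_comm]
  have h4 : -((n : ℝ) ^ 2 * R) ≤ ∑ i, ∑ j, radialJac g.K (fun r => -g.slopeK r * g.K r) y L j i *
      (radialField (fun r => r ^ σ) y j * d i) := by
    calc -((n : ℝ) ^ 2 * R) = ∑ _i : Fin n, ∑ _j : Fin n, -R := by
          simp
          ring
      _ ≤ _ := Finset.sum_le_sum fun i _ => Finset.sum_le_sum fun j _ => h2 i j
  rw [h3]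
  have h5 := mul_le_mul_of_nonneg_right h1 (pow_nonneg hz (2 * m + 2))
  refine le_trans ?_ (add_le_add h5 h4)
  -- Splitting z^(2m+1) = z^(m+1) z^m makes the cross term NPQ. Completing the square with
  -- coefficient (1-a)/2 on P² produces `energyConst`.
  set N := (n : ℝ) ^ 2 * (2 * (2 * m + 2) * B) with hN
  set P := √S * z ^ (m + 1) with hP
  set Q := ‖y‖ * z ^ m with hQ
  have e1 : g.K ‖y‖ * ‖y‖ ^ σ * S * z ^ (2 * m + 2) = g.K ‖y‖ * ‖y‖ ^ σ * P ^ 2 := by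
    rw [hP, mul_pow, Real.sq_sqrt hS0]
    ring
  have e2 : (n : ℝ) ^ 2 * R = g.K ‖y‖ * ‖y‖ ^ σ * (N * P * Q) := by
    rw [hR, hP, hQ, hN]
    ring
  have e3 : g.K ‖y‖ * (‖y‖ ^ σ * ‖y‖ ^ 2) * z ^ (2 * m) = g.K ‖y‖ * ‖y‖ ^ σ * Q ^ 2 := by
    rw [hQ]
    ring
  have e4 : energyConst n g B m = N ^ 2 / (2 * (1 - g.a)) := rfl
  rw [e2, e3, e4, mul_assoc (1 - g.a), e1]
  have e5 : N * P * Q ≤ (1 - g.a) / 2 * P ^ 2 + N ^ 2 / (2 * (1 - g.a)) * Q ^ 2 := by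
    have hb : 0 < 1 - g.a := by linarith
    have : (1 - g.a) / 2 * P ^ 2 + N ^ 2 / (2 * (1 - g.a)) * Q ^ 2 - N * P * Q
        = ((1 - g.a) * P - N * Q) ^ 2 / (2 * (1 - g.a)) := by
      field_simp
      ring
    linarith [show 0 ≤ ((1 - g.a) * P - N * Q) ^ 2 / (2 * (1 - g.a)) by positivity]
  have e6 := mul_le_mul_of_nonneg_left e5 (mul_nonneg hK.le hrσ)
  linarith

theorem integrable_energy_density (g : ForchheimerPoly) {σ : ℝ} (hσ : 0 ≤ σ) (hU : IsOpen U)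
    (hq : ContDiffOn ℝ 1 q U) {B : ℝ} {ψ : EuclideanSpace ℝ (Fin n) → ℝ} (hψ : IsCutoff U B ψ)
    {m : ℕ} (hm : m ≠ 0) :
    Integrable fun x => g.K ‖q x‖ * ‖q x‖ ^ σ * frobSq (fderiv ℝ q x) * ψ x ^ m := by
  refine hψ.integrable_mul_pow hU ?_ m hm
  have h1 := hq.continuousOn_fderiv_of_isOpen hU le_rfl
  refine ContinuousOn.mul ?_ (continuous_frobSq.comp_continuousOn h1)
  exact ((((IsRadialProfile.conductivity g).mul (.rpow hσ)).continuous_comp_norm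
    (E := EuclideanSpace ℝ (Fin n))).comp_continuousOn hq.continuousOn)

theorem integrable_flux_density (g : ForchheimerPoly) {σ : ℝ} (hσ : 0 ≤ σ) (hU : IsOpen U)
    (hq : ContinuousOn q U) {B : ℝ} {ψ : EuclideanSpace ℝ (Fin n) → ℝ} (hψ : IsCutoff U B ψ)
    (l : ℕ) {m : ℕ} (hm : m ≠ 0) :
    Integrable fun x => g.K ‖q x‖ * (‖q x‖ ^ σ * ‖q x‖ ^ l) * ψ x ^ m := by
  refine hψ.integrable_mul_pow hU ?_ m hm
  have h1 := (((IsRadialProfile.conductivity g).mul (.rpow hσ)).continuous_comp_norm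
    (E := EuclideanSpace ℝ (Fin n))).comp_continuousOn hq
  refine (h1.mul (hq.norm.pow l)).congr fun x _ => ?_
  simp [mul_assoc]

/-- The spatial energy estimate: testing the divergence of the flux `K(|q|) q` with the divergence
of `|q|^σ q ψ^{2m+2}` controls the derivative of `q`. -/
theorem le_integral_div_mul_weightedDiv (g : ForchheimerPoly) {σ : ℝ} (hσ : 0 ≤ σ) (hU : IsOpen U)
    (hq : ContDiffOn ℝ 1 q U)
    (hsym : ∀ x ∈ U, ∀ i j, fderiv ℝ q x (EuclideanSpace.single i 1) j
      = fderiv ℝ q x (EuclideanSpace.single j 1) i)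
    {B : ℝ} {ψ : EuclideanSpace ℝ (Fin n) → ℝ} (hψ : IsCutoff U B ψ) {m : ℕ} (hm : m ≠ 0) :
    (1 - g.a) / 2 * (∫ x, g.K ‖q x‖ * ‖q x‖ ^ σ * frobSq (fderiv ℝ q x) * ψ x ^ (2 * m + 2))
      - energyConst n g B m * (∫ x, g.K ‖q x‖ * (‖q x‖ ^ σ * ‖q x‖ ^ 2) * ψ x ^ (2 * m)) ≤
    ∫ x, (∑ i, fderiv ℝ (fun x => radialField g.K (q x) i) x (EuclideanSpace.single i 1)) *
      weightedDiv (fun r => r ^ σ) q (fun x => ψ x ^ (2 * m + 2)) x := by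
  have HK := IsRadialProfile.conductivity g
  have Hσ := IsRadialProfile.rpow hσ
  set η : EuclideanSpace ℝ (Fin n) → ℝ := fun x => ψ x ^ (2 * m + 2) with hηdef
  have hη : ContDiff ℝ 1 η := hψ.contDiff_pow _
  have hsψ : tsupport η ⊆ tsupport ψ := IsCutoff.tsupport_pow_subset _ (by omega)
  have hs : tsupport η ⊆ U := hsψ.trans hψ.tsupport_subset
  have hc : HasCompactSupport η := hψ.hasCompactSupport_pow _ (by omega)
  have hA := HK.contDiffOn_comp hq
  have hB := Hσ.contDiff_comp_mul hU hq hη hs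
  have hBs : ∀ j, tsupport (fun x => radialField (fun r => r ^ σ) (q x) j * η x) ⊆ tsupport η :=
    fun j => tsupport_mul_subset_right
  have hBc : ∀ j, HasCompactSupport (fun x => radialField (fun r => r ^ σ) (q x) j * η x) :=
    fun j => HasCompactSupport.mul_left hc
  have hint : ∀ i j (v w : EuclideanSpace ℝ (Fin n)), Integrable fun x =>
      fderiv ℝ (fun x => radialField g.K (q x) i) x v *
        fderiv ℝ (fun x => radialField (fun r => r ^ σ) (q x) j * η x) x w := by
    intro i j v w
    have hs' := tsupport_fderiv_apply_subset ℝ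
      (f := fun x => radialField (fun r => r ^ σ) (q x) j * η x) w
    exact ((((hA i).continuousOn_fderiv_of_isOpen hU le_rfl).clm_apply
      continuousOn_const).continuous_mul_of_tsupport_subset hU
      (((hB j).continuous_fderiv one_ne_zero).clm_apply continuous_const)
      (hs'.trans ((hBs j).trans hs))).integrable_of_hasCompactSupport
      (HasCompactSupport.mul_left ((hBc j).of_isClosed_subset (isClosed_tsupport _) hs'))
  -- After the exchange, ∂ᵢFᵢ ∂ⱼGⱼ becomes ∂ⱼFᵢ ∂ᵢGⱼ, the form to which the pointwise coercivity
  -- applies.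
  have hswap : ∫ x, (∑ i, fderiv ℝ (fun x => radialField g.K (q x) i) x
        (EuclideanSpace.single i 1)) * weightedDiv (fun r => r ^ σ) q η x
      = ∫ x, ∑ i, ∑ j, fderiv ℝ (fun x => radialField g.K (q x) i) x (EuclideanSpace.single j 1) *
        fderiv ℝ (fun x => radialField (fun r => r ^ σ) (q x) j * η x) x
          (EuclideanSpace.single i 1) := by
    simp only [weightedDiv, Finset.sum_mul_sum]
    rw [integral_finsetSum _ fun i _ => integrable_finsetSum _ fun j _ => hint i j _ _,
      integral_finsetSum _ fun i _ => integrable_finsetSum _ fun j _ => hint i j _ _]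
    refine Finset.sum_congr rfl fun i _ => ?_
    rw [integral_finsetSum _ fun j _ => hint i j _ _, integral_finsetSum _ fun j _ => hint i j _ _]
    exact Finset.sum_congr rfl fun j _ =>
      integral_fderiv_mul_fderiv_comm hU (hA i) (hB j) (hBc j) ((hBs j).trans hs) _ _
  rw [hswap, ← integral_const_mul, ← integral_const_mul]
  have i1 := (integrable_energy_density g hσ hU hq hψ (m := 2 * m + 2) (by omega)).const_mul
    ((1 - g.a) / 2)
  have i2 := (integrable_flux_density g hσ hU hq.continuousOn hψ 2 (m := 2 * m)
    (by omega)).const_mul (energyConst n g B m)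
  rw [← integral_sub i1 i2]
  refine integral_mono (i1.sub i2) (integrable_finsetSum _ fun i _ =>
    integrable_finsetSum _ fun j _ => hint i j _ _) fun x => ?_
  by_cases hx : x ∈ tsupport ψ
  · have hxU := hψ.tsupport_subset hx
    have key := le_sum_radialJac_mul g hσ (B := B) m (q x) (fderiv ℝ q x) (hsym x hxU)
      (hψ.nonneg x) (fun i => fderiv ℝ η x (EuclideanSpace.single i 1)) (fun i => by
        refine (hψ.abs_fderiv_pow_apply_single_le (2 * m + 1) x i).trans (le_of_eq ?_)
        push_cast
        ring)
    refine key.trans (le_of_eq ?_)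
    refine Finset.sum_congr rfl fun i _ => Finset.sum_congr rfl fun j _ => ?_
    rw [HK.fderiv_comp hU hq hxU, Hσ.fderiv_comp_mul hU hq hη hs]
  · have hx0 : ψ x = 0 := image_eq_zero_of_notMem_tsupport hx
    have h0 : fderiv ℝ η x = 0 := by
      by_contra h0
      exact hx (hsψ (support_fderiv_subset ℝ h0))
    have h1 : η x = 0 := by simp [hηdef, hx0]
    simp only [Hσ.fderiv_comp_mul hU hq hη hs, h0, h1, hx0]
    simp [hm]

/-- The embedding estimate: a bound for `u` upgrades the integrability of its gradient. -/
theorem integral_flux_le_of_abs_le (g : ForchheimerPoly) {σ : ℝ} (hσ : 0 ≤ σ) (hU : IsOpen U)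
    (hq : ContDiffOn ℝ 1 q U) {u : EuclideanSpace ℝ (Fin n) → ℝ} (hu : ContDiffOn ℝ 1 u U)
    (huq : ∀ x ∈ U, ∀ j, fderiv ℝ u x (EuclideanSpace.single j 1) = q x j)
    {B : ℝ} {ψ : EuclideanSpace ℝ (Fin n) → ℝ} (hψ : IsCutoff U B ψ) {m : ℕ} (hm : m ≠ 0)
    {M : ℝ} (hM : ∀ x ∈ tsupport ψ, |u x| ≤ M) (hM0 : 0 ≤ M) :
    ∫ x, g.K ‖q x‖ * (‖q x‖ ^ σ * ‖q x‖ ^ 4) * ψ x ^ (2 * m + 2) ≤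
      2 * M ^ 2 * ((n * (σ + 4)) ^ 2 *
          ∫ x, g.K ‖q x‖ * ‖q x‖ ^ σ * frobSq (fderiv ℝ q x) * ψ x ^ (2 * m + 2))
        + 2 * M ^ 2 * ((n * ((2 * m + 2) * B)) ^ 2 *
          ∫ x, g.K ‖q x‖ * (‖q x‖ ^ σ * ‖q x‖ ^ 2) * ψ x ^ (2 * m)) := by
  have hσ2 : 0 ≤ σ + 2 := by linarith
  have H := (IsRadialProfile.conductivity g).mul (IsRadialProfile.rpow hσ2)
  set η : EuclideanSpace ℝ (Fin n) → ℝ := fun x => ψ x ^ (2 * m + 2) with hηdef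
  have hη : ContDiff ℝ 1 η := hψ.contDiff_pow _
  have hsψ : tsupport η ⊆ tsupport ψ := IsCutoff.tsupport_pow_subset _ (by omega)
  have hs : tsupport η ⊆ U := hsψ.trans hψ.tsupport_subset
  have hc : HasCompactSupport η := hψ.hasCompactSupport_pow _ (by omega)
  have hrp : ∀ x, ‖q x‖ ^ (σ + 2) = ‖q x‖ ^ σ * ‖q x‖ ^ 2 := fun x => by
    rw [Real.rpow_add_of_nonneg (norm_nonneg _) hσ two_pos.le, Real.rpow_two]
  have hibp := H.integral_mul_weightedDiv hU hq hη hc hs hu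
  -- Testing u against the field K|q|^(σ+2) q reproduces K|q|^(σ+4), since ∇u = q.
  have hZ : ∀ x, (∑ j, fderiv ℝ u x (EuclideanSpace.single j 1) *
      radialField (fun r => g.K r * r ^ (σ + 2)) (q x) j) * η x
      = g.K ‖q x‖ * (‖q x‖ ^ σ * ‖q x‖ ^ 4) * ψ x ^ (2 * m + 2) := by
    intro x
    by_cases hx : x ∈ tsupport ψ
    · have h1 : ∑ j, fderiv ℝ u x (EuclideanSpace.single j 1) *
          radialField (fun r => g.K r * r ^ (σ + 2)) (q x) j
          = g.K ‖q x‖ * ‖q x‖ ^ (σ + 2) * ‖q x‖ ^ 2 := by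
        rw [EuclideanSpace.real_norm_sq_eq (q x), Finset.mul_sum]
        refine Finset.sum_congr rfl fun j _ => ?_
        rw [huq x (hψ.tsupport_subset hx), radialField, PiLp.smul_apply, smul_eq_mul]
        ring
      rw [h1, hrp]
      ring
    · have hx0 : ψ x = 0 := image_eq_zero_of_notMem_tsupport hx
      simp [hηdef, hx0]
  simp only [hZ] at hibp
  have iX := integrable_energy_density g hσ hU hq hψ (m := 2 * m + 2) (by omega)
  have iY := integrable_flux_density g hσ hU hq.continuousOn hψ 2 (m := 2 * m) (by omega)
  have iZ := integrable_flux_density g hσ hU hq.continuousOn hψ 4 (m := 2 * m + 2) (by omega)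
  set α : ℝ := n * (σ + 4) with hα
  set β : ℝ := n * ((2 * m + 2) * B) with hβ
  -- Young's inequality with weight 1/2 on the target density; absorbing that half at the end gives
  -- the factors 2 in the statement.
  have hpt : ∀ x, -(u x * weightedDiv (fun r => g.K r * r ^ (σ + 2)) q η x) ≤
      1 / 2 * (g.K ‖q x‖ * (‖q x‖ ^ σ * ‖q x‖ ^ 4) * ψ x ^ (2 * m + 2))
      + (M ^ 2 * α ^ 2 * (g.K ‖q x‖ * ‖q x‖ ^ σ * frobSq (fderiv ℝ q x) * ψ x ^ (2 * m + 2))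
      + M ^ 2 * β ^ 2 * (g.K ‖q x‖ * (‖q x‖ ^ σ * ‖q x‖ ^ 2) * ψ x ^ (2 * m))) := by
    intro x
    rw [H.weightedDiv_eq hU hq hη hs]
    by_cases hx : x ∈ tsupport ψ
    · have hr : 0 ≤ ‖q x‖ := norm_nonneg _
      set r := ‖q x‖ with hrdef
      set S := frobSq (fderiv ℝ q x) with hS
      have hS0 : 0 ≤ S := frobSq_nonneg _
      have hK := g.K_pos hr
      have hb0 := g.slopeK_nonneg hr
      have hb1 := (g.slopeK_le hr).trans g.a_lt_one.le
      have hrσ : 0 ≤ r ^ σ := Real.rpow_nonneg hr σ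
      have hz := hψ.nonneg x
      set z := ψ x with hzdef
      have hB0 := hψ.bound_nonneg
      have hterm : ∀ j, |radialJac (fun r => g.K r * r ^ (σ + 2))
          (fun r => -g.slopeK r * g.K r * r ^ (σ + 2) + g.K r * ((σ + 2) * r ^ (σ + 2))) (q x)
          (fderiv ℝ q x) j j * η x + radialField (fun r => g.K r * r ^ (σ + 2)) (q x) j *
            fderiv ℝ η x (EuclideanSpace.single j 1)| ≤
          (σ + 4) * (g.K r * (r ^ σ * r ^ 2)) * √S * z ^ (2 * m + 2)
            + g.K r * (r ^ σ * r ^ 2) * r * ((2 * m + 2) * B * z ^ (2 * m + 1)) := by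
        intro j
        refine (abs_add_le _ _).trans ?_
        rw [abs_mul, abs_mul]
        have e1 := abs_radialJac_le (fun r => g.K r * r ^ (σ + 2))
          (fun r => -g.slopeK r * g.K r * r ^ (σ + 2) + g.K r * ((σ + 2) * r ^ (σ + 2))) (q x)
          (fderiv ℝ q x) j j
        have e2 := abs_radialField_apply_le (fun r => g.K r * r ^ (σ + 2)) (q x) j
        have e3 := hψ.abs_fderiv_pow_apply_single_le (2 * m + 1) x j
        simp only [← hrdef, ← hS] at e1 e2
        rw [hrdef, hrp, ← hrdef] at e1 e2
        have hP : 0 ≤ g.K r * (r ^ σ * r ^ 2) := by positivity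
        have e4 : |g.K r * (r ^ σ * r ^ 2)| + |-g.slopeK r * g.K r * (r ^ σ * r ^ 2)
            + g.K r * ((σ + 2) * (r ^ σ * r ^ 2))| ≤ (σ + 4) * (g.K r * (r ^ σ * r ^ 2)) := by
          have : -g.slopeK r * g.K r * (r ^ σ * r ^ 2) + g.K r * ((σ + 2) * (r ^ σ * r ^ 2))
              = (σ + 2 - g.slopeK r) * (g.K r * (r ^ σ * r ^ 2)) := by ring
          rw [this, abs_of_nonneg hP, abs_of_nonneg (mul_nonneg (by linarith) hP)]
          nlinarith
        rw [abs_of_nonneg hP] at e2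
        have e5 : |η x| = z ^ (2 * m + 2) := abs_of_nonneg (by positivity)
        rw [e5]
        refine add_le_add (mul_le_mul_of_nonneg_right (e1.trans
          (mul_le_mul_of_nonneg_right e4 (Real.sqrt_nonneg _))) (by positivity))
          (mul_le_mul e2 (e3.trans (le_of_eq ?_)) (abs_nonneg _) (by positivity))
        push_cast
        ring
      have hsum : |∑ j, (radialJac (fun r => g.K r * r ^ (σ + 2))
          (fun r => -g.slopeK r * g.K r * r ^ (σ + 2) + g.K r * ((σ + 2) * r ^ (σ + 2))) (q x)
          (fderiv ℝ q x) j j * η x + radialField (fun r => g.K r * r ^ (σ + 2)) (q x) j *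
            fderiv ℝ η x (EuclideanSpace.single j 1))| ≤
          n * ((σ + 4) * (g.K r * (r ^ σ * r ^ 2)) * √S * z ^ (2 * m + 2)
            + g.K r * (r ^ σ * r ^ 2) * r * ((2 * m + 2) * B * z ^ (2 * m + 1))) := by
        refine (Finset.abs_sum_le_sum_abs _ _).trans ((Finset.sum_le_sum fun j _ => hterm j).trans
          (le_of_eq ?_))
        rw [Finset.sum_const, Finset.card_univ, Fintype.card_fin, nsmul_eq_mul]
      refine (neg_le_abs _).trans ?_
      rw [abs_mul]
      refine (mul_le_mul (hM x hx) hsum (abs_nonneg _) hM0).trans ?_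
      -- Halving the powers of the cutoff again: X pairs with P through the Hessian term and with Q
      -- through the term with ∇ψ.
      set X := r ^ 2 * z ^ (m + 1) with hX
      set P := √S * z ^ (m + 1) with hP
      set Q := r * z ^ m with hQ
      have e0 : √S ^ 2 = S := Real.sq_sqrt hS0
      have e1 : M * (n * ((σ + 4) * (g.K r * (r ^ σ * r ^ 2)) * √S * z ^ (2 * m + 2)
            + g.K r * (r ^ σ * r ^ 2) * r * ((2 * m + 2) * B * z ^ (2 * m + 1))))
          = g.K r * r ^ σ * (M * α * X * P + M * β * X * Q) := by
        rw [hX, hP, hQ, hα, hβ]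
        ring
      have e2 : 1 / 2 * (g.K r * (r ^ σ * r ^ 4) * z ^ (2 * m + 2))
          + (M ^ 2 * α ^ 2 * (g.K r * r ^ σ * S * z ^ (2 * m + 2))
          + M ^ 2 * β ^ 2 * (g.K r * (r ^ σ * r ^ 2) * z ^ (2 * m)))
          = g.K r * r ^ σ * (1 / 2 * X ^ 2 + M ^ 2 * α ^ 2 * P ^ 2 + M ^ 2 * β ^ 2 * Q ^ 2) := by
        rw [hX, hP, hQ, mul_pow (√S), e0]
        ring
      rw [e1, e2]
      refine mul_le_mul_of_nonneg_left ?_ (mul_nonneg hK.le hrσ)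
      nlinarith [sq_nonneg (X / 2 - M * α * P), sq_nonneg (X / 2 - M * β * Q)]
    · have hx0 : ψ x = 0 := image_eq_zero_of_notMem_tsupport hx
      have h0 : fderiv ℝ η x = 0 := by
        by_contra h0
        exact hx (hsψ (support_fderiv_subset ℝ h0))
      have h1 : η x = 0 := by simp [hηdef, hx0]
      simp [h0, h1, hx0, hm]
  have i1 := iX.const_mul (M ^ 2 * α ^ 2)
  have i2 := iY.const_mul (M ^ 2 * β ^ 2)
  have i3 := iZ.const_mul (1 / 2)
  have i4 : Integrable fun x =>
      M ^ 2 * α ^ 2 * (g.K ‖q x‖ * ‖q x‖ ^ σ * frobSq (fderiv ℝ q x) * ψ x ^ (2 * m + 2))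
      + M ^ 2 * β ^ 2 * (g.K ‖q x‖ * (‖q x‖ ^ σ * ‖q x‖ ^ 2) * ψ x ^ (2 * m)) := i1.add i2
  have hfin := integral_mono (H.integrable_mul_weightedDiv hU hq hη hc hs hu.continuousOn).neg
    (i3.add i4) hpt
  simp only [Pi.neg_apply, Pi.add_apply] at hfin
  rw [integral_neg, hibp, neg_neg, integral_add i3 i4, integral_const_mul,
    integral_add i1 i2, integral_const_mul, integral_const_mul] at hfin
  linarith

end SpatialEstimates

/-! ### Differentiating the gradient energy in time -/

section TimeDerivative

open Filter Topology

variable {n : ℕ} {U : Set (EuclideanSpace ℝ (Fin n))} {p : EuclideanSpace ℝ (Fin n) → ℝ → ℝ}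

theorem contDiffOn_one_of_continuousOn_fderiv {E F : Type*} [NormedAddCommGroup E]
    [NormedSpace ℝ E] [NormedAddCommGroup F] [NormedSpace ℝ F] {f : E → F} {U : Set E}
    (hU : IsOpen U) (hf : ∀ x ∈ U, DifferentiableAt ℝ f x) (hf' : ContinuousOn (fderiv ℝ f) U) :
    ContDiffOn ℝ 1 f U := by
  rw [show (1 : WithTop ℕ∞) = 0 + 1 from rfl, contDiffOn_succ_iff_fderiv_of_isOpen hU]
  exact ⟨fun x hx => (hf x hx).differentiableWithinAt, by simp, contDiffOn_zero.2 hf'⟩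

theorem ContinuousOn.section_left {X Y Z : Type*} [TopologicalSpace X] [TopologicalSpace Y]
    [TopologicalSpace Z] {f : X × Y → Z} {s : Set X} {t : Set Y} (hf : ContinuousOn f (s ×ˢ t))
    {y : Y} (hy : y ∈ t) : ContinuousOn (fun x => f (x, y)) s :=
  hf.comp (by fun_prop) fun _ hx => ⟨hx, hy⟩

namespace IsC21On

theorem fderiv_apply (hp : IsC21On U p) {x : EuclideanSpace ℝ (Fin n)} (hx : x ∈ U) {t : ℝ}
    (ht : 0 < t) : fderiv ℝ (fun y => p y t) x = innerSL ℝ (spaceGrad p x t) := by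
  ext w
  exact ((hp.differentiableAt_space x hx t ht).hasGradientAt.fderiv_apply)

theorem fderiv_apply_single (hp : IsC21On U p) {x : EuclideanSpace ℝ (Fin n)} (hx : x ∈ U) {t : ℝ}
    (ht : 0 < t) (j : Fin n) :
    fderiv ℝ (fun y => p y t) x (EuclideanSpace.single j 1) = spaceGrad p x t j := by
  rw [hp.fderiv_apply hx ht]
  simp [EuclideanSpace.inner_single_right]

theorem contDiffOn_grad (hp : IsC21On U p) (hU : IsOpen U) {t : ℝ} (ht : 0 < t) :
    ContDiffOn ℝ 1 (fun x => spaceGrad p x t) U :=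
  contDiffOn_one_of_continuousOn_fderiv hU (fun x hx => hp.differentiableAt_grad x hx t ht)
    (hp.continuousOn_hessian.section_left (mem_Ioi.2 ht))

theorem contDiffOn_space (hp : IsC21On U p) (hU : IsOpen U) {t : ℝ} (ht : 0 < t) :
    ContDiffOn ℝ 1 (fun x => p x t) U := by
  refine contDiffOn_one_of_continuousOn_fderiv hU
    (fun x hx => hp.differentiableAt_space x hx t ht) ?_
  exact ((innerSL ℝ).continuous.comp_continuousOn
    (hp.continuousOn_grad.section_left (mem_Ioi.2 ht))).congr fun x hx => hp.fderiv_apply hx ht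

/-- Symmetry of the second derivative needs only differentiability of p(·,t) near x and of its
gradient at x. It supplies the symmetric matrix required by the coercivity. -/
theorem fderiv_grad_symm (hp : IsC21On U p) (hU : IsOpen U) {x : EuclideanSpace ℝ (Fin n)}
    (hx : x ∈ U) {t : ℝ} (ht : 0 < t) (i j : Fin n) :
    fderiv ℝ (fun y => spaceGrad p y t) x (EuclideanSpace.single i 1) j
      = fderiv ℝ (fun y => spaceGrad p y t) x (EuclideanSpace.single j 1) i := by
  have h1 : ∀ᶠ y in 𝓝 x, HasFDerivAt (fun y => p y t) (innerSL ℝ (spaceGrad p y t)) y := by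
    filter_upwards [hU.mem_nhds hx] with y hy
    rw [← hp.fderiv_apply hy ht]
    exact (hp.differentiableAt_space y hy t ht).hasFDerivAt
  have h2 := ((innerSL ℝ (E := EuclideanSpace ℝ (Fin n))).hasFDerivAt
    (x := spaceGrad p x t)).comp x (hp.differentiableAt_grad x hx t ht).hasFDerivAt
  have h3 := second_derivative_symmetric_of_eventually_of_real h1 h2 (EuclideanSpace.single i 1)
    (EuclideanSpace.single j 1)
  change inner ℝ (fderiv ℝ (fun y => spaceGrad p y t) x (EuclideanSpace.single i 1))
    (EuclideanSpace.single j 1) = inner ℝ (fderiv ℝ (fun y => spaceGrad p y t) x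
      (EuclideanSpace.single j 1)) (EuclideanSpace.single i 1) at h3
  simpa [EuclideanSpace.inner_single_right] using h3

end IsC21On

/-- Extends a product from U to all of space: near a point outside k it is identically zero. The
factor D may depend on time, as the weighted divergence of ∇p does. -/
theorem ContinuousOn.mul_of_eq_zero_prod {f D : EuclideanSpace ℝ (Fin n) × ℝ → ℝ}
    (hU : IsOpen U) (hf : ContinuousOn f (U ×ˢ Ioi 0)) (hD : ContinuousOn D (univ ×ˢ Ioi 0))
    {k : Set (EuclideanSpace ℝ (Fin n))} (hk : IsClosed k) (hkU : k ⊆ U)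
    (h0 : ∀ x ∉ k, ∀ t, D (x, t) = 0) :
    ContinuousOn (fun z => f z * D z) (univ ×ˢ Ioi 0) := by
  intro z hz
  by_cases hx : z.1 ∈ k
  · exact ((hf.continuousAt ((hU.prod isOpen_Ioi).mem_nhds ⟨hkU hx, hz.2⟩)).mul
      (hD.continuousAt ((isOpen_univ.prod isOpen_Ioi).mem_nhds hz))).continuousWithinAt
  · have h0 : (fun z => f z * D z) =ᶠ[𝓝 z] fun _ => 0 := by
      filter_upwards [continuous_fst.continuousAt.preimage_mem_nhds
        (hk.isOpen_compl.mem_nhds hx)] with y hy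
      rw [show y = (y.1, y.2) from rfl, h0 y.1 hy, mul_zero]
    exact (continuousAt_const.congr h0.symm).continuousWithinAt

theorem ContinuousOn.mul_of_tsupport_subset_prod {f : EuclideanSpace ℝ (Fin n) × ℝ → ℝ}
    (hU : IsOpen U) (hf : ContinuousOn f (U ×ˢ Ioi 0)) {η : EuclideanSpace ℝ (Fin n) → ℝ}
    (hη : Continuous η) (hs : tsupport η ⊆ U) :
    ContinuousOn (fun z : EuclideanSpace ℝ (Fin n) × ℝ => f z * η z.1) (univ ×ˢ Ioi 0) :=
  hf.mul_of_eq_zero_prod hU (hη.comp continuous_fst).continuousOn (isClosed_tsupport η) hs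
    fun _ hx _ => image_eq_zero_of_notMem_tsupport hx

/-- Integrals in space of functions supported in a fixed compact set are continuous in time. -/
theorem continuousOn_integral_space {f : EuclideanSpace ℝ (Fin n) × ℝ → ℝ}
    (hf : ContinuousOn f (univ ×ˢ Ioi 0)) {k : Set (EuclideanSpace ℝ (Fin n))} (hk : IsCompact k)
    (h0 : ∀ x ∉ k, ∀ t, f (x, t) = 0) :
    ContinuousOn (fun t => ∫ x, f (x, t)) (Ioi 0) := by
  refine continuousOn_integral_of_compact_support (f := fun t x => f (x, t)) hk ?_
    fun t x _ hx => h0 x hx t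
  exact hf.comp (by fun_prop : Continuous fun z : ℝ × EuclideanSpace ℝ (Fin n) =>
    (z.2, z.1)).continuousOn fun z hz => ⟨mem_univ _, hz.1⟩

theorem IsCutoff.continuousOn_integral_mul_pow {B : ℝ} {ψ : EuclideanSpace ℝ (Fin n) → ℝ}
    (hψ : IsCutoff U B ψ) (hU : IsOpen U) {f : EuclideanSpace ℝ (Fin n) → ℝ → ℝ}
    (hf : ContinuousOn (fun z : EuclideanSpace ℝ (Fin n) × ℝ => f z.1 z.2) (U ×ˢ Ioi 0))
    {m : ℕ} (hm : m ≠ 0) : ContinuousOn (fun t => ∫ x, f x t * ψ x ^ m) (Ioi 0) := by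
  refine continuousOn_integral_space (f := fun z => f z.1 z.2 * ψ z.1 ^ m)
    (hf.mul_of_tsupport_subset_prod hU (hψ.contDiff_pow m).continuous
    ((IsCutoff.tsupport_pow_subset m hm).trans hψ.tsupport_subset)) hψ.hasCompactSupport ?_
  intro x hx t
  simp [image_eq_zero_of_notMem_tsupport hx, hm]

/-- Joint continuity is read off from the expanded form, where only ∇p and ∇²p occur. -/
theorem IsRadialProfile.continuousOn_weightedDiv {h k : ℝ → ℝ} (H : IsRadialProfile h k)
    (hU : IsOpen U) (hp : IsC21On U p) {η : EuclideanSpace ℝ (Fin n) → ℝ} (hη : ContDiff ℝ 1 η)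
    (hs : tsupport η ⊆ U) :
    ContinuousOn (fun z : EuclideanSpace ℝ (Fin n) × ℝ =>
      weightedDiv h (fun x => spaceGrad p x z.2) η z.1) (univ ×ˢ Ioi 0) := by
  have hq := hp.continuousOn_grad
  have hH := hp.continuousOn_hessian
  have h1 : ContinuousOn (fun z : EuclideanSpace ℝ (Fin n) × ℝ => ∑ j,
      (radialJac h k (spaceGrad p z.1 z.2) (fderiv ℝ (fun x => spaceGrad p x z.2) z.1) j j * η z.1
        + radialField h (spaceGrad p z.1 z.2) j *
          fderiv ℝ η z.1 (EuclideanSpace.single j 1))) (univ ×ˢ Ioi 0) := by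
    refine continuousOn_finsetSum _ fun j _ => ContinuousOn.add ?_ ?_
    · refine ContinuousOn.mul_of_tsupport_subset_prod hU ?_ hη.continuous hs
      have h2 := (H.continuous_radialDeriv.comp_continuousOn hq).clm_apply
        (hH.clm_apply (continuousOn_const (c := EuclideanSpace.single j (1 : ℝ))))
      exact (EuclideanSpace.proj (𝕜 := ℝ) j).continuous.comp_continuousOn h2
    · refine ContinuousOn.mul_of_tsupport_subset_prod hU
        (f := fun z => radialField h (spaceGrad p z.1 z.2) j)
        (η := fun x => fderiv ℝ η x (EuclideanSpace.single j 1)) ?_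
        ((hη.continuous_fderiv one_ne_zero).clm_apply continuous_const)
        ((tsupport_fderiv_apply_subset ℝ _).trans hs)
      exact (EuclideanSpace.proj (𝕜 := ℝ) j).continuous.comp_continuousOn
        (H.continuous_radialField.comp_continuousOn hq)
  exact h1.congr fun z hz => H.weightedDiv_eq hU (hp.contDiffOn_grad hU hz.2) hη hs z.1

/-- Convexity of `y ↦ ‖y‖ ^ (σ + 2) / (σ + 2)`. -/
theorem inner_radialField_sub_le {E : Type*} [NormedAddCommGroup E] [InnerProductSpace ℝ E]
    {σ : ℝ} (hσ : 0 ≤ σ) (y z : E) :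
    inner ℝ (radialField (fun r => r ^ σ) y) (z - y) ≤
      ‖z‖ ^ (σ + 2) / (σ + 2) - ‖y‖ ^ (σ + 2) / (σ + 2) := by
  have hy := norm_nonneg y
  have hz := norm_nonneg z
  have h1 : (‖z‖ * ‖y‖ ^ (σ + 1)) ≤
      ‖z‖ ^ (σ + 2) / (σ + 2) + (‖y‖ ^ (σ + 1)) ^ ((σ + 2) / (σ + 1)) / ((σ + 2) / (σ + 1)) := by
    -- Conjugate exponents σ+2 and (σ+2)/(σ+1); the tangent inequality then follows from
    -- Cauchy–Schwarz.
    refine Real.young_inequality_of_nonneg hz (Real.rpow_nonneg hy _) ?_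
    rw [Real.holderConjugate_iff]
    refine ⟨by linarith, ?_⟩
    field_simp
    ring
  rw [← Real.rpow_mul hy, mul_div_cancel₀ _ (by linarith : σ + 1 ≠ 0)] at h1
  have h2 : ‖y‖ ^ (σ + 2) = ‖y‖ ^ σ * ‖y‖ ^ 2 := by
    rw [Real.rpow_add_of_nonneg hy hσ two_pos.le, Real.rpow_two]
  have h3 : ‖y‖ ^ (σ + 1) = ‖y‖ ^ σ * ‖y‖ := by
    rw [Real.rpow_add_of_nonneg hy hσ one_pos.le, Real.rpow_one]
  have h4 : ‖y‖ ^ (σ + 2) / ((σ + 2) / (σ + 1)) = ‖y‖ ^ (σ + 2) - ‖y‖ ^ (σ + 2) / (σ + 2) := by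
    field_simp
    ring
  rw [radialField, inner_sub_right, inner_smul_left, inner_smul_left, real_inner_self_eq_norm_sq,
    RCLike.conj_to_real]
  have h5 := mul_le_mul_of_nonneg_left (real_inner_le_norm y z) (Real.rpow_nonneg hy σ)
  rw [h4] at h1
  nlinarith

/-- Convergence of difference quotients in time under the integral sign. -/
theorem tendsto_integral_slope_mul (hU : IsOpen U) (hp : IsC21On U p)
    {k : Set (EuclideanSpace ℝ (Fin n))} (hk : IsCompact k) (hkU : k ⊆ U)
    {f : EuclideanSpace ℝ (Fin n) × ℝ → ℝ} (hf : ContinuousOn f (univ ×ˢ Ioi 0))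
    (h0 : ∀ x ∉ k, ∀ t, f (x, t) = 0) {t : ℝ} (ht : 0 < t) :
    Tendsto (fun s => ∫ x, (s - t)⁻¹ * (p x s - p x t) * f (x, s)) (𝓝[≠] t)
      (𝓝 (∫ x, deriv (p x) t * f (x, t))) := by
  have hI : Icc (t / 2) (2 * t) ∈ 𝓝 t := Icc_mem_nhds (by linarith) (by linarith)
  have hIpos : ∀ s ∈ Icc (t / 2) (2 * t), 0 < s := fun s hs => by linarith [hs.1]
  have hsub : k ×ˢ Icc (t / 2) (2 * t) ⊆ U ×ˢ Ioi 0 := prod_mono hkU hIpos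
  obtain ⟨P, hP⟩ := (hk.prod isCompact_Icc).exists_bound_of_continuousOn
    (hp.continuousOn_time.mono hsub)
  obtain ⟨D, hD⟩ := (hk.prod isCompact_Icc).exists_bound_of_continuousOn
    (hf.mono (prod_mono (subset_univ k) hIpos))
  have hbound : ∀ s ∈ Icc (t / 2) (2 * t), s ≠ t → ∀ x,
      ‖(s - t)⁻¹ * (p x s - p x t) * f (x, s)‖ ≤ k.indicator (fun _ => P * D) x := by
    intro s hs hst x
    by_cases hx : x ∈ k
    · rw [indicator_of_mem hx, norm_mul, norm_mul, norm_inv]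
      have h1 : ‖p x s - p x t‖ ≤ P * ‖s - t‖ :=
        Convex.norm_image_sub_le_of_norm_deriv_le
          (fun r hr => hp.differentiableAt_time x (hkU hx) r (hIpos r hr))
          (fun r hr => hP (x, r) ⟨hx, hr⟩) (convex_Icc _ _) (mem_of_mem_nhds hI) hs
      have h2 : 0 < ‖s - t‖ := norm_pos_iff.2 (sub_ne_zero.2 hst)
      have h3 := hD (x, s) ⟨hx, hs⟩
      refine mul_le_mul ?_ h3 (norm_nonneg _) ?_
      · rw [inv_mul_le_iff₀ h2, mul_comm]
        exact h1
      · exact (norm_nonneg _).trans (hP (x, s) ⟨hx, hs⟩)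
    · simp [h0 x hx s, hx]
  refine tendsto_integral_filter_of_dominated_convergence (k.indicator fun _ => P * D) ?_ ?_ ?_ ?_
  · filter_upwards [mem_nhdsWithin_of_mem_nhds hI] with s hs
    have hspos := hIpos s hs
    have hfs : Continuous fun x => f (x, s) := by
      rw [← continuousOn_univ]
      exact hf.section_left (mem_Ioi.2 hspos)
    have hw : ContinuousOn (fun x => (s - t)⁻¹ * (p x s - p x t)) U :=
      continuousOn_const.mul ((hp.contDiffOn_space hU hspos).continuousOn.sub
        (hp.contDiffOn_space hU ht).continuousOn)
    have hsk : Function.support (fun x => f (x, s)) ⊆ k := fun x hx =>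
      by_contra fun hxk => hx (h0 x hxk s)
    have hss : tsupport (fun x => f (x, s)) ⊆ U := (closure_minimal hsk hk.isClosed).trans hkU
    exact (hw.continuous_mul_of_tsupport_subset hU hfs hss).aestronglyMeasurable
  · filter_upwards [mem_nhdsWithin_of_mem_nhds hI, self_mem_nhdsWithin] with s hs hst
    exact Eventually.of_forall (hbound s hs hst)
  · exact (integrable_indicator_iff hk.measurableSet).2 (integrableOn_const hk.measure_lt_top.ne)
  · refine Eventually.of_forall fun x => ?_
    by_cases hx : x ∈ k
    · have h1 := (hp.differentiableAt_time x (hkU hx) t ht).hasDerivAt.tendsto_slope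
      have h2 : Tendsto (fun s => f (x, s)) (𝓝[≠] t) (𝓝 (f (x, t))) := by
        have : ContinuousOn (fun s => f (x, s)) (Ioi 0) :=
          hf.comp (by fun_prop) fun s hs => ⟨mem_univ _, hs⟩
        exact (this.continuousAt (Ioi_mem_nhds ht)).tendsto.mono_left nhdsWithin_le_nhds
      refine (h1.mul h2).congr fun s => ?_
      simp [slope]
    · simp [h0 x hx]

/-- The derivative of the weighted integral of `‖∇p‖ ^ (σ + 2)`. No mixed derivative of `p` is
involved: by convexity, the increments lie between two difference quotients of `p`. -/
theorem hasDerivAt_integral_rpow_grad (hU : IsOpen U) (hp : IsC21On U p) {σ : ℝ} (hσ : 0 ≤ σ)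
    {η : EuclideanSpace ℝ (Fin n) → ℝ} (hη : ContDiff ℝ 1 η) (hη0 : ∀ x, 0 ≤ η x)
    (hc : HasCompactSupport η) (hs : tsupport η ⊆ U) {t : ℝ} (ht : 0 < t) :
    HasDerivAt (fun t => ∫ x, ‖spaceGrad p x t‖ ^ (σ + 2) / (σ + 2) * η x)
      (-∫ x, deriv (p x) t * weightedDiv (fun r => r ^ σ) (fun x => spaceGrad p x t) η x) t := by
  have H := IsRadialProfile.rpow hσ
  set D : EuclideanSpace ℝ (Fin n) × ℝ → ℝ := fun z =>
    weightedDiv (fun r => r ^ σ) (fun x => spaceGrad p x z.2) η z.1 with hDdef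
  have hD : ContinuousOn D (univ ×ˢ Ioi 0) := H.continuousOn_weightedDiv hU hp hη hs
  have hD0 : ∀ x ∉ tsupport η, ∀ t, D (x, t) = 0 := fun x hx t =>
    image_eq_zero_of_notMem_tsupport
      (f := weightedDiv (fun r => r ^ σ) (fun x => spaceGrad p x t) η)
      fun h => hx (tsupport_weightedDiv_subset η h)
  set e : ℝ → ℝ := fun t => ∫ x, ‖spaceGrad p x t‖ ^ (σ + 2) / (σ + 2) * η x with hedef
  have hei : ∀ t > 0, Integrable fun x => ‖spaceGrad p x t‖ ^ (σ + 2) / (σ + 2) * η x := by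
    intro t ht
    have h1 : ContinuousOn (fun x => ‖spaceGrad p x t‖ ^ (σ + 2) / (σ + 2)) U :=
      ((hp.contDiffOn_grad hU ht).continuousOn.norm.rpow_const
        fun x _ => Or.inr (by linarith)).div_const _
    exact (h1.continuous_mul_of_tsupport_subset hU hη.continuous hs).integrable_of_hasCompactSupport
      (HasCompactSupport.mul_left hc)
  -- The convexity inequality at ∇p(·,t), integrated against η. Because ∇p(s)-∇p(t) is the gradient
  -- of p(s)-p(t), integration by parts leaves an increment of p and no derivative of ∇p in time.
  have hconv : ∀ s > 0, ∀ t > 0, -∫ x, (p x s - p x t) * D (x, t) ≤ e s - e t := by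
    intro s hs0 t ht
    have hq := hp.contDiffOn_grad hU ht
    have hw : ContDiffOn ℝ 1 (fun x => p x s - p x t) U :=
      (hp.contDiffOn_space hU hs0).sub (hp.contDiffOn_space hU ht)
    have h1 := H.integral_mul_weightedDiv hU hq hη hc hs hw
    have h2 : ∀ x, (∑ j, fderiv ℝ (fun x => p x s - p x t) x (EuclideanSpace.single j 1) *
        radialField (fun r => r ^ σ) (spaceGrad p x t) j) * η x
        = inner ℝ (radialField (fun r => r ^ σ) (spaceGrad p x t))
          (spaceGrad p x s - spaceGrad p x t) * η x := by
      intro x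
      by_cases hx : x ∈ tsupport η
      · rw [PiLp.inner_apply]
        congr 1
        refine Finset.sum_congr rfl fun j _ => ?_
        rw [fderiv_fun_sub (hp.differentiableAt_space x (hs hx) s hs0)
          (hp.differentiableAt_space x (hs hx) t ht), sub_apply,
          hp.fderiv_apply_single (hs hx) hs0, hp.fderiv_apply_single (hs hx) ht]
        simp
      · rw [image_eq_zero_of_notMem_tsupport hx, mul_zero, mul_zero]
    simp only [h2] at h1
    have h3 : Integrable fun x => inner ℝ (radialField (fun r => r ^ σ) (spaceGrad p x t))
          (spaceGrad p x s - spaceGrad p x t) * η x := by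
      have h4 : ContinuousOn (fun x => inner ℝ (radialField (fun r => r ^ σ) (spaceGrad p x t))
          (spaceGrad p x s - spaceGrad p x t)) U :=
        (H.continuous_radialField.comp_continuousOn hq.continuousOn).inner
          ((hp.contDiffOn_grad hU hs0).continuousOn.sub hq.continuousOn)
      exact (h4.continuous_mul_of_tsupport_subset hU hη.continuous
        hs).integrable_of_hasCompactSupport (HasCompactSupport.mul_left hc)
    have h5 : -∫ x, (p x s - p x t) * D (x, t)
        = ∫ x, inner ℝ (radialField (fun r => r ^ σ) (spaceGrad p x t))
          (spaceGrad p x s - spaceGrad p x t) * η x := by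
      rw [hDdef, h1, neg_neg]
    rw [h5, hedef, ← integral_sub (hei s hs0) (hei t ht)]
    refine integral_mono h3 ((hei s hs0).sub (hei t ht)) fun x => ?_
    rw [← sub_mul]
    exact mul_le_mul_of_nonneg_right (inner_radialField_sub_le hσ _ _) (hη0 x)
  -- Two difference quotients of p, one with the field frozen at t and one with the field at s. Both
  -- have the claimed derivative as limit.
  have hA := (tendsto_integral_slope_mul hU hp hc hs (f := fun z => D (z.1, t))
    (hD.comp (by fun_prop) fun z _ => ⟨mem_univ _, ht⟩) (fun x hx s => hD0 x hx t) ht).neg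
  have hB := (tendsto_integral_slope_mul hU hp hc hs hD hD0 ht).neg
  rw [hasDerivAt_iff_tendsto_slope]
  have hmin := hA.min hB
  have hmax := hA.max hB
  simp only [min_self, max_self] at hmin hmax
  have hev : ∀ᶠ s in 𝓝[≠] t, 0 < s ∧ s ≠ t := by
    filter_upwards [mem_nhdsWithin_of_mem_nhds (Ioi_mem_nhds ht), self_mem_nhdsWithin] with s h1 h2
    exact ⟨h1, h2⟩
  -- Convexity used with s and t in both roles. Dividing by s-t reverses the inequalities when s <
  -- t, hence the minimum and maximum.
  have hkey : ∀ s, 0 < s → s ≠ t →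
      min (-∫ x, (s - t)⁻¹ * (p x s - p x t) * D (x, t))
        (-∫ x, (s - t)⁻¹ * (p x s - p x t) * D (x, s)) ≤ slope e t s ∧
      slope e t s ≤ max (-∫ x, (s - t)⁻¹ * (p x s - p x t) * D (x, t))
        (-∫ x, (s - t)⁻¹ * (p x s - p x t) * D (x, s)) := by
    intro s hs0 hst
    have h1 := hconv s hs0 t ht
    have h2 := hconv t ht s hs0
    have h3 : ∫ x, (p x t - p x s) * D (x, s) = -∫ x, (p x s - p x t) * D (x, s) := by
      rw [← integral_neg]
      congr 1
      funext x
      ring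
    rw [h3] at h2
    simp only [mul_assoc, integral_const_mul]
    rw [slope_def_field, div_eq_inv_mul]
    rcases lt_or_gt_of_ne hst with hlt | hgt
    · have h4 : (s - t)⁻¹ < 0 := inv_lt_zero.2 (by linarith)
      exact ⟨(min_le_right _ _).trans (by nlinarith), (by nlinarith : _ ≤ _).trans (le_max_left _ _)⟩
    · have h4 : 0 < (s - t)⁻¹ := inv_pos.2 (by linarith)
      exact ⟨(min_le_left _ _).trans (by nlinarith), (by nlinarith : _ ≤ _).trans (le_max_right _ _)⟩
  exact tendsto_of_tendsto_of_tendsto_of_le_of_le' hmin hmax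
    (hev.mono fun s h => (hkey s h.1 h.2).1) (hev.mono fun s h => (hkey s h.1 h.2).2)

end TimeDerivative

/-! ### The local energy inequality -/

section EnergyInequality

open Filter Topology

variable {n : ℕ} {U : Set (EuclideanSpace ℝ (Fin n))} {p : EuclideanSpace ℝ (Fin n) → ℝ → ℝ}

/-- The weighted integral `∫ f(‖∇p(x,t)‖) ψ(x)^m dx`. -/
noncomputable def gradInt (f : ℝ → ℝ) (p : EuclideanSpace ℝ (Fin n) → ℝ → ℝ)
    (ψ : EuclideanSpace ℝ (Fin n) → ℝ) (m : ℕ) (t : ℝ) : ℝ :=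
  ∫ x, f ‖spaceGrad p x t‖ * ψ x ^ m

/-- The weighted integral of `K(‖∇p‖) ‖∇p‖^σ ‖∇²p‖²`. -/
noncomputable def hessInt (g : ForchheimerPoly) (σ : ℝ) (p : EuclideanSpace ℝ (Fin n) → ℝ → ℝ)
    (ψ : EuclideanSpace ℝ (Fin n) → ℝ) (m : ℕ) (t : ℝ) : ℝ :=
  ∫ x, g.K ‖spaceGrad p x t‖ * ‖spaceGrad p x t‖ ^ σ *
    frobSq (fderiv ℝ (fun x => spaceGrad p x t) x) * ψ x ^ m

theorem IsC21On.continuousOn_comp_norm_grad (hp : IsC21On U p) {f : ℝ → ℝ}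
    (hf : ContinuousOn f (Ici 0)) :
    ContinuousOn (fun z : EuclideanSpace ℝ (Fin n) × ℝ => f ‖spaceGrad p z.1 z.2‖)
      (U ×ˢ Ioi 0) :=
  hf.comp hp.continuousOn_grad.norm fun _ _ => norm_nonneg _

section

variable {B : ℝ} {ψ : EuclideanSpace ℝ (Fin n) → ℝ} {m : ℕ}

theorem integrable_gradInt (hU : IsOpen U) (hp : IsC21On U p) (hψ : IsCutoff U B ψ) {f : ℝ → ℝ}
    (hf : ContinuousOn f (Ici 0)) (hm : m ≠ 0) {t : ℝ} (ht : 0 < t) :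
    Integrable fun x => f ‖spaceGrad p x t‖ * ψ x ^ m :=
  hψ.integrable_mul_pow hU ((hp.continuousOn_comp_norm_grad hf).section_left (mem_Ioi.2 ht)) m hm

theorem continuousOn_gradInt (hU : IsOpen U) (hp : IsC21On U p) (hψ : IsCutoff U B ψ) {f : ℝ → ℝ}
    (hf : ContinuousOn f (Ici 0)) (hm : m ≠ 0) : ContinuousOn (gradInt f p ψ m) (Ioi 0) :=
  hψ.continuousOn_integral_mul_pow hU (f := fun x t => f ‖spaceGrad p x t‖)
    (hp.continuousOn_comp_norm_grad hf) hm

theorem continuousOn_hessInt (g : ForchheimerPoly) {σ : ℝ} (hσ : 0 ≤ σ) (hU : IsOpen U)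
    (hp : IsC21On U p) (hψ : IsCutoff U B ψ) (hm : m ≠ 0) :
    ContinuousOn (hessInt g σ p ψ m) (Ioi 0) := by
  refine hψ.continuousOn_integral_mul_pow hU (f := fun x t =>
    g.K ‖spaceGrad p x t‖ * ‖spaceGrad p x t‖ ^ σ *
    frobSq (fderiv ℝ (fun x => spaceGrad p x t) x)) ?_ hm
  exact (hp.continuousOn_comp_norm_grad
    ((IsRadialProfile.conductivity g).mul (.rpow hσ)).continuousOn).mul
    (continuous_frobSq.comp_continuousOn hp.continuousOn_hessian)

theorem gradInt_nonneg (hψ : IsCutoff U B ψ) {f : ℝ → ℝ} (hf : ∀ r, 0 ≤ r → 0 ≤ f r) (t : ℝ) :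
    0 ≤ gradInt f p ψ m t :=
  integral_nonneg fun x => mul_nonneg (hf _ (norm_nonneg _)) (hψ.pow_nonneg m x)

theorem gradInt_le_mul (hU : IsOpen U) (hp : IsC21On U p) (hψ : IsCutoff U B ψ) {f f' : ℝ → ℝ}
    (hf : ContinuousOn f (Ici 0)) (hf' : ContinuousOn f' (Ici 0)) {m' : ℕ} (hm' : m' ≠ 0)
    (hmm : m' ≤ m) {c : ℝ} (h0 : ∀ r, 0 ≤ r → 0 ≤ f r) (h : ∀ r, 0 ≤ r → f r ≤ c * f' r) {t : ℝ}
    (ht : 0 < t) : gradInt f p ψ m t ≤ c * gradInt f' p ψ m' t := by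
  rw [gradInt, gradInt, ← integral_const_mul]
  refine integral_mono (integrable_gradInt hU hp hψ hf (by omega) ht)
    ((integrable_gradInt hU hp hψ hf' hm' ht).const_mul c) fun x => ?_
  have h1 := h0 _ (norm_nonneg (spaceGrad p x t))
  have h2 := h _ (norm_nonneg (spaceGrad p x t))
  change f _ * ψ x ^ m ≤ c * (f' _ * ψ x ^ m')
  rw [← mul_assoc]
  exact mul_le_mul h2 (pow_le_pow_of_le_one (hψ.nonneg x) (hψ.le_one x) hmm) (hψ.pow_nonneg m x)
    (h1.trans h2)

theorem continuousOn_rpow_mul_pow {σ : ℝ} (hσ : 0 ≤ σ) (l : ℕ) :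
    ContinuousOn (fun r : ℝ => r ^ σ * r ^ l) (Ici 0) :=
  ((Real.continuous_rpow_const hσ).mul (continuous_pow l)).continuousOn

theorem continuousOn_K_mul_rpow_mul_pow (g : ForchheimerPoly) {σ : ℝ} (hσ : 0 ≤ σ) (l : ℕ) :
    ContinuousOn (fun r : ℝ => g.K r * (r ^ σ * r ^ l)) (Ici 0) :=
  g.continuousOn_K.mul (continuousOn_rpow_mul_pow hσ l)

end

/-- The smooth time weight `(t - t₀) / (t - t₀ + δ)`, which vanishes at `t₀`. -/
noncomputable def timeWeight (t₀ δ t : ℝ) : ℝ := (t - t₀) / (t - t₀ + δ)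

section TimeWeight

variable {t₀ δ t : ℝ}

theorem timeWeight_nonneg (hδ : 0 < δ) (ht : t₀ ≤ t) : 0 ≤ timeWeight t₀ δ t :=
  div_nonneg (by linarith) (by linarith)

theorem timeWeight_le_one (hδ : 0 < δ) (ht : t₀ ≤ t) : timeWeight t₀ δ t ≤ 1 :=
  (div_le_one (by linarith)).2 (by linarith)

theorem timeWeight_self (t₀ δ : ℝ) : timeWeight t₀ δ t₀ = 0 := by simp [timeWeight]

theorem half_le_timeWeight (hδ : 0 < δ) (ht : t₀ + δ ≤ t) : 1 / 2 ≤ timeWeight t₀ δ t := by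
  rw [timeWeight, div_le_div_iff₀ two_pos (by linarith)]
  linarith

theorem hasDerivAt_timeWeight (hδ : 0 < δ) (ht : t₀ ≤ t) :
    HasDerivAt (timeWeight t₀ δ) (δ / (t - t₀ + δ) ^ 2) t := by
  have h1 : t - t₀ + δ ≠ 0 := by linarith
  have h2 : HasDerivAt (fun t => t - t₀) 1 t := (hasDerivAt_id t).sub_const t₀
  refine (h2.div (h2.add_const δ) h1).congr_deriv ?_
  congr 1
  ring

theorem deriv_timeWeight_le (hδ : 0 < δ) (ht : t₀ ≤ t) : δ / (t - t₀ + δ) ^ 2 ≤ δ⁻¹ := by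
  have h1 : 0 < t - t₀ + δ := by linarith
  rw [div_le_iff₀ (by positivity), inv_mul_eq_div, le_div_iff₀ hδ]
  nlinarith

theorem continuousOn_timeWeight (hδ : 0 < δ) : ContinuousOn (timeWeight t₀ δ) (Ici t₀) :=
  fun _ ht => (hasDerivAt_timeWeight hδ ht).continuousAt.continuousWithinAt

end TimeWeight

variable {B : ℝ} {ψ : EuclideanSpace ℝ (Fin n) → ℝ} {m : ℕ}

/-- The only place where the differential equation is used: it replaces ∂ₜp by the divergence of the
flux, to which the spatial energy estimate applies. -/
theorem IsForchheimerSolution.le_integral_deriv_mul_weightedDiv {g : ForchheimerPoly}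
    (hU : IsOpen U) (hp : IsForchheimerSolution g U p) {σ : ℝ} (hσ : 0 ≤ σ) (hψ : IsCutoff U B ψ)
    (hm : m ≠ 0) {t : ℝ} (ht : 0 < t) :
    (1 - g.a) / 2 * hessInt g σ p ψ (2 * m + 2) t
      - energyConst n g B m * gradInt (fun r => g.K r * (r ^ σ * r ^ 2)) p ψ (2 * m) t ≤
    ∫ x, deriv (p x) t * weightedDiv (fun r => r ^ σ) (fun x => spaceGrad p x t)
      (fun x => ψ x ^ (2 * m + 2)) x := by
  have hr := hp.regular
  refine (le_integral_div_mul_weightedDiv g hσ hU (hr.contDiffOn_grad hU ht)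
    (fun x hx i j => hr.fderiv_grad_symm hU hx ht i j) hψ hm).trans (le_of_eq ?_)
  refine integral_congr_ae (Eventually.of_forall fun x => ?_)
  by_cases hx : x ∈ tsupport ψ
  · have hxU := hψ.tsupport_subset hx
    simp only
    rw [hp.equation x hxU t ht, divergence]
    congr 1
    refine Finset.sum_congr rfl fun i _ => ?_
    have hq : HasFDerivAt (fun x => spaceGrad p x t) _ x :=
      (hr.differentiableAt_grad x hxU t ht).hasFDerivAt
    have h1 := ((IsRadialProfile.conductivity g).hasFDerivAt (spaceGrad p x t)).comp x hq
    have h2 := ((EuclideanSpace.proj (𝕜 := ℝ) i).hasFDerivAt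
      (x := radialField g.K (spaceGrad p x t))).comp x h1
    have h3 : HasFDerivAt (fun x => radialField g.K (spaceGrad p x t) i) _ x := h2
    have h4 : HasFDerivAt (fun y => g.K ‖spaceGrad p y t‖ • spaceGrad p y t) _ x := h1
    rw [h3.fderiv, h4.fderiv]
    rfl
  · have h0 : weightedDiv (fun r => r ^ σ) (fun x => spaceGrad p x t)
      (fun x => ψ x ^ (2 * m + 2)) x = 0 :=
      image_eq_zero_of_notMem_tsupport fun h =>
        hx (IsCutoff.tsupport_pow_subset _ (by omega) (tsupport_weightedDiv_subset _ h))
    simp [h0]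

/-- The constant of the energy inequality. -/
noncomputable def energyConst' (n : ℕ) (g : ForchheimerPoly) (B : ℝ) (m : ℕ) : ℝ :=
  energyConst n g B m / g.coeff 0 + (2 * m + 2)

theorem energyConst'_pos (g : ForchheimerPoly) (B : ℝ) (m : ℕ) : 0 < energyConst' n g B m := by
  have := div_nonneg (energyConst_nonneg (n := n) g B m) g.coeff_zero_pos.le
  rw [energyConst']
  positivity

/-- The energy inequality, localized in space and time. -/
theorem IsForchheimerSolution.energy_le {g : ForchheimerPoly} (hU : IsOpen U)
    (hp : IsForchheimerSolution g U p) {σ : ℝ} (hσ : 0 ≤ σ) (hψ : IsCutoff U B ψ) (hm : m ≠ 0)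
    {t₀ δ t : ℝ} (ht₀ : 0 < t₀) (hδ : 0 < δ) (ht : t₀ ≤ t) :
    timeWeight t₀ δ t ^ (2 * m + 2) *
        gradInt (fun r => r ^ (σ + 2) / (σ + 2)) p ψ (2 * m + 2) t
      + (1 - g.a) / 2 * (∫ s in t₀..t, timeWeight t₀ δ s ^ (2 * m + 2) *
        hessInt g σ p ψ (2 * m + 2) s) ≤
    energyConst' n g B m * (1 + δ⁻¹) * ∫ s in t₀..t, timeWeight t₀ δ s ^ (2 * m) *
      gradInt (fun r => r ^ σ * r ^ 2) p ψ (2 * m) s := by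
  have hr := hp.regular
  set τ := timeWeight t₀ δ with hτ
  set τ' : ℝ → ℝ := fun s => δ / (s - t₀ + δ) ^ 2 with hτ'
  set e := gradInt (fun r => r ^ (σ + 2) / (σ + 2)) p ψ (2 * m + 2) with he
  set X := hessInt g σ p ψ (2 * m + 2) with hX
  set W := gradInt (fun r => r ^ σ * r ^ 2) p ψ (2 * m) with hW
  set Y := gradInt (fun r => g.K r * (r ^ σ * r ^ 2)) p ψ (2 * m) with hY
  set η : EuclideanSpace ℝ (Fin n) → ℝ := fun x => ψ x ^ (2 * m + 2) with hη
  set J : ℝ → ℝ := fun s => ∫ x, deriv (p x) s *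
    weightedDiv (fun r => r ^ σ) (fun x => spaceGrad p x s) η x with hJ
  have hηd : ContDiff ℝ 1 η := hψ.contDiff_pow _
  have hsψ : tsupport η ⊆ tsupport ψ := IsCutoff.tsupport_pow_subset _ (by omega)
  have hs : tsupport η ⊆ U := hsψ.trans hψ.tsupport_subset
  have hc : HasCompactSupport η := hψ.hasCompactSupport_pow _ (by omega)
  have hpos : ∀ s ∈ Icc t₀ t, 0 < s := fun s hs => ht₀.trans_le hs.1
  have hfe : ContinuousOn (fun r : ℝ => r ^ (σ + 2) / (σ + 2)) (Ici 0) :=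
    ((Real.continuous_rpow_const (by linarith)).div_const _).continuousOn
  have hec : ContinuousOn e (Icc t₀ t) :=
    (continuousOn_gradInt hU hr hψ hfe (by omega)).mono hpos
  have hXc : ContinuousOn X (Icc t₀ t) :=
    (continuousOn_hessInt g hσ hU hr hψ (by omega)).mono hpos
  have hWc : ContinuousOn W (Icc t₀ t) :=
    (continuousOn_gradInt hU hr hψ (continuousOn_rpow_mul_pow hσ 2) (by omega)).mono hpos
  have hJc : ContinuousOn J (Icc t₀ t) := by
    have hD0 : ∀ x ∉ tsupport η, ∀ t,
        weightedDiv (fun r => r ^ σ) (fun x => spaceGrad p x t) η x = 0 := fun x hx t =>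
      image_eq_zero_of_notMem_tsupport fun h => hx (tsupport_weightedDiv_subset η h)
    refine (continuousOn_integral_space (f := fun z => deriv (p z.1) z.2 *
      weightedDiv (fun r => r ^ σ) (fun x => spaceGrad p x z.2) η z.1) ?_ hc
      fun x hx t => by simp [hD0 x hx t]).mono hpos
    exact hr.continuousOn_time.mul_of_eq_zero_prod hU
      ((IsRadialProfile.rpow hσ).continuousOn_weightedDiv hU hr hηd hs) (isClosed_tsupport η) hs hD0
  have hτc : ContinuousOn τ (Icc t₀ t) := (continuousOn_timeWeight hδ).mono Icc_subset_Ici_self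
  have hτ'c : ContinuousOn τ' (Icc t₀ t) := by
    refine continuousOn_const.div (by fun_prop) fun s hs => ?_
    have : 0 < s - t₀ + δ := by linarith [hs.1]
    positivity
  have hderiv : ∀ s ∈ uIcc t₀ t, HasDerivAt (fun s => τ s ^ (2 * m + 2) * e s)
      ((2 * m + 2) * τ s ^ (2 * m + 1) * τ' s * e s + τ s ^ (2 * m + 2) * -J s) s := by
    intro s hs'
    rw [uIcc_of_le ht] at hs'
    have h1 := (hasDerivAt_timeWeight hδ hs'.1).pow (2 * m + 2)
    have h2 := hasDerivAt_integral_rpow_grad hU hr hσ hηd (hψ.pow_nonneg _) hc hs (hpos s hs')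
    refine (h1.mul h2).congr_deriv ?_
    simp only [Pi.pow_apply]
    push_cast
    rfl
  have hE'c : ContinuousOn (fun s => (2 * m + 2) * τ s ^ (2 * m + 1) * τ' s * e s
      + τ s ^ (2 * m + 2) * -J s) (Icc t₀ t) := by fun_prop
  have hftc := intervalIntegral.integral_eq_sub_of_hasDerivAt hderiv
    (hE'c.intervalIntegrable_of_Icc ht)
  -- The weight vanishes at t₀, so the initial energy drops out.
  have hτ0 : τ t₀ = 0 := timeWeight_self t₀ δ
  rw [hτ0, zero_pow (by omega), zero_mul, sub_zero] at hftc
  have i1 : IntervalIntegrable (fun s => τ s ^ (2 * m + 2) * X s) volume t₀ t :=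
    ContinuousOn.intervalIntegrable_of_Icc ht (by fun_prop)
  have i2 : IntervalIntegrable (fun s => τ s ^ (2 * m) * W s) volume t₀ t :=
    ContinuousOn.intervalIntegrable_of_Icc ht (by fun_prop)
  rw [← hftc, ← intervalIntegral.integral_const_mul, ← intervalIntegral.integral_const_mul,
    ← intervalIntegral.integral_add (hE'c.intervalIntegrable_of_Icc ht) (i1.const_mul _)]
  refine intervalIntegral.integral_mono_on ht ((hE'c.intervalIntegrable_of_Icc ht).add
    (i1.const_mul _)) (i2.const_mul _) fun s hs' => ?_
  have hs0 := hpos s hs'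
  have e1 := hp.le_integral_deriv_mul_weightedDiv hU hσ hψ hm hs0
  rw [← hX, ← hY] at e1
  have e2 : Y s ≤ 1 / g.coeff 0 * W s := by
    refine gradInt_le_mul hU hr hψ (continuousOn_K_mul_rpow_mul_pow g hσ 2)
      (continuousOn_rpow_mul_pow hσ 2) (by omega) le_rfl (fun r hr => ?_) (fun r hr => ?_) hs0
    · have := g.K_pos hr
      positivity
    · exact mul_le_mul_of_nonneg_right (g.K_le hr) (by positivity)
  have e3 : e s ≤ 1 * W s := by
    refine gradInt_le_mul hU hr hψ hfe
      (continuousOn_rpow_mul_pow hσ 2) (by omega) (by omega) (fun r hr => by positivity)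
      (fun r hr => ?_) hs0
    rw [Real.rpow_add_of_nonneg hr hσ two_pos.le, Real.rpow_two, one_mul]
    exact div_le_self (by positivity) (by linarith)
  have e0 : 0 ≤ e s := gradInt_nonneg hψ (fun r hr => by positivity) s
  have eW : 0 ≤ W s := gradInt_nonneg hψ (fun r hr => by positivity) s
  have t0 : 0 ≤ τ s := timeWeight_nonneg hδ hs'.1
  have t1 : τ s ≤ 1 := timeWeight_le_one hδ hs'.1
  have t2 : τ' s ≤ δ⁻¹ := deriv_timeWeight_le hδ hs'.1
  have t3 : 0 ≤ τ' s := div_nonneg hδ.le (sq_nonneg _)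
  have t4 : τ s ^ (2 * m + 1) ≤ τ s ^ (2 * m) := pow_le_pow_of_le_one t0 t1 (by omega)
  have t5 : τ s ^ (2 * m + 2) ≤ τ s ^ (2 * m) := pow_le_pow_of_le_one t0 t1 (by omega)
  have hCe := energyConst_nonneg (n := n) g B m
  have ha0 := g.coeff_zero_pos
  have hδi : 0 ≤ δ⁻¹ := inv_nonneg.2 hδ.le
  -- Differentiating τ^(2m+2) costs one power of τ and a factor at most 1/δ; τ^(2m) still matches
  -- ψ^(2m).
  have k1 : (2 * m + 2) * τ s ^ (2 * m + 1) * τ' s * e s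
      ≤ (2 * m + 2) * τ s ^ (2 * m) * δ⁻¹ * W s := by
    rw [one_mul] at e3
    gcongr
  have k2 : τ s ^ (2 * m + 2) * -J s ≤ energyConst n g B m / g.coeff 0 * (τ s ^ (2 * m) * W s)
      - (1 - g.a) / 2 * (τ s ^ (2 * m + 2) * X s) := by
    have h1 : -J s ≤ energyConst n g B m / g.coeff 0 * W s - (1 - g.a) / 2 * X s := by
      have h2 := mul_le_mul_of_nonneg_left e2 hCe
      have h3 : energyConst n g B m * (1 / g.coeff 0 * W s)
          = energyConst n g B m / g.coeff 0 * W s := by ring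
      linarith [e1]
    have h4 := mul_le_mul_of_nonneg_left h1 (pow_nonneg t0 (2 * m + 2))
    have h5 := mul_le_mul_of_nonneg_left t5
      (mul_nonneg (div_nonneg hCe ha0.le) eW)
    nlinarith
  have k3 : 0 ≤ τ s ^ (2 * m) * W s := by positivity
  have k4 : 0 ≤ energyConst n g B m / g.coeff 0 := by positivity
  have k5 : 0 ≤ energyConst n g B m / g.coeff 0 * δ⁻¹ * (τ s ^ (2 * m) * W s) := by positivity
  have k6 : 0 ≤ (2 * (m : ℝ) + 2) * (τ s ^ (2 * m) * W s) := by positivity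
  rw [energyConst']
  nlinarith

/-- The energy inequality combined with the embedding estimate. -/
theorem IsForchheimerSolution.integral_flux_le {g : ForchheimerPoly} (hU : IsOpen U)
    (hp : IsForchheimerSolution g U p) {σ : ℝ} (hσ : 0 ≤ σ) (hψ : IsCutoff U B ψ) (hm : m ≠ 0)
    {t₀ δ t : ℝ} (ht₀ : 0 < t₀) (hδ : 0 < δ) (ht : t₀ ≤ t) {M : ℝ} (hM0 : 0 ≤ M)
    (hM : ∀ x ∈ tsupport ψ, ∀ s ∈ Icc t₀ t, |p x s| ≤ M) :
    ∫ s in t₀..t, timeWeight t₀ δ s ^ (2 * m + 2) *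
        gradInt (fun r => g.K r * (r ^ σ * r ^ 4)) p ψ (2 * m + 2) s ≤
    2 * ((n * (σ + 4)) ^ 2 * (2 / (1 - g.a)) * energyConst' n g B m
        + (n * ((2 * m + 2) * B)) ^ 2 / g.coeff 0) * (M ^ 2 * (1 + δ⁻¹)) *
      ∫ s in t₀..t, timeWeight t₀ δ s ^ (2 * m) *
        gradInt (fun r => r ^ σ * r ^ 2) p ψ (2 * m) s := by
  have hr := hp.regular
  have key := hp.energy_le hU hσ hψ hm ht₀ hδ ht
  set τ := timeWeight t₀ δ with hτ
  set X := hessInt g σ p ψ (2 * m + 2) with hX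
  set W := gradInt (fun r => r ^ σ * r ^ 2) p ψ (2 * m) with hW
  set Y := gradInt (fun r => g.K r * (r ^ σ * r ^ 2)) p ψ (2 * m) with hY
  set Z := gradInt (fun r => g.K r * (r ^ σ * r ^ 4)) p ψ (2 * m + 2) with hZ
  have hpos : ∀ s ∈ Icc t₀ t, 0 < s := fun s hs => ht₀.trans_le hs.1
  have hXc : ContinuousOn X (Icc t₀ t) :=
    (continuousOn_hessInt g hσ hU hr hψ (by omega)).mono hpos
  have hWc : ContinuousOn W (Icc t₀ t) :=
    (continuousOn_gradInt hU hr hψ (continuousOn_rpow_mul_pow hσ 2) (by omega)).mono hpos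
  have hZc : ContinuousOn Z (Icc t₀ t) :=
    (continuousOn_gradInt hU hr hψ (continuousOn_K_mul_rpow_mul_pow g hσ 4) (by omega)).mono hpos
  have hτc : ContinuousOn τ (Icc t₀ t) := (continuousOn_timeWeight hδ).mono Icc_subset_Ici_self
  have i1 : IntervalIntegrable (fun s => τ s ^ (2 * m + 2) * X s) volume t₀ t :=
    ContinuousOn.intervalIntegrable_of_Icc ht (by fun_prop)
  have i2 : IntervalIntegrable (fun s => τ s ^ (2 * m) * W s) volume t₀ t :=
    ContinuousOn.intervalIntegrable_of_Icc ht (by fun_prop)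
  have i3 : IntervalIntegrable (fun s => τ s ^ (2 * m + 2) * Z s) volume t₀ t :=
    ContinuousOn.intervalIntegrable_of_Icc ht (by fun_prop)
  set α : ℝ := (n * (σ + 4)) ^ 2 with hα
  set β : ℝ := (n * ((2 * m + 2) * B)) ^ 2 with hβ
  have hα0 : 0 ≤ α := sq_nonneg _
  have hβ0 : 0 ≤ β := sq_nonneg _
  have ha0 := g.coeff_zero_pos
  have ha1 : 0 < 1 - g.a := by linarith [g.a_lt_one]
  have hδi : 0 ≤ δ⁻¹ := inv_nonneg.2 hδ.le
  have h1 : ∫ s in t₀..t, τ s ^ (2 * m + 2) * Z s ≤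
      2 * M ^ 2 * α * (∫ s in t₀..t, τ s ^ (2 * m + 2) * X s)
        + 2 * M ^ 2 * β / g.coeff 0 * ∫ s in t₀..t, τ s ^ (2 * m) * W s := by
    rw [← intervalIntegral.integral_const_mul, ← intervalIntegral.integral_const_mul,
      ← intervalIntegral.integral_add (i1.const_mul _) (i2.const_mul _)]
    refine intervalIntegral.integral_mono_on ht i3 ((i1.const_mul _).add (i2.const_mul _))
      fun s hs' => ?_
    have hs0 := hpos s hs'
    have e1 : Z s ≤ 2 * M ^ 2 * (α * X s) + 2 * M ^ 2 * (β * Y s) :=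
      integral_flux_le_of_abs_le g hσ hU (hr.contDiffOn_grad hU hs0) (hr.contDiffOn_space hU hs0)
        (fun x hx j => hr.fderiv_apply_single hx hs0 j) hψ hm (fun x hx => hM x hx s hs') hM0
    have e2 : Y s ≤ 1 / g.coeff 0 * W s := by
      refine gradInt_le_mul hU hr hψ (continuousOn_K_mul_rpow_mul_pow g hσ 2)
        (continuousOn_rpow_mul_pow hσ 2) (by omega) le_rfl (fun r hr => ?_) (fun r hr => ?_) hs0
      · have := g.K_pos hr
        positivity
      · exact mul_le_mul_of_nonneg_right (g.K_le hr) (by positivity)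
    have eW : 0 ≤ W s := gradInt_nonneg hψ (fun r hr => by positivity) s
    have t0 : 0 ≤ τ s := timeWeight_nonneg hδ hs'.1
    have t1 : τ s ≤ 1 := timeWeight_le_one hδ hs'.1
    have t5 : τ s ^ (2 * m + 2) ≤ τ s ^ (2 * m) := pow_le_pow_of_le_one t0 t1 (by omega)
    calc τ s ^ (2 * m + 2) * Z s
        ≤ τ s ^ (2 * m + 2) * (2 * M ^ 2 * (α * X s) + 2 * M ^ 2 * (β * (1 / g.coeff 0 * W s))) := by
          refine mul_le_mul_of_nonneg_left (e1.trans ?_) (by positivity)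
          gcongr
      _ = 2 * M ^ 2 * α * (τ s ^ (2 * m + 2) * X s)
          + 2 * M ^ 2 * β / g.coeff 0 * (τ s ^ (2 * m + 2) * W s) := by ring
      _ ≤ _ := by gcongr
  have hE0 : 0 ≤ τ t ^ (2 * m + 2) *
      gradInt (fun r => r ^ (σ + 2) / (σ + 2)) p ψ (2 * m + 2) t :=
    mul_nonneg (pow_nonneg (timeWeight_nonneg hδ ht) _)
      (gradInt_nonneg hψ (fun r hr => by positivity) t)
  set IX := ∫ s in t₀..t, τ s ^ (2 * m + 2) * X s with hIX
  set IW := ∫ s in t₀..t, τ s ^ (2 * m) * W s with hIW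
  have hIW0 : 0 ≤ IW := intervalIntegral.integral_nonneg ht fun s hs' =>
    mul_nonneg (pow_nonneg (timeWeight_nonneg hδ hs'.1) _)
      (gradInt_nonneg hψ (fun r hr => by positivity) s)
  -- The energy at the final time is nonnegative and is dropped.
  have h2 : IX ≤ 2 / (1 - g.a) * (energyConst' n g B m * (1 + δ⁻¹) * IW) := by
    rw [div_mul_eq_mul_div, le_div_iff₀ ha1]
    linarith
  have h3 : 2 * M ^ 2 * β / g.coeff 0 * IW ≤ 2 * M ^ 2 * β / g.coeff 0 * (1 + δ⁻¹) * IW := by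
    have : 0 ≤ 2 * M ^ 2 * β / g.coeff 0 * IW * δ⁻¹ := by positivity
    linarith
  refine h1.trans ?_
  have h4 := mul_le_mul_of_nonneg_left h2 (by positivity : 0 ≤ 2 * M ^ 2 * α)
  refine (add_le_add h4 h3).trans (le_of_eq ?_)
  ring

end EnergyInequality

/-! ### Pointwise interpolation inequalities -/

section Absorption

/-- Interpolation of `r ^ (s-2)` between `r ^ s` and `r ^ 2`, with weights. -/
theorem ForchheimerPoly.rpow_sub_two_mul_pow_le (g : ForchheimerPoly) {s A r y : ℝ} {l : ℕ}
    (hs : 4 ≤ s) (hl : s - 3 ≤ l) (hA : 0 ≤ A) (hr : 0 ≤ r) (hy0 : 0 ≤ y) (hy1 : y ≤ 1) :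
    A * (r ^ (s - 2) * y ^ (l + 1)) ≤ 1 / 2 * (g.K r * r ^ s * y ^ (l + 2))
      + (A + 1 / 2 * (2 * A / g.root 1) ^ (s - 2)) * ((1 + g.K r * r ^ (2 : ℝ)) * y) := by
  have hK := g.K_pos hr
  have hc := g.root_pos one_pos
  set Q := 2 * A / g.root 1 with hQ
  have hQ0 : 0 ≤ Q := by positivity
  have hQs : 0 ≤ Q ^ (s - 2) := Real.rpow_nonneg hQ0 _
  have hrs : 0 ≤ r ^ s := Real.rpow_nonneg hr _
  have hr2 : 0 ≤ r ^ (2 : ℝ) := Real.rpow_nonneg hr _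
  have hp1 : 0 ≤ 1 / 2 * (g.K r * r ^ s * y ^ (l + 2)) := by positivity
  have hp2 : 0 ≤ A * (g.K r * r ^ (2 : ℝ) * y) := by positivity
  have hp3 : 0 ≤ 1 / 2 * Q ^ (s - 2) * y := by positivity
  have hp4 : 0 ≤ 1 / 2 * Q ^ (s - 2) * (g.K r * r ^ (2 : ℝ) * y) := by positivity
  rcases le_or_gt r 1 with h1 | h1
  · have h2 : r ^ (s - 2) ≤ 1 := Real.rpow_le_one hr h1 (by linarith)
    have h3 : y ^ (l + 1) ≤ y := by
      simpa using pow_le_pow_of_le_one hy0 hy1 (by omega : 1 ≤ l + 1)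
    have h4 : r ^ (s - 2) * y ^ (l + 1) ≤ 1 * y := mul_le_mul h2 h3 (by positivity) zero_le_one
    have h5 := mul_le_mul_of_nonneg_left h4 hA
    nlinarith
  · have hr0 : 0 < r := by linarith
    -- The bound rK(r) ≥ `g.root 1` trades one power of r for the factor K. The choice of Q puts 1/2
    -- in front, ready for absorption.
    have h2 : A * r ^ (s - 2) ≤ 1 / 2 * Q * (g.K r * r ^ (s - 1)) := by
      have h3 := g.root_one_le_mul_K h1.le
      have h4 : r ^ (s - 1) = r * r ^ (s - 2) := by
        rw [show s - 1 = 1 + (s - 2) by ring, Real.rpow_add hr0, Real.rpow_one]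
      rw [h4, hQ]
      have h5 : 1 / 2 * (2 * A / g.root 1) * (g.K r * (r * r ^ (s - 2)))
          = A * r ^ (s - 2) * ((r * g.K r) / g.root 1) := by field_simp
      rw [h5]
      exact le_mul_of_one_le_right (by positivity) ((one_le_div hc).2 h3)
    have h6 : Q * r ^ (s - 1) * y ^ (l + 1) ≤ r ^ s * y ^ (l + 2)
        + Q ^ (s - 2) * (r ^ (2 : ℝ) * y) := by
      -- If Q ≤ ry, the factor Q is exchanged for ry and the top term dominates. Otherwise
      -- (ry)^(s-3) ≤ Q^(s-3) leaves only r²; the assumption l ≥ s-3 ensures enough powers of y.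
      rcases le_or_gt Q (r * y) with h7 | h7
      · have h8 : r ^ s = r * r ^ (s - 1) := by
          rw [show s = 1 + (s - 1) by ring, Real.rpow_add hr0, Real.rpow_one]
          ring_nf
        have h9 : 0 ≤ r ^ (s - 1) * y ^ (l + 1) := by positivity
        have h10 := mul_le_mul_of_nonneg_right h7 h9
        have h11 : 0 ≤ Q ^ (s - 2) * (r ^ (2 : ℝ) * y) := by positivity
        have h12 : r * y * (r ^ (s - 1) * y ^ (l + 1)) = r ^ s * y ^ (l + 2) := by
          rw [h8]
          ring
        linarith
      · have hy : y ^ l ≤ y ^ (s - 3) := by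
          rcases hy0.eq_or_lt with h0 | h0
          · rw [← h0]
            rcases Nat.eq_zero_or_pos l with hl0 | hl0
            · rw [hl0, Nat.cast_zero] at hl
              linarith
            · rw [zero_pow hl0.ne', Real.zero_rpow (by linarith)]
          · rw [← Real.rpow_natCast]
            exact Real.rpow_le_rpow_of_exponent_ge h0 hy1 hl
        have h8 : (r * y) ^ (s - 3) ≤ Q ^ (s - 3) :=
          Real.rpow_le_rpow (by positivity) h7.le (by linarith)
        rw [Real.mul_rpow hr hy0] at h8
        have hQpos : 0 < Q := (mul_nonneg hr hy0).trans_lt h7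
        have h9 : r ^ (s - 1) = r ^ (2 : ℝ) * r ^ (s - 3) := by
          rw [← Real.rpow_add hr0]
          congr 1
          ring
        have h10 : Q ^ (s - 2) = Q * Q ^ (s - 3) := by
          rw [show s - 2 = 1 + (s - 3) by ring, Real.rpow_add hQpos, Real.rpow_one]
        have h11 : r ^ (s - 3) * y ^ l ≤ Q ^ (s - 3) :=
          (mul_le_mul_of_nonneg_left hy (Real.rpow_nonneg hr _)).trans h8
        calc Q * r ^ (s - 1) * y ^ (l + 1)
            = Q * (r ^ (2 : ℝ) * y) * (r ^ (s - 3) * y ^ l) := by rw [h9]; ring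
          _ ≤ Q * (r ^ (2 : ℝ) * y) * Q ^ (s - 3) :=
              mul_le_mul_of_nonneg_left h11 (by positivity)
          _ = Q ^ (s - 2) * (r ^ (2 : ℝ) * y) := by rw [h10]; ring
          _ ≤ _ := le_add_of_nonneg_left (by positivity)
    have h13 := mul_le_mul_of_nonneg_right h2 (pow_nonneg hy0 (l + 1))
    have h14 := mul_le_mul_of_nonneg_left h6 (by positivity : 0 ≤ 1 / 2 * g.K r)
    have h15 : 0 ≤ A * y := by positivity
    linarith

/-- Interpolation of `r ^ s`, `2 ≤ s ≤ 4`, between `r ^ 2` and `r ^ 4`. -/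
theorem rpow_le_add_rpow {s Λ r : ℝ} (hs : 2 ≤ s) (hs4 : s ≤ 4) (hΛ : 1 ≤ Λ) (hr : 0 ≤ r) :
    r ^ s ≤ Λ ^ (s - 2) * r ^ (2 : ℝ) + Λ ^ (s - 4) * r ^ (4 : ℝ) := by
  have hΛ0 : 0 < Λ := by linarith
  have p1 := Real.rpow_nonneg hΛ0.le (s - 2)
  have p2 := Real.rpow_nonneg hΛ0.le (s - 4)
  have p3 := Real.rpow_nonneg hr 2
  have p4 := Real.rpow_nonneg hr 4
  -- Split at r = Λ: below it r^(s-2) ≤ Λ^(s-2), above it r^(s-4) ≤ Λ^(s-4), as s-4 ≤ 0.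
  rcases le_or_gt r Λ with h | h
  · rcases hr.eq_or_lt with h0 | h0
    · rw [← h0, Real.zero_rpow (by linarith)]
      exact add_nonneg (mul_nonneg p1 (Real.rpow_nonneg le_rfl _))
        (mul_nonneg p2 (Real.rpow_nonneg le_rfl _))
    · have h1 : r ^ s = r ^ (s - 2) * r ^ (2 : ℝ) := by
        rw [← Real.rpow_add h0]
        congr 1
        ring
      rw [h1]
      have h2 := mul_le_mul_of_nonneg_right (Real.rpow_le_rpow hr h (by linarith : 0 ≤ s - 2)) p3
      nlinarith [mul_nonneg p2 p4]
  · have hr0 : 0 < r := hΛ0.trans h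
    have h1 : r ^ s = r ^ (s - 4) * r ^ (4 : ℝ) := by
      rw [← Real.rpow_add hr0]
      congr 1
      ring
    rw [h1]
    have h2 := mul_le_mul_of_nonneg_right
      (Real.rpow_le_rpow_of_nonpos hΛ0 h.le (by linarith : s - 4 ≤ 0)) p4
    nlinarith [mul_nonneg p1 p3]

end Absorption

/-! ### Interior estimates in space and time -/

section InteriorEstimates

open Filter Topology

variable {n : ℕ}

/-- The density `1 + K(r) r ^ 2` of the right-hand side. -/
noncomputable def baseDensity (g : ForchheimerPoly) (r : ℝ) : ℝ := 1 + g.K r * r ^ (2 : ℝ)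

theorem continuousOn_baseDensity (g : ForchheimerPoly) : ContinuousOn (baseDensity g) (Ici 0) :=
  continuousOn_const.add (g.continuousOn_K.mul
    (Real.continuous_rpow_const two_pos.le).continuousOn)

theorem baseDensity_nonneg (g : ForchheimerPoly) {r : ℝ} (hr : 0 ≤ r) : 0 ≤ baseDensity g r := by
  have := g.K_pos hr
  have := Real.rpow_nonneg hr 2
  rw [baseDensity]
  positivity

theorem continuousOn_K_mul_rpow (g : ForchheimerPoly) {s : ℝ} (hs : 0 ≤ s) :
    ContinuousOn (fun r : ℝ => g.K r * r ^ s) (Ici 0) :=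
  g.continuousOn_K.mul (Real.continuous_rpow_const hs).continuousOn

/-- Comparison of space-time integrals from a pointwise comparison of weighted densities. -/
theorem integral_gradInt_le {U : Set (EuclideanSpace ℝ (Fin n))}
    {p : EuclideanSpace ℝ (Fin n) → ℝ → ℝ} {B : ℝ} {ψ : EuclideanSpace ℝ (Fin n) → ℝ}
    (hU : IsOpen U) (hp : IsC21On U p) (hψ : IsCutoff U B ψ) {f f₁ f₂ : ℝ → ℝ}
    (hf : ContinuousOn f (Ici 0)) (hf₁ : ContinuousOn f₁ (Ici 0)) (hf₂ : ContinuousOn f₂ (Ici 0))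
    {a b c : ℕ} (ha : a ≠ 0) (hb : b ≠ 0) (hc : c ≠ 0) {A₁ A₂ : ℝ} {t₀ δ t : ℝ} (ht₀ : 0 < t₀)
    (hδ : 0 < δ) (ht : t₀ ≤ t)
    (h : ∀ r τ z, 0 ≤ r → 0 ≤ τ → τ ≤ 1 → 0 ≤ z → z ≤ 1 →
      τ ^ a * (f r * z ^ a) ≤ A₁ * (τ ^ b * (f₁ r * z ^ b)) + A₂ * (f₂ r * z ^ c)) :
    ∫ s in t₀..t, timeWeight t₀ δ s ^ a * gradInt f p ψ a s ≤
      A₁ * (∫ s in t₀..t, timeWeight t₀ δ s ^ b * gradInt f₁ p ψ b s)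
        + A₂ * ∫ s in t₀..t, gradInt f₂ p ψ c s := by
  have hpos : ∀ s ∈ Icc t₀ t, 0 < s := fun s hs => ht₀.trans_le hs.1
  have hτc : ContinuousOn (timeWeight t₀ δ) (Icc t₀ t) :=
    (continuousOn_timeWeight hδ).mono Icc_subset_Ici_self
  have i1 : IntervalIntegrable (fun s => timeWeight t₀ δ s ^ a * gradInt f p ψ a s) volume t₀ t :=
    ((hτc.pow a).mul
      ((continuousOn_gradInt hU hp hψ hf ha).mono hpos)).intervalIntegrable_of_Icc ht
  have i2 : IntervalIntegrable (fun s => timeWeight t₀ δ s ^ b * gradInt f₁ p ψ b s) volume t₀ t :=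
    ((hτc.pow b).mul
      ((continuousOn_gradInt hU hp hψ hf₁ hb).mono hpos)).intervalIntegrable_of_Icc ht
  have i3 : IntervalIntegrable (fun s => gradInt f₂ p ψ c s) volume t₀ t :=
    ((continuousOn_gradInt hU hp hψ hf₂ hc).mono hpos).intervalIntegrable_of_Icc ht
  rw [← intervalIntegral.integral_const_mul, ← intervalIntegral.integral_const_mul,
    ← intervalIntegral.integral_add (i2.const_mul _) (i3.const_mul _)]
  refine intervalIntegral.integral_mono_on ht i1 ((i2.const_mul _).add (i3.const_mul _))
    fun s hs => ?_
  have hs0 := hpos s hs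
  have j1 := (integrable_gradInt hU hp hψ hf ha hs0).const_mul (timeWeight t₀ δ s ^ a)
  have j2 := ((integrable_gradInt hU hp hψ hf₁ hb hs0).const_mul
    (timeWeight t₀ δ s ^ b)).const_mul A₁
  have j3 := (integrable_gradInt hU hp hψ hf₂ hc hs0).const_mul A₂
  simp only [gradInt, ← integral_const_mul]
  rw [← integral_add j2 j3]
  exact integral_mono j1 (j2.add j3) fun x => h _ _ _ (norm_nonneg _)
    (timeWeight_nonneg hδ hs.1) (timeWeight_le_one hδ hs.1) (hψ.nonneg x) (hψ.le_one x)

theorem rpow_natCast_add {r : ℝ} (hr : 0 ≤ r) {σ : ℝ} (hσ : 0 ≤ σ) (l : ℕ) :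
    r ^ σ * r ^ l = r ^ (σ + l) := by
  rw [Real.rpow_add_of_nonneg hr hσ (Nat.cast_nonneg l), Real.rpow_natCast]

/-- The interior estimate of `∬ K(|∇p|) |∇p|^s` for `s ≥ 4`. -/
theorem exists_integral_flux_le_of_four_le (n : ℕ) (g : ForchheimerPoly) (B : ℝ) {s : ℝ}
    (hs : 4 ≤ s) {m : ℕ} (hm : s - 2 ≤ m) :
    ∃ C : ℝ, 0 < C ∧ ∀ (U : Set (EuclideanSpace ℝ (Fin n)))
      (p : EuclideanSpace ℝ (Fin n) → ℝ → ℝ) (ψ : EuclideanSpace ℝ (Fin n) → ℝ),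
      IsOpen U → IsForchheimerSolution g U p → IsCutoff U B ψ →
      ∀ t₀ δ t M : ℝ, 0 < t₀ → 0 < δ → t₀ ≤ t → 0 ≤ M →
      (∀ x ∈ tsupport ψ, ∀ r ∈ Icc t₀ t, |p x r| ≤ M) →
      ∫ r in t₀..t, timeWeight t₀ δ r ^ (2 * m + 2) *
        gradInt (fun r => g.K r * r ^ s) p ψ (2 * m + 2) r ≤
      C * ((1 + M ^ 2) * (1 + δ⁻¹)) ^ (s - 2) * ∫ r in t₀..t, gradInt (baseDensity g) p ψ 2 r := by
  obtain ⟨l, rfl⟩ : ∃ l, m = l + 1 := by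
    refine ⟨m - 1, ?_⟩
    have : m ≠ 0 := by
      rintro rfl
      norm_num at hm
      linarith
    omega
  have hl : s - 3 ≤ l := by
    push_cast at hm
    linarith
  have hσ : 0 ≤ s - 4 := by linarith
  have hc := g.root_pos one_pos
  -- C₀ - 1 is the constant of `IsForchheimerSolution.integral_flux_le`; the added 1 keeps C₀
  -- positive without further case distinctions.
  set C₀ := 1 + 2 * ((n * (s - 4 + 4)) ^ 2 * (2 / (1 - g.a)) * energyConst' n g B (l + 1)
        + (n * ((2 * ((l + 1 : ℕ) : ℝ) + 2) * B)) ^ 2 / g.coeff 0) with hC₀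
  have hC₀1 : 0 ≤ C₀ - 1 := by
    have h1 := energyConst'_pos (n := n) g B (l + 1)
    have h2 := g.coeff_zero_pos
    have h3 : 0 < 1 - g.a := by linarith [g.a_lt_one]
    rw [hC₀, add_sub_cancel_left]
    positivity
  have hC₀0 : 0 < C₀ := by linarith
  refine ⟨2 * (C₀ + 1 / 2 * (2 * C₀ / g.root 1) ^ (s - 2)), by positivity, ?_⟩
  intro U p ψ hU hp hψ t₀ δ t M ht₀ hδ ht hM0 hM
  have hr := hp.regular
  set Λ := (1 + M ^ 2) * (1 + δ⁻¹) with hΛ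
  have hδi : 0 < δ⁻¹ := inv_pos.2 hδ
  have hΛ1 : 1 ≤ Λ := by
    rw [hΛ]
    nlinarith [sq_nonneg M, mul_nonneg (sq_nonneg M) hδi.le]
  have hΛ0 : 0 < Λ := by linarith
  have key := hp.integral_flux_le hU hσ hψ (m := l + 1) (by omega) ht₀ hδ ht hM0 hM
  have hZ : ∀ r, gradInt (fun r => g.K r * (r ^ (s - 4) * r ^ 4)) p ψ (2 * (l + 1) + 2) r
      = gradInt (fun r => g.K r * r ^ s) p ψ (2 * (l + 1) + 2) r := fun r => by
    simp only [gradInt]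
    congr 1
    funext x
    rw [rpow_natCast_add (norm_nonneg _) hσ]
    norm_num
  have hW : ∀ r, gradInt (fun r => r ^ (s - 4) * r ^ 2) p ψ (2 * (l + 1)) r
      = gradInt (fun r => r ^ (s - 2)) p ψ (2 * (l + 1)) r := fun r => by
    simp only [gradInt]
    congr 1
    funext x
    rw [rpow_natCast_add (norm_nonneg _) hσ]
    congr 2
    push_cast
    ring
  simp only [hZ, hW] at key
  set IZ := ∫ r in t₀..t, timeWeight t₀ δ r ^ (2 * (l + 1) + 2) *
        gradInt (fun r => g.K r * r ^ s) p ψ (2 * (l + 1) + 2) r with hIZ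
  set IW := ∫ r in t₀..t, timeWeight t₀ δ r ^ (2 * (l + 1)) *
        gradInt (fun r => r ^ (s - 2)) p ψ (2 * (l + 1)) r with hIW
  set IN := ∫ r in t₀..t, gradInt (baseDensity g) p ψ 2 r with hIN
  have hIW0 : 0 ≤ IW := intervalIntegral.integral_nonneg ht fun s hs' =>
    mul_nonneg (pow_nonneg (timeWeight_nonneg hδ hs'.1) _)
      (gradInt_nonneg hψ (fun r hr => by positivity) s)
  have hIN0 : 0 ≤ IN := intervalIntegral.integral_nonneg ht fun s hs' =>
      (gradInt_nonneg hψ (fun r hr => baseDensity_nonneg g hr) s)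
  set A := C₀ * Λ with hA
  have hA0 : 0 ≤ A := by positivity
  have h1 : IZ ≤ A * IW := by
    refine key.trans (mul_le_mul_of_nonneg_right ?_ hIW0)
    have h2 : 2 * ((n * (s - 4 + 4)) ^ 2 * (2 / (1 - g.a)) * energyConst' n g B (l + 1)
        + (n * ((2 * ((l + 1 : ℕ) : ℝ) + 2) * B)) ^ 2 / g.coeff 0) = C₀ - 1 := by
      rw [hC₀]
      ring
    rw [h2, hA]
    refine mul_le_mul (by linarith) ?_ (by positivity) hC₀0.le
    rw [hΛ]
    gcongr
    linarith
  -- Half of `IZ` returns on the right and is absorbed. This is legitimate because `IZ` is a finite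
  -- real: the integrand is continuous in time on [t₀, t] and t₀ > 0.
  have h3 : A * IW ≤ 1 / 2 * IZ + (A + 1 / 2 * (2 * A / g.root 1) ^ (s - 2)) * IN := by
    have h4 := integral_gradInt_le hU hr hψ (f := fun r => A * r ^ (s - 2))
      (f₁ := fun r => g.K r * r ^ s) (f₂ := baseDensity g) (a := 2 * (l + 1))
      (b := 2 * (l + 1) + 2) (c := 2) (A₁ := 1 / 2)
      (A₂ := A + 1 / 2 * (2 * A / g.root 1) ^ (s - 2))
      (continuousOn_const.mul (Real.continuous_rpow_const (by linarith)).continuousOn)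
      (continuousOn_K_mul_rpow g (by linarith)) (continuousOn_baseDensity g) (by omega) (by omega)
      (by omega) ht₀ hδ ht ?_
    · have h5 : A * IW = ∫ r in t₀..t, timeWeight t₀ δ r ^ (2 * (l + 1)) *
          gradInt (fun r => A * r ^ (s - 2)) p ψ (2 * (l + 1)) r := by
        rw [hIW, ← intervalIntegral.integral_const_mul]
        congr 1
        funext r
        simp only [gradInt, mul_assoc, integral_const_mul]
        ring
      rw [h5]
      exact h4
    · intro r τ z hr0 hτ0 hτ1 hz0 hz1
      -- Time and space weights enter as the single variable y = (τψ)²; the powers 2m and 2m+2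
      -- become l+1 and l+2.
      have hy0 : 0 ≤ (τ * z) ^ 2 := sq_nonneg _
      have hτz : τ * z ≤ z := mul_le_of_le_one_left hz0 hτ1
      have hyz : (τ * z) ^ 2 ≤ z ^ 2 := pow_le_pow_left₀ (by positivity) hτz 2
      have hy1 : (τ * z) ^ 2 ≤ 1 := hyz.trans (pow_le_one₀ hz0 hz1)
      have h6 := g.rpow_sub_two_mul_pow_le hs hl hA0 hr0 hy0 hy1
      have h7 : 0 ≤ A + 1 / 2 * (2 * A / g.root 1) ^ (s - 2) := by positivity
      have h8 := mul_le_mul_of_nonneg_left (mul_le_mul_of_nonneg_left hyz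
        (baseDensity_nonneg g hr0)) h7
      have h9 : τ ^ (2 * (l + 1)) * (A * r ^ (s - 2) * z ^ (2 * (l + 1)))
          = A * (r ^ (s - 2) * ((τ * z) ^ 2) ^ (l + 1)) := by ring
      have h10 : τ ^ (2 * (l + 1) + 2) * (g.K r * r ^ s * z ^ (2 * (l + 1) + 2))
          = g.K r * r ^ s * ((τ * z) ^ 2) ^ (l + 2) := by ring
      rw [h9, h10]
      exact h6.trans (add_le_add le_rfl h8)
  -- Since A = C₀Λ with Λ ≥ 1 and s-2 ≥ 1, the linear term in Λ is also at most a multiple of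
  -- Λ^(s-2).
  have h11 : A + 1 / 2 * (2 * A / g.root 1) ^ (s - 2)
      ≤ (C₀ + 1 / 2 * (2 * C₀ / g.root 1) ^ (s - 2)) * Λ ^ (s - 2) := by
    have h12 : 2 * A / g.root 1 = 2 * C₀ / g.root 1 * Λ := by
      rw [hA]
      ring
    have h13 : Λ ≤ Λ ^ (s - 2) := Real.self_le_rpow_of_one_le hΛ1 (by linarith)
    rw [h12, Real.mul_rpow (by positivity) hΛ0.le, hA]
    have h14 := mul_le_mul_of_nonneg_left h13 hC₀0.le
    linarith
  have h15 := mul_le_mul_of_nonneg_right h11 hIN0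
  linarith

/-- The interior estimate of `∬ K(|∇p|) |∇p|^s` for `s ≥ 2`. -/
theorem exists_integral_flux_le (n : ℕ) (g : ForchheimerPoly) (B : ℝ) {s : ℝ}
    (hs : 2 ≤ s) {m : ℕ} (hm : s ≤ m) :
    ∃ C : ℝ, 0 < C ∧ ∀ (U : Set (EuclideanSpace ℝ (Fin n)))
      (p : EuclideanSpace ℝ (Fin n) → ℝ → ℝ) (ψ : EuclideanSpace ℝ (Fin n) → ℝ),
      IsOpen U → IsForchheimerSolution g U p → IsCutoff U B ψ →
      ∀ t₀ δ t M : ℝ, 0 < t₀ → 0 < δ → t₀ ≤ t → 0 ≤ M →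
      (∀ x ∈ tsupport ψ, ∀ r ∈ Icc t₀ t, |p x r| ≤ M) →
      ∫ r in t₀..t, timeWeight t₀ δ r ^ (2 * m + 2) *
        gradInt (fun r => g.K r * r ^ s) p ψ (2 * m + 2) r ≤
      C * ((1 + M ^ 2) * (1 + δ⁻¹)) ^ (s - 2) * ∫ r in t₀..t, gradInt (baseDensity g) p ψ 2 r := by
  rcases le_or_gt 4 s with h4 | h4
  · exact exists_integral_flux_le_of_four_le n g B h4 (by linarith)
  obtain ⟨C, hC, hmain⟩ := exists_integral_flux_le_of_four_le n g B (le_refl 4) (m := m)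
    (by linarith)
  refine ⟨1 + C, by positivity, ?_⟩
  intro U p ψ hU hp hψ t₀ δ t M ht₀ hδ ht hM0 hM
  have hr := hp.regular
  have key := hmain U p ψ hU hp hψ t₀ δ t M ht₀ hδ ht hM0 hM
  set Λ := (1 + M ^ 2) * (1 + δ⁻¹) with hΛ
  have hδi : 0 < δ⁻¹ := inv_pos.2 hδ
  have hΛ1 : 1 ≤ Λ := by
    rw [hΛ]
    nlinarith [sq_nonneg M, mul_nonneg (sq_nonneg M) hδi.le]
  have hΛ0 : 0 < Λ := by linarith
  -- With threshold Λ, the case of exponent 4 contributes Λ^(s-4) Λ² = Λ^(s-2), the same power as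
  -- the base term.
  have h1 := integral_gradInt_le hU hr hψ (f := fun r => g.K r * r ^ s)
      (f₁ := fun r => g.K r * r ^ (4 : ℝ)) (f₂ := baseDensity g) (a := 2 * m + 2)
      (b := 2 * m + 2) (c := 2) (A₁ := Λ ^ (s - 4)) (A₂ := Λ ^ (s - 2))
      (continuousOn_K_mul_rpow g (by linarith))
      (continuousOn_K_mul_rpow g (by linarith)) (continuousOn_baseDensity g) (by omega) (by omega)
      (by omega) ht₀ hδ ht (by
    intro r τ z hr0 hτ0 hτ1 hz0 hz1
    have hK := g.K_pos hr0
    have p1 := Real.rpow_nonneg hΛ0.le (s - 2)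
    have h2 := rpow_le_add_rpow hs h4.le hΛ1 hr0
    have h3 : τ ^ (2 * m + 2) * z ^ (2 * m + 2) ≤ z ^ 2 := by
      have := mul_le_mul (pow_le_one₀ hτ0 hτ1 (n := 2 * m + 2))
        (pow_le_pow_of_le_one hz0 hz1 (by omega : 2 ≤ 2 * m + 2)) (by positivity) zero_le_one
      simpa using this
    have hw : 0 ≤ τ ^ (2 * m + 2) * z ^ (2 * m + 2) := by positivity
    have h5 := mul_le_mul_of_nonneg_left h2 (mul_nonneg hw hK.le)
    have h6 : g.K r * r ^ (2 : ℝ) ≤ baseDensity g r := by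
      rw [baseDensity]
      linarith
    have h7 : g.K r * r ^ (2 : ℝ) * (τ ^ (2 * m + 2) * z ^ (2 * m + 2))
        ≤ baseDensity g r * z ^ 2 :=
      mul_le_mul h6 h3 hw (baseDensity_nonneg g hr0)
    have h8 := mul_le_mul_of_nonneg_left h7 p1
    linarith)
  have p2 := Real.rpow_nonneg hΛ0.le (s - 4)
  have h2 := mul_le_mul_of_nonneg_left key p2
  have h3 : Λ ^ (s - 4) * Λ ^ ((4 : ℝ) - 2) = Λ ^ (s - 2) := by
    rw [← Real.rpow_add hΛ0]
    congr 1
    ring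
  refine h1.trans ((add_le_add h2 le_rfl).trans (le_of_eq ?_))
  rw [← h3]
  ring

/-- The interior estimate of `sup_t ∫ |∇p|^s` for `s ≥ 2`. -/
theorem exists_integral_rpow_grad_le (n : ℕ) (g : ForchheimerPoly) (B : ℝ) {s : ℝ}
    (hs : 2 ≤ s) {m : ℕ} (hm : s + g.a + 1 ≤ m) :
    ∃ C : ℝ, 0 < C ∧ ∀ (U : Set (EuclideanSpace ℝ (Fin n)))
      (p : EuclideanSpace ℝ (Fin n) → ℝ → ℝ) (ψ : EuclideanSpace ℝ (Fin n) → ℝ),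
      IsOpen U → IsForchheimerSolution g U p → IsCutoff U B ψ →
      ∀ t₀ δ t M : ℝ, 0 < t₀ → 0 < δ → t₀ ≤ t → 0 ≤ M →
      (∀ x ∈ tsupport ψ, ∀ r ∈ Icc t₀ t, |p x r| ≤ M) →
      timeWeight t₀ δ t ^ (2 * m + 2) * gradInt (fun r => r ^ s) p ψ (2 * m + 2) t ≤
      C * ((1 + δ⁻¹) * ((1 + M ^ 2) * (1 + δ⁻¹)) ^ (s + g.a - 2)) *
        ∫ r in t₀..t, gradInt (baseDensity g) p ψ 2 r := by
  have ha0 := g.a_pos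
  obtain ⟨l, rfl⟩ : ∃ l, m = l + 1 := by
    refine ⟨m - 1, ?_⟩
    have : m ≠ 0 := by
      rintro rfl
      norm_num at hm
      linarith
    omega
  have hl : s + g.a ≤ l := by
    push_cast at hm
    linarith
  -- The flux estimate is taken with l = m-1: its weight power 2l+2 equals the power 2m on the right
  -- of the energy inequality.
  obtain ⟨C, hC, hmain⟩ := exists_integral_flux_le n g B (s := s + g.a) (by linarith) hl
  obtain ⟨c, hc, hKc⟩ := g.exists_le_rpow_a_mul_K
  have hE := energyConst'_pos (n := n) g B (l + 1)
  refine ⟨s * energyConst' n g B (l + 1) * (1 + c⁻¹ * C), by positivity, ?_⟩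
  intro U p ψ hU hp hψ t₀ δ t M ht₀ hδ ht hM0 hM
  have hr := hp.regular
  have key := hmain U p ψ hU hp hψ t₀ δ t M ht₀ hδ ht hM0 hM
  have hσ : 0 ≤ s - 2 := by linarith
  have hen := hp.energy_le hU hσ hψ (m := l + 1) (by omega) ht₀ hδ ht
  set Λ := (1 + M ^ 2) * (1 + δ⁻¹) with hΛ
  have hδi : 0 < δ⁻¹ := inv_pos.2 hδ
  have hΛ1 : 1 ≤ Λ := by
    rw [hΛ]
    nlinarith [sq_nonneg M, mul_nonneg (sq_nonneg M) hδi.le]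
  have hW : ∀ r, gradInt (fun r => r ^ (s - 2) * r ^ 2) p ψ (2 * (l + 1)) r
      = gradInt (fun r => r ^ s) p ψ (2 * l + 2) r := fun r => by
    simp only [gradInt]
    congr 1
    funext x
    rw [rpow_natCast_add (norm_nonneg _) hσ]
    norm_num
    left
    ring
  have he : gradInt (fun r => r ^ (s - 2 + 2) / (s - 2 + 2)) p ψ (2 * (l + 1) + 2) t
      = s⁻¹ * gradInt (fun r => r ^ s) p ψ (2 * (l + 1) + 2) t := by
    simp only [gradInt]
    rw [← integral_const_mul]
    congr 1
    funext x
    rw [sub_add_cancel]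
    ring
  simp only [hW] at hen
  rw [he] at hen
  set IN := ∫ r in t₀..t, gradInt (baseDensity g) p ψ 2 r with hIN
  have hIN0 : 0 ≤ IN := intervalIntegral.integral_nonneg ht fun s hs' =>
      (gradInt_nonneg hψ (fun r hr => baseDensity_nonneg g hr) s)
  have h1 : 0 ≤ (1 - g.a) / 2 * (∫ s_1 in t₀..t, timeWeight t₀ δ s_1 ^ (2 * (l + 1) + 2) *
      hessInt g (s - 2) p ψ (2 * (l + 1) + 2) s_1) := by
    refine mul_nonneg (by linarith [g.a_lt_one]) (intervalIntegral.integral_nonneg ht fun r hr' =>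
      mul_nonneg (pow_nonneg (timeWeight_nonneg hδ hr'.1) _) (integral_nonneg fun x => ?_))
    have := g.K_pos (norm_nonneg (spaceGrad p x r))
    have := frobSq_nonneg (fderiv ℝ (fun x => spaceGrad p x r) x)
    have := hψ.pow_nonneg (2 * (l + 1) + 2) x
    simp only [Pi.zero_apply]
    positivity
  have h2 := integral_gradInt_le hU hr hψ (f := fun r => r ^ s)
      (f₁ := fun r => g.K r * r ^ (s + g.a)) (f₂ := baseDensity g) (a := 2 * l + 2)
      (b := 2 * l + 2) (c := 2) (A₁ := c⁻¹) (A₂ := 1)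
      (Real.continuous_rpow_const (by linarith)).continuousOn
      (continuousOn_K_mul_rpow g (by linarith)) (continuousOn_baseDensity g) (by omega) (by omega)
      (by omega) ht₀ hδ ht (by
    intro r τ z hr0 hτ0 hτ1 hz0 hz1
    have hK := g.K_pos hr0
    have hw : 0 ≤ τ ^ (2 * l + 2) * z ^ (2 * l + 2) := by positivity
    have h3 : τ ^ (2 * l + 2) * z ^ (2 * l + 2) ≤ z ^ 2 := by
      have := mul_le_mul (pow_le_one₀ hτ0 hτ1 (n := 2 * l + 2))
        (pow_le_pow_of_le_one hz0 hz1 (by omega : 2 ≤ 2 * l + 2)) (by positivity) zero_le_one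
      simpa using this
    have hf : 0 ≤ g.K r * r ^ (s + g.a) := mul_nonneg hK.le (Real.rpow_nonneg hr0 _)
    -- For r > 1 the decay bound r^a K(r) ≥ c gives it; for r ≤ 1 the constant 1 suffices and is
    -- part of the base density.
    have h6 : r ^ s ≤ 1 + c⁻¹ * (g.K r * r ^ (s + g.a)) := by
      rcases le_or_gt r 1 with h | h
      · have := Real.rpow_le_one hr0 h (by linarith : 0 ≤ s)
        have : 0 ≤ c⁻¹ * (g.K r * r ^ (s + g.a)) := by positivity
        linarith
      · have h7 := hKc r h.le
        have h8 : r ^ s ≤ c⁻¹ * (g.K r * r ^ (s + g.a)) := by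
          rw [le_inv_mul_iff₀ hc, Real.rpow_add (by linarith)]
          have := mul_le_mul_of_nonneg_left h7 (Real.rpow_nonneg hr0 s)
          linarith
        linarith
    have h9 := mul_le_mul_of_nonneg_left h6 hw
    have h10 : (1 : ℝ) ≤ baseDensity g r := by
      rw [baseDensity]
      have := mul_nonneg hK.le (Real.rpow_nonneg hr0 2)
      linarith
    have h11 : 1 * (τ ^ (2 * l + 2) * z ^ (2 * l + 2)) ≤ baseDensity g r * z ^ 2 :=
      mul_le_mul h10 h3 hw (baseDensity_nonneg g hr0)
    linarith)
  have hΛp : 1 ≤ Λ ^ (s + g.a - 2) := Real.one_le_rpow hΛ1 (by linarith)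
  set IW := ∫ r in t₀..t, timeWeight t₀ δ r ^ (2 * l + 2) *
    gradInt (fun r => r ^ s) p ψ (2 * l + 2) r with hIW
  set L := Λ ^ (s + g.a - 2) with hL
  have h3 : IW ≤ (1 + c⁻¹ * C) * L * IN := by
    have h4 := mul_le_mul_of_nonneg_left key (inv_nonneg.2 hc.le)
    have h5 := mul_le_mul_of_nonneg_right hΛp hIN0
    linarith
  have hs0 : 0 < s := by linarith
  have h4 : timeWeight t₀ δ t ^ (2 * (l + 1) + 2) *
      (s⁻¹ * gradInt (fun r => r ^ s) p ψ (2 * (l + 1) + 2) t)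
      ≤ energyConst' n g B (l + 1) * (1 + δ⁻¹) * ((1 + c⁻¹ * C) * L * IN) := by
    have h5 := mul_le_mul_of_nonneg_left h3
      (by positivity : 0 ≤ energyConst' n g B (l + 1) * (1 + δ⁻¹))
    have h6 : ∀ r, timeWeight t₀ δ r ^ (2 * (l + 1)) = timeWeight t₀ δ r ^ (2 * l + 2) :=
      fun r => by ring
    simp only [h6] at hen
    linarith
  have h5 := mul_le_mul_of_nonneg_left h4 hs0.le
  refine le_trans (le_of_eq ?_) (h5.trans (le_of_eq ?_))
  · field_simp
  · ring

end InteriorEstimates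

/-! ### Cutoffs, essential suprema and extended integrals -/

section Assembly

open Filter Topology

variable {n : ℕ}

theorem exists_isCutoff {U V U' : Set (EuclideanSpace ℝ (Fin n))} (hV : IsOpen V)
    (hU'V : CompactlyContained U' V) (hVU : CompactlyContained V U) :
    ∃ (B : ℝ) (ψ : EuclideanSpace ℝ (Fin n) → ℝ), IsCutoff U B ψ ∧ tsupport ψ ⊆ V ∧
      ∀ x ∈ U', ψ x = 1 := by
  obtain ⟨W, hWo, hU'W, hWV, hWc⟩ := exists_open_between_and_isCompact_closure hU'V.1 hV hU'V.2
  obtain ⟨φ, hφ1, hφ0, hφ⟩ := exists_contMDiffMap_one_nhds_of_subset_interior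
    (modelWithCornersSelf ℝ (EuclideanSpace ℝ (Fin n))) (n := 1) (isClosed_closure (s := U'))
    (t := W) (by rwa [hWo.interior_eq])
  have hφs : tsupport φ ⊆ closure W :=
    closure_mono fun x hx => by_contra fun hxW => hx (hφ0 x hxW)
  have hφd : ContDiff ℝ 1 φ := φ.contMDiff.contDiff
  have hφc : HasCompactSupport φ := hWc.of_isClosed_subset (isClosed_tsupport _) hφs
  obtain ⟨B, hB⟩ := (hφc.fderiv (𝕜 := ℝ)).exists_bound_of_continuous
    (hφd.continuous_fderiv one_ne_zero)
  exact ⟨B, φ, ⟨hφd, hφc, hφs.trans (hWV.trans (subset_closure.trans hVU.2)),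
    fun x => (hφ x).1, fun x => (hφ x).2, hB⟩, hφs.trans hWV,
    fun x hx => hφ1.self_of_nhdsSet x (subset_closure hx)⟩

/-- The subset of V where the bound fails is open by continuity and null by definition of the
essential supremum, hence empty. -/
theorem norm_le_of_eLpNorm_top_le {V : Set (EuclideanSpace ℝ (Fin n))} (hV : IsOpen V)
    {f : EuclideanSpace ℝ (Fin n) → ℝ} (hf : ContinuousOn f V) {c : ENNReal}
    (h : eLpNorm f ⊤ (volume.restrict V) ≤ c) {x : EuclideanSpace ℝ (Fin n)} (hx : x ∈ V) :
    ‖f x‖ₑ ≤ c := by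
  by_contra! hlt
  rw [eLpNorm_exponent_top] at h
  have h1 : ∀ᵐ y ∂volume.restrict V, ‖f y‖ₑ ≤ c :=
    (enorm_ae_le_eLpNormEssSup f _).mono fun y hy => hy.trans h
  rw [ae_restrict_iff' hV.measurableSet] at h1
  have h2 : IsOpen (V ∩ (fun y => ‖f y‖ₑ) ⁻¹' Ioi c) :=
    (continuous_enorm.comp_continuousOn hf).isOpen_inter_preimage hV isOpen_Ioi
  have h3 : volume (V ∩ (fun y => ‖f y‖ₑ) ⁻¹' Ioi c) = 0 := by
    refine measure_mono_null (fun y hy => ?_) h1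
    exact fun h4 => absurd (h4 hy.1) (not_le.2 hy.2)
  have h4 := (h2.measure_eq_zero_iff (μ := volume)).1 h3
  have h5 : x ∈ V ∩ (fun y => ‖f y‖ₑ) ⁻¹' Ioi c := ⟨hx, hlt⟩
  rw [h4] at h5
  exact h5

/-- The essential supremum of a solution over `V` and a compact time interval is finite and bounds
the solution pointwise. -/
theorem IsC21On.exists_sup_eLpNorm_eq {U V : Set (EuclideanSpace ℝ (Fin n))}
    {p : EuclideanSpace ℝ (Fin n) → ℝ → ℝ} (hp : IsC21On U p) (hV : IsOpen V)
    (hVU : CompactlyContained V U) {t₀ t₁ : ℝ} (ht₀ : 0 < t₀) :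
    ∃ M : ℝ, 0 ≤ M ∧ (⨆ t ∈ Icc t₀ t₁,
        (eLpNorm (fun x => p x t) ⊤ (volume.restrict V)) ^ 2) = ENNReal.ofReal (M ^ 2) ∧
      ∀ x ∈ V, ∀ t ∈ Icc t₀ t₁, |p x t| ≤ M := by
  set S := ⨆ t ∈ Icc t₀ t₁, (eLpNorm (fun x => p x t) ⊤ (volume.restrict V)) ^ 2 with hS
  have hpos : ∀ t ∈ Icc t₀ t₁, 0 < t := fun t ht => ht₀.trans_le ht.1
  obtain ⟨P, hP⟩ := (hVU.1.prod isCompact_Icc).exists_bound_of_continuousOn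
    (hp.continuousOn.mono (prod_mono hVU.2 hpos : closure V ×ˢ Icc t₀ t₁ ⊆ U ×ˢ Ioi 0))
  have hfin : S ≠ ⊤ := by
    -- Finiteness: p is bounded on the compact set `closure V ×ˢ Icc t₀ t₁`, which stays away from t
    -- = 0.
    refine ne_top_of_le_ne_top (ENNReal.pow_ne_top (n := 2) (ENNReal.ofReal_ne_top (r := P)))
      (iSup₂_le fun t ht => ?_)
    refine pow_le_pow_left' ?_ 2
    rw [eLpNorm_exponent_top]
    refine eLpNormEssSup_le_of_ae_bound ?_
    rw [ae_restrict_iff' hV.measurableSet]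
    exact Eventually.of_forall fun x hx => hP (x, t) ⟨subset_closure hx, ht⟩
  refine ⟨√S.toReal, Real.sqrt_nonneg _, ?_, fun x hx t ht => ?_⟩
  · rw [Real.sq_sqrt ENNReal.toReal_nonneg, ENNReal.ofReal_toReal hfin]
  · have h1 : ‖p x t‖ₑ ≤ eLpNorm (fun x => p x t) ⊤ (volume.restrict V) :=
      norm_le_of_eLpNorm_top_le hV ((hp.continuousOn.section_left (mem_Ioi.2 (hpos t ht))).mono
        (subset_closure.trans hVU.2)) le_rfl hx
    have h2 : ‖p x t‖ₑ ^ 2 ≤ S := (pow_le_pow_left' h1 2).trans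
      (le_iSup₂ (f := fun t (_ : t ∈ Icc t₀ t₁) =>
        (eLpNorm (fun x => p x t) ⊤ (volume.restrict V)) ^ 2) t ht)
    refine Real.le_sqrt_of_sq_le ?_
    have h3 := ENNReal.toReal_mono hfin h2
    rwa [ENNReal.toReal_pow, toReal_enorm] at h3

variable {U U' : Set (EuclideanSpace ℝ (Fin n))} {p : EuclideanSpace ℝ (Fin n) → ℝ → ℝ}
  {B : ℝ} {ψ : EuclideanSpace ℝ (Fin n) → ℝ}

theorem ofReal_gradInt_eq_lintegral (hU : IsOpen U) (hp : IsC21On U p) (hψ : IsCutoff U B ψ)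
    {f : ℝ → ℝ} (hf : ContinuousOn f (Ici 0)) (hf0 : ∀ r, 0 ≤ r → 0 ≤ f r) {k : ℕ} (hk : k ≠ 0)
    {t : ℝ} (ht : 0 < t) :
    ENNReal.ofReal (gradInt f p ψ k t) =
      ∫⁻ x, ENNReal.ofReal (f ‖spaceGrad p x t‖ * ψ x ^ k) :=
  ofReal_integral_eq_lintegral_ofReal (integrable_gradInt hU hp hψ hf hk ht)
    (Eventually.of_forall fun x => mul_nonneg (hf0 _ (norm_nonneg _)) (hψ.pow_nonneg k x))

theorem setLIntegral_le_ofReal_gradInt (hU : IsOpen U) (hp : IsC21On U p) (hψ : IsCutoff U B ψ)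
    (hU' : IsOpen U') (h1 : ∀ x ∈ U', ψ x = 1)
    {f : ℝ → ℝ} (hf : ContinuousOn f (Ici 0)) (hf0 : ∀ r, 0 ≤ r → 0 ≤ f r) {k : ℕ} (hk : k ≠ 0)
    {t : ℝ} (ht : 0 < t) :
    ∫⁻ x in U', ENNReal.ofReal (f ‖spaceGrad p x t‖) ≤ ENNReal.ofReal (gradInt f p ψ k t) := by
  rw [ofReal_gradInt_eq_lintegral hU hp hψ hf hf0 hk ht]
  refine le_trans (le_of_eq ?_) (setLIntegral_le_lintegral U' _)
  refine setLIntegral_congr_fun hU'.measurableSet fun x hx => ?_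
  simp [h1 x hx]

theorem ofReal_gradInt_le_setLIntegral (hU : IsOpen U) (hp : IsC21On U p) (hψ : IsCutoff U B ψ)
    {f : ℝ → ℝ} (hf : ContinuousOn f (Ici 0)) (hf0 : ∀ r, 0 ≤ r → 0 ≤ f r) {k : ℕ} (hk : k ≠ 0)
    {t : ℝ} (ht : 0 < t) :
    ENNReal.ofReal (gradInt f p ψ k t) ≤ ∫⁻ x in U, ENNReal.ofReal (f ‖spaceGrad p x t‖) := by
  rw [ofReal_gradInt_eq_lintegral hU hp hψ hf hf0 hk ht, ← lintegral_indicator hU.measurableSet]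
  refine lintegral_mono fun x => ?_
  by_cases hx : x ∈ U
  · rw [indicator_of_mem hx]
    exact ENNReal.ofReal_le_ofReal (mul_le_of_le_one_right (hf0 _ (norm_nonneg _))
      (pow_le_one₀ (hψ.nonneg x) (hψ.le_one x)))
  · have : ψ x = 0 := image_eq_zero_of_notMem_tsupport fun h => hx (hψ.tsupport_subset h)
    simp [this, hk]

theorem ofReal_intervalIntegral_eq_lintegral {F : ℝ → ℝ} {t₀ t : ℝ} (ht : t₀ ≤ t)
    (hF : ContinuousOn F (Icc t₀ t)) (hF0 : ∀ r ∈ Icc t₀ t, 0 ≤ F r) :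
    ENNReal.ofReal (∫ r in t₀..t, F r) = ∫⁻ r in Ioo t₀ t, ENNReal.ofReal (F r) := by
  rw [intervalIntegral.integral_of_le ht, integral_Ioc_eq_integral_Ioo]
  refine ofReal_integral_eq_lintegral_ofReal
    (hF.integrableOn_Icc.mono_set Ioo_subset_Icc_self) ?_
  exact (ae_restrict_mem measurableSet_Ioo).mono fun r hr => hF0 r (Ioo_subset_Icc_self hr)

theorem ofReal_integral_gradInt_le (hU : IsOpen U) (hp : IsC21On U p) (hψ : IsCutoff U B ψ)
    (g : ForchheimerPoly) {T₀ t₀ t t₁ : ℝ} (hT₀ : T₀ ≤ t₀) (ht₀ : 0 < t₀) (ht : t₀ ≤ t)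
    (ht₁ : t ≤ t₁) :
    ENNReal.ofReal (∫ r in t₀..t, gradInt (baseDensity g) p ψ 2 r) ≤
      ∫⁻ t in Ioo T₀ t₁, ∫⁻ x in U,
        ENNReal.ofReal (1 + g.K ‖spaceGrad p x t‖ * ‖spaceGrad p x t‖ ^ 2) := by
  rw [ofReal_intervalIntegral_eq_lintegral ht ((continuousOn_gradInt hU hp hψ
    (continuousOn_baseDensity g) two_ne_zero).mono fun r hr => ht₀.trans_le hr.1)
    fun r _ => gradInt_nonneg hψ (fun r hr => baseDensity_nonneg g hr) r]
  refine le_trans ?_ (lintegral_mono_set (Ioo_subset_Ioo hT₀ ht₁))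
  refine setLIntegral_mono' measurableSet_Ioo fun r hr => ?_
  have h1 := ofReal_gradInt_le_setLIntegral hU hp hψ (continuousOn_baseDensity g)
    (fun r hr => baseDensity_nonneg g hr) two_ne_zero (ht₀.trans hr.1)
  simpa only [baseDensity, Real.rpow_two] using h1

/-- Once the time δ has elapsed the weight is at least 1/2, so it can be removed at the cost of 2^k.
-/
theorem le_two_pow_mul_timeWeight {t₀ δ t G : ℝ} (hδ : 0 < δ) (ht : t₀ + δ ≤ t) (hG : 0 ≤ G)
    (k : ℕ) : G ≤ 2 ^ k * (timeWeight t₀ δ t ^ k * G) := by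
  have h1 : 1 ≤ 2 * timeWeight t₀ δ t := by linarith [half_le_timeWeight hδ ht]
  have h2 := mul_le_mul_of_nonneg_right (one_le_pow₀ h1 (n := k)) hG
  rw [mul_pow] at h2
  linarith

theorem lintegral_flux_le_ofReal (hU : IsOpen U) (hp : IsC21On U p) (hψ : IsCutoff U B ψ)
    (hU' : IsOpen U') (h1 : ∀ x ∈ U', ψ x = 1)
    {f : ℝ → ℝ} (hf : ContinuousOn f (Ici 0)) (hf0 : ∀ r, 0 ≤ r → 0 ≤ f r) {k : ℕ} (hk : k ≠ 0)
    {t₀ δ t : ℝ} (ht₀ : 0 < t₀) (hδ : 0 < δ) (ht : t₀ ≤ t) :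
    ∫⁻ r in Ioo (t₀ + δ) t, ∫⁻ x in U', ENNReal.ofReal (f ‖spaceGrad p x r‖) ≤
      ENNReal.ofReal (2 ^ k * ∫ r in t₀..t, timeWeight t₀ δ r ^ k * gradInt f p ψ k r) := by
  have hG0 : ∀ r, 0 ≤ gradInt f p ψ k r := gradInt_nonneg hψ hf0
  rw [← intervalIntegral.integral_const_mul]
  rw [ofReal_intervalIntegral_eq_lintegral ht]
  · refine le_trans ?_ (lintegral_mono_set (Ioo_subset_Ioo_left (by linarith : t₀ ≤ t₀ + δ)))
    refine setLIntegral_mono' measurableSet_Ioo fun r hr => ?_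
    refine (setLIntegral_le_ofReal_gradInt hU hp hψ hU' h1 hf hf0 hk
      (by linarith [hr.1])).trans (ENNReal.ofReal_le_ofReal ?_)
    exact le_two_pow_mul_timeWeight hδ hr.1.le (hG0 r) k
  · refine continuousOn_const.mul ((((continuousOn_timeWeight hδ).mono
      Icc_subset_Ici_self).pow k).mul ?_)
    exact (continuousOn_gradInt hU hp hψ hf hk).mono fun r hr => ht₀.trans_le hr.1
  · exact fun r hr => mul_nonneg (by positivity)
      (mul_nonneg (pow_nonneg (timeWeight_nonneg hδ hr.1) _) (hG0 r))

/-- The real factors of the right-hand side. -/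
theorem rpow_product_le {M κ e : ℝ} (hκ : 0 < κ) (he : 0 ≤ e) :
    ((1 + M ^ 2) * (1 + (κ / 2)⁻¹)) ^ e ≤ 2 ^ e * (1 + κ⁻¹) ^ e * (1 + M ^ 2) ^ e := by
  have h0 : 0 < κ⁻¹ := inv_pos.2 hκ
  have h1 : (κ / 2)⁻¹ = 2 * κ⁻¹ := by rw [inv_div, div_eq_mul_inv]
  rw [← Real.mul_rpow (by norm_num) (by positivity), ← Real.mul_rpow (by positivity) (by positivity),
    h1]
  refine Real.rpow_le_rpow (by positivity) ?_ he
  nlinarith [sq_nonneg M]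

/-- Carries a real estimate over to `ENNReal`, where J may be infinite. Passing from A to the larger
D lets both final inequalities share one constant. -/
theorem ofReal_le_mul_rpow_mul {A F D M e : ℝ} {J : ENNReal} {I : ℝ} (hA : 0 ≤ A)
    (hF : F ≤ A * (1 + M ^ 2) ^ e * I) (hAD : A ≤ D) (he : 0 ≤ e)
    (hI : ENNReal.ofReal I ≤ J) :
    ENNReal.ofReal F ≤ ENNReal.ofReal D * (1 + ENNReal.ofReal (M ^ 2)) ^ e * J := by
  have h1 : (1 + ENNReal.ofReal (M ^ 2)) ^ e = ENNReal.ofReal ((1 + M ^ 2) ^ e) := by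
    rw [← ENNReal.ofReal_rpow_of_nonneg (by positivity) he,
      ENNReal.ofReal_add zero_le_one (sq_nonneg M), ENNReal.ofReal_one]
  rw [h1]
  refine (ENNReal.ofReal_le_ofReal hF).trans ?_
  rw [ENNReal.ofReal_mul (by positivity), ENNReal.ofReal_mul hA]
  gcongr

end Assembly

theorem proposition5p3 {n : ℕ} (hn : 2 ≤ n) (g : ForchheimerPoly)
    (U V U' : Set (EuclideanSpace ℝ (Fin n)))
    (hU : IsOpen U) (hUb : Bornology.IsBounded U) (hV : IsOpen V) (hU' : IsOpen U')
    (hU'V : CompactlyContained U' V) (hVU : CompactlyContained V U)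
    (s : ℝ) (hs : 2 ≤ s) :
    ∃ C : ℝ, 0 < C ∧
      ∀ p : EuclideanSpace ℝ (Fin n) → ℝ → ℝ, IsForchheimerSolution g U p →
      ∀ T₀ T θ : ℝ, 0 ≤ T₀ → 0 < T → 0 < θ → θ < 1 →
        ((∫⁻ t in Ioo (T₀ + θ * T) (T₀ + T), ∫⁻ x in U',
            ENNReal.ofReal (g.K ‖spaceGrad p x t‖ * ‖spaceGrad p x t‖ ^ s))
          ≤ ENNReal.ofReal (C * (1 + (θ * T)⁻¹) ^ (s - 2))
            * (1 + ⨆ t ∈ Icc (T₀ + θ * T / 2) (T₀ + T),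
                (eLpNorm (fun x => p x t) ⊤ (volume.restrict V)) ^ 2) ^ (s - 2)
            * ∫⁻ t in Ioo T₀ (T₀ + T), ∫⁻ x in U,
                ENNReal.ofReal (1 + g.K ‖spaceGrad p x t‖ * ‖spaceGrad p x t‖ ^ 2)) ∧
        ((⨆ t ∈ Icc (T₀ + θ * T) (T₀ + T), ∫⁻ x in U', ENNReal.ofReal (‖spaceGrad p x t‖ ^ s))
          ≤ ENNReal.ofReal (C * (1 + (θ * T)⁻¹) ^ (s + g.a - 1))
            * (1 + ⨆ t ∈ Icc (T₀ + θ * T / 2) (T₀ + T),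
                (eLpNorm (fun x => p x t) ⊤ (volume.restrict V)) ^ 2) ^ (s - 2 + g.a)
            * ∫⁻ t in Ioo T₀ (T₀ + T), ∫⁻ x in U,
                ENNReal.ofReal (1 + g.K ‖spaceGrad p x t‖ * ‖spaceGrad p x t‖ ^ 2)) := by
  obtain ⟨B, ψ, hψ, hψV, hψ1⟩ := exists_isCutoff hV hU'V hVU
  obtain ⟨m, hm⟩ := exists_nat_ge (s + g.a + 1)
  have ha0 := g.a_pos
  obtain ⟨C₁, hC₁, hflux⟩ := exists_integral_flux_le n g B hs (m := m) (by linarith)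
  obtain ⟨C₂, hC₂, hgrad⟩ := exists_integral_rpow_grad_le n g B hs hm
  set k := 2 * m + 2 with hk
  have hk0 : k ≠ 0 := by omega
  -- One summand per inequality: 2^k removes the time weight, and the remaining powers of 2 come
  -- from δ = θT/2 in place of θT.
  refine ⟨2 ^ k * C₁ * 2 ^ (s - 2) + 2 ^ k * C₂ * (2 * 2 ^ (s + g.a - 2)), by positivity, ?_⟩
  intro p hp T₀ T θ hT₀ hT hθ hθ1
  have hr := hp.regular
  have hκ : 0 < θ * T := mul_pos hθ hT
  have hκT : θ * T < T := by nlinarith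
  -- The estimates start at t₀ = T₀ + θT/2 with δ = θT/2. Thus t₀ > 0 even if T₀ = 0, and the weight
  -- is at least 1/2 from T₀ + θT on.
  have hδ : 0 < θ * T / 2 := by linarith
  have ht₀ : 0 < T₀ + θ * T / 2 := by linarith
  have ht₁ : T₀ + θ * T / 2 ≤ T₀ + T := by linarith
  have hκi : 0 < (θ * T)⁻¹ := inv_pos.2 hκ
  obtain ⟨M, hM0, hMeq, hM⟩ := hr.exists_sup_eLpNorm_eq hV hVU (t₁ := T₀ + T) ht₀
  rw [hMeq]
  have hstart : T₀ + θ * T = T₀ + θ * T / 2 + θ * T / 2 := by ring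
  have hKf0 : ∀ r : ℝ, 0 ≤ r → 0 ≤ g.K r * r ^ s := fun r hr =>
    mul_nonneg (g.K_pos hr).le (Real.rpow_nonneg hr s)
  have hIN0 : ∀ t, T₀ + θ * T / 2 ≤ t →
      0 ≤ ∫ r in (T₀ + θ * T / 2)..t, gradInt (baseDensity g) p ψ 2 r := fun t ht =>
    intervalIntegral.integral_nonneg ht fun r _ =>
      gradInt_nonneg hψ (fun r hr => baseDensity_nonneg g hr) r
  constructor
  · have h1 := lintegral_flux_le_ofReal hU hr hψ hU' hψ1 (continuousOn_K_mul_rpow g (by linarith))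
      hKf0 hk0 ht₀ hδ ht₁
    rw [← hstart] at h1
    refine h1.trans (ofReal_le_mul_rpow_mul
      (A := 2 ^ k * C₁ * 2 ^ (s - 2) * (1 + (θ * T)⁻¹) ^ (s - 2)) (by positivity) ?_ ?_
      (by linarith) (ofReal_integral_gradInt_le hU hr hψ g (by linarith) ht₀ ht₁ le_rfl))
    · have h2 := hflux U p ψ hU hp hψ _ _ _ M ht₀ hδ ht₁ hM0
        fun x hx r hr => hM x (hψV hx) r hr
      have h3 := rpow_product_le (M := M) hκ (by linarith : 0 ≤ s - 2)
      have h4 := mul_le_mul_of_nonneg_right (mul_le_mul_of_nonneg_left h3 hC₁.le) (hIN0 _ ht₁)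
      have h5 := mul_le_mul_of_nonneg_left (h2.trans h4) (by positivity : (0 : ℝ) ≤ 2 ^ k)
      linarith
    · refine mul_le_mul_of_nonneg_right ?_ (by positivity)
      exact le_add_of_nonneg_right (by positivity)
  -- For each t the estimate is run on the interval ending at t; enlarging that interval only
  -- increases the integral on the right.
  · refine iSup₂_le fun t ht => ?_
    have ht' : T₀ + θ * T / 2 ≤ t := by linarith [ht.1]
    have h1 := setLIntegral_le_ofReal_gradInt hU hr hψ hU' hψ1
      (Real.continuous_rpow_const (by linarith : 0 ≤ s)).continuousOn
      (fun r hr => Real.rpow_nonneg hr s) hk0 (ht₀.trans_le ht')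
    refine h1.trans (ofReal_le_mul_rpow_mul
      (A := 2 ^ k * C₂ * (2 * 2 ^ (s + g.a - 2)) * (1 + (θ * T)⁻¹) ^ (s + g.a - 1))
      (by positivity) ?_ ?_ (by linarith)
      (ofReal_integral_gradInt_le hU hr hψ g (by linarith) ht₀ ht' ht.2))
    · have h2 := hgrad U p ψ hU hp hψ _ _ t M ht₀ hδ ht' hM0
        fun x hx r hr => hM x (hψV hx) r ⟨hr.1, hr.2.trans ht.2⟩
      have h3 := rpow_product_le (M := M) hκ (by linarith : 0 ≤ s + g.a - 2)
      have h4 : 1 + (θ * T / 2)⁻¹ ≤ 2 * (1 + (θ * T)⁻¹) := by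
        rw [inv_div, div_eq_mul_inv]
        linarith
      have h5 : (1 + (θ * T)⁻¹) ^ (s + g.a - 1)
          = (1 + (θ * T)⁻¹) * (1 + (θ * T)⁻¹) ^ (s + g.a - 2) := by
        rw [show s + g.a - 1 = 1 + (s + g.a - 2) by ring, Real.rpow_add (by positivity),
          Real.rpow_one]
      have h6 := mul_le_mul h4 h3 (by positivity) (by positivity)
      have h7 := mul_le_mul_of_nonneg_right (mul_le_mul_of_nonneg_left h6 hC₂.le) (hIN0 _ ht')
      have h8 := mul_le_mul_of_nonneg_left (h2.trans h7) (by positivity : (0 : ℝ) ≤ 2 ^ k)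
      have h9 := le_two_pow_mul_timeWeight (t₀ := T₀ + θ * T / 2) (t := t) hδ
        (by linarith [ht.1]) (gradInt_nonneg (p := p) (f := fun r => r ^ s) hψ (m := k)
          (fun r hr => Real.rpow_nonneg hr s) t) k
      refine h9.trans (h8.trans (le_of_eq ?_))
      rw [h5, show s - 2 + g.a = s + g.a - 2 by ring]
      ring
    · refine mul_le_mul_of_nonneg_right ?_ (by positivity)
      exact le_add_of_nonneg_left (by positivity)
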